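/- Let $p>2$ be a prime and let $k$ be an algebraically closed field of characteristic $p$. Let $G$ be a cyclic group of order $p$ with generator $\sigma$, acting on $\mathbb{P}^{p-1}_k$ over $k$ by $$\sigma(x_0:x_1:\cdots:x_{p-1})=(x_1:x_2:\cdots:x_{p-1}:x_0).$$ Let $X$ be the closed subscheme of $\mathbb{P}^{p-1}_k$ defined by the homogeneous polynomial $$f_p=X_0X_1\cdots X_{p-1}+\sum_{i=0}^{p-1}X_i^{p-1}X_{i+1},\qquad X_p:=X_0 .$$ Then: 1. $X$ is a hypersurface of degree $p$ in $\mathbb{P}^{p-1}_k$ (a closed subscheme defined by a nonzero form of degree $p$), it is smooth over $k$, irreducible, and of dimension $p-2$. 2. The action of $G$ on $\mathbb{P}^{p-1}_k$ restricts to an action on $X$, and this action has no fixed points: no non-trivial element of $G$ fixes a closed point of $X$. 3. The quotient $Y=X/G$ exists as a scheme over $k$ (its space is the space of $G$-orbits of $X$ with the quotient topology, and its structure sheaf is the sheaf of $G$-invariant sections of $\mathcal{O}_X$). The quotient morphism $\pi:X\to Y$ is étale, and $Y$ is smooth, irreducible and projective over $k$, of dimension $p-2$. -/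

import Mathlib

open CategoryTheory AlgebraicGeometry

universe u

noncomputable section

namespace CyclicQuotient

/-! ### The graded quotient of a graded algebra by a homogeneous ideal -/

section QuotientGrading

variable {k A : Type u} [CommRing k] [CommRing A] [Algebra k A]

/-- The image in `A ⧸ I` of the grading of `A`. -/
def quotGrading (𝒜 : ℕ → Submodule k A) (I : Ideal A) (n : ℕ) : Submodule k (A ⧸ I) :=
  (𝒜 n).map (Ideal.Quotient.mkₐ k I).toLinearMap

variable (𝒜 : ℕ → Submodule k A) (I : Ideal A)

theorem mk_mem_quotGrading {n : ℕ} {a : A} (ha : a ∈ 𝒜 n) :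
    Ideal.Quotient.mk I a ∈ quotGrading 𝒜 I n :=
  Submodule.mem_map_of_mem (f := (Ideal.Quotient.mkₐ k I).toLinearMap) ha

/-- The degree `n` part of `A` maps onto the degree `n` part of `A ⧸ I`. -/
def toQuotGrading (n : ℕ) : 𝒜 n →ₗ[k] quotGrading 𝒜 I n :=
  (Ideal.Quotient.mkₐ k I).toLinearMap.restrict fun _ ha => mk_mem_quotGrading 𝒜 I ha

variable [GradedAlgebra 𝒜]

instance quotGradedMonoid : SetLike.GradedMonoid (quotGrading 𝒜 I) where
  one_mem := by
    simpa using mk_mem_quotGrading 𝒜 I (SetLike.GradedOne.one_mem (A := 𝒜))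
  mul_mem := by
    rintro i j _ _ ⟨a, ha, rfl⟩ ⟨b, hb, rfl⟩
    simpa using mk_mem_quotGrading 𝒜 I (SetLike.GradedMul.mul_mem ha hb)

/-- Taking all the homogeneous components of an element of `A` and reducing them modulo `I`. -/
def decomposeMod : A →ₗ[k] DirectSum ℕ fun i => quotGrading 𝒜 I i :=
  DirectSum.lmap (toQuotGrading 𝒜 I) ∘ₗ (DirectSum.decomposeLinearEquiv 𝒜).toLinearMap

variable {I} in
theorem decomposeMod_eq_zero (hI : I.IsHomogeneous 𝒜) {a : A} (ha : a ∈ I) :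
    decomposeMod 𝒜 I a = 0 := by
  refine DFinsupp.ext fun i => Subtype.ext ?_
  exact Ideal.Quotient.eq_zero_iff_mem.2 (hI i ha)

theorem decomposeMod_of_mem {i : ℕ} {a : A} (ha : a ∈ 𝒜 i) :
    decomposeMod 𝒜 I a =
      DirectSum.of (fun i => quotGrading 𝒜 I i) i ⟨_, mk_mem_quotGrading 𝒜 I ha⟩ := by
  have : DirectSum.decompose 𝒜 a = DirectSum.of (fun i => 𝒜 i) i ⟨a, ha⟩ :=
    DirectSum.decompose_of_mem 𝒜 ha
  simp only [decomposeMod, LinearMap.comp_apply, LinearEquiv.coe_coe,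
    DirectSum.decomposeLinearEquiv_apply, this]
  exact DirectSum.lmap_lof (toQuotGrading 𝒜 I) i ⟨a, ha⟩

variable {I} in
/-- The decomposition of an element of `A ⧸ I` into its homogeneous components. -/
def quotDecompose (hI : I.IsHomogeneous 𝒜) :
    (A ⧸ I) →ₗ[k] DirectSum ℕ fun i => quotGrading 𝒜 I i where
  toFun := Quotient.lift (decomposeMod 𝒜 I) fun a b h => by
    exact sub_eq_zero.1 ((map_sub (decomposeMod 𝒜 I) a b).symm.trans
      (decomposeMod_eq_zero 𝒜 hI ((Submodule.quotientRel_def I).1 h)))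
  map_add' := by
    rintro ⟨a⟩ ⟨b⟩
    exact map_add (decomposeMod 𝒜 I) a b
  map_smul' := by
    rintro c ⟨a⟩
    exact map_smul (decomposeMod 𝒜 I) c a

variable {I} in
/-- `A ⧸ I` is graded by the images of the graded pieces of `A`, if `I` is homogeneous. -/
abbrev quotGradedAlgebra (hI : I.IsHomogeneous 𝒜) : GradedAlgebra (quotGrading 𝒜 I) where
  toGradedMonoid := quotGradedMonoid 𝒜 I
  toDecomposition := DirectSum.Decomposition.ofLinearMap _ (quotDecompose 𝒜 hI)
    (by
      refine LinearMap.ext fun x => ?_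
      obtain ⟨a, rfl⟩ := Ideal.Quotient.mk_surjective x
      induction a using DirectSum.Decomposition.inductionOn 𝒜 with
      | zero => simp
      | @homogeneous i a =>
        change DirectSum.coeLinearMap _ (decomposeMod 𝒜 I a) = _
        rw [decomposeMod_of_mem 𝒜 I a.2]
        exact DirectSum.coeLinearMap_of _ _ _
      | add a b ha hb => rw [map_add, map_add, ha, hb, map_add])
    (by
      refine DirectSum.linearMap_ext _ fun i => LinearMap.ext ?_
      rintro ⟨_, a, ha, rfl⟩
      simp only [LinearMap.comp_apply, DirectSum.lof_eq_of, DirectSum.coeLinearMap_of]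
      exact decomposeMod_of_mem 𝒜 I ha)

end QuotientGrading

/-! ### Projective space and hypersurfaces -/

section ProjectiveSpace

open MvPolynomial HomogeneousIdeal

attribute [local instance] MvPolynomial.gradedAlgebra

variable (σ : Type) (k : Type u) [Field k]

/-- The projective space over `k` with homogeneous coordinates indexed by `σ`,
that is `Proj k[X_i : i ∈ σ]`. -/
def ProjSpace : Scheme.{u} := Proj (homogeneousSubmodule σ k)

/-- The structure morphism of projective space. -/
def ProjSpace.toSpec : ProjSpace σ k ⟶ Spec (.of k) :=
  Proj.toSpecZero (homogeneousSubmodule σ k) ≫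
    Spec.map (CommRingCat.ofHom (algebraMap k (homogeneousSubmodule σ k 0)))

variable {σ k}

/-- A morphism `Y ⟶ Spec k` is projective if it factors through a closed immersion into some
projective space `ℙ^N` over `k`. -/
def IsProjective {Y : Scheme.{u}} (s : Y ⟶ Spec (.of k)) : Prop :=
  ∃ (N : ℕ) (i : Y ⟶ ProjSpace (Fin (N + 1)) k),
    IsClosedImmersion i ∧ i ≫ ProjSpace.toSpec (Fin (N + 1)) k = s

theorem span_isHomogeneous {F : MvPolynomial σ k} {d : ℕ} (hF : F.IsHomogeneous d) :
    (Ideal.span {F}).IsHomogeneous (homogeneousSubmodule σ k) :=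
  Ideal.homogeneous_span _ _ fun _ hx => ⟨d, by rw [Set.mem_singleton_iff.1 hx]; exact hF⟩

/-- The grading of the homogeneous coordinate ring `k[X_i : i ∈ σ] / (F)`. -/
abbrev coordGrading (F : MvPolynomial σ k) :
    ℕ → Submodule k (MvPolynomial σ k ⧸ Ideal.span {F}) :=
  quotGrading (homogeneousSubmodule σ k) (Ideal.span {F})

/-- The closed subscheme of projective space defined by a homogeneous polynomial `F`,
that is `Proj k[X_i : i ∈ σ] / (F)`. -/
def zeroScheme {F : MvPolynomial σ k} {d : ℕ} (hF : F.IsHomogeneous d) : Scheme.{u} :=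
  letI := quotGradedAlgebra (homogeneousSubmodule σ k) (span_isHomogeneous hF)
  Proj (coordGrading F)

/-- The inclusion of the closed subscheme defined by `F` in projective space, induced by the
projection `k[X_i : i ∈ σ] → k[X_i : i ∈ σ] / (F)`. -/
def zeroScheme.ι {F : MvPolynomial σ k} {d : ℕ} (hF : F.IsHomogeneous d) :
    zeroScheme hF ⟶ ProjSpace σ k :=
  letI := quotGradedAlgebra (homogeneousSubmodule σ k) (span_isHomogeneous hF)
  Proj.map (𝒜 := homogeneousSubmodule σ k) (ℬ := coordGrading F)
    { __ := Ideal.Quotient.mk (Ideal.span {F})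
      map_mem := fun h => mk_mem_quotGrading _ _ h }
    ((HomogeneousIdeal.irrelevant_le _).2 fun i hi => by
      rintro _ ⟨a, ha, rfl⟩
      exact Ideal.mem_map_of_mem _ (mem_irrelevant_of_mem _ hi ha))

/-- A morphism `i : Z ⟶ ℙ` to projective space is (the inclusion of) a hypersurface of degree `d`
if it is a closed immersion identifying `Z` with the closed subscheme defined by a nonzero
homogeneous polynomial of degree `d`. -/
def IsHypersurface {Z : Scheme.{u}} (i : Z ⟶ ProjSpace σ k) (d : ℕ) : Prop :=
  IsClosedImmersion i ∧ ∃ (F : MvPolynomial σ k) (hF : F.IsHomogeneous d), F ≠ 0 ∧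
    ∃ e : Z ≅ zeroScheme hF, e.hom ≫ zeroScheme.ι hF = i

/-- The automorphism of the graded ring `k[X_i : i ∈ σ]` given by a permutation of the
variables. -/
def permHom (e : Equiv.Perm σ) : homogeneousSubmodule σ k →+*ᵍ homogeneousSubmodule σ k where
  __ := (rename e : MvPolynomial σ k →ₐ[k] MvPolynomial σ k).toRingHom
  map_mem := fun h => IsHomogeneous.rename_isHomogeneous h

theorem irrelevant_le_map_permHom (e : Equiv.Perm σ) :
    irrelevant (homogeneousSubmodule σ k) ≤
      (irrelevant (homogeneousSubmodule σ k)).map (permHom e) :=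
  (HomogeneousIdeal.irrelevant_le _).2 fun i hi a ha => by
    have h : permHom e (rename e.symm a) = a := by
      change rename e (rename e.symm a) = a
      simp [rename_rename]
    rw [← h]
    exact Ideal.mem_map_of_mem _
      (mem_irrelevant_of_mem _ hi (IsHomogeneous.rename_isHomogeneous ha))

/-- The morphism `(x_i)_i ↦ (x_{e i})_i` from projective space to itself: it pulls the coordinate
`X_i` back to `X_{e i}`. -/
def permMap (e : Equiv.Perm σ) : ProjSpace σ k ⟶ ProjSpace σ k :=
  Proj.map (permHom e) (irrelevant_le_map_permHom e)

theorem permMap_one : permMap (k := k) (1 : Equiv.Perm σ) = 𝟙 _ := by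
  have h : permHom (k := k) (1 : Equiv.Perm σ) = GradedRingHom.id _ := by
    ext1 x
    exact rename_id_apply x
  refine Eq.trans ?_ (Proj.map_id (𝒜 := homogeneousSubmodule σ k))
  simp only [permMap, h]
  rfl

theorem permMap_comp (e e' : Equiv.Perm σ) :
    permMap (k := k) e ≫ permMap e' = permMap (e * e') := by
  have h : permHom (k := k) (e * e') = (permHom e).comp (permHom e') := by
    ext1 x
    exact (rename_rename e' e x).symm
  refine (Proj.map_comp (permHom (k := k) e') (permHom e) (irrelevant_le_map_permHom e')
    (irrelevant_le_map_permHom e)).symm.trans ?_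
  simp only [permMap, h]

variable (k) in
/-- The action of the cyclic group of order `p` on the projective space with homogeneous
coordinates `X_i`, `i ∈ ℤ/p`, in which `c` acts by `(x_i)_i ↦ (x_{i + c})_i`. The generator `1`
acts by the cyclic shift `(x_0 : x_1 : ⋯ : x_{p-1}) ↦ (x_1 : x_2 : ⋯ : x_0)`. -/
def shiftAction (p : ℕ) : Multiplicative (ZMod p) →* Aut (ProjSpace (ZMod p) k) where
  toFun g :=
    { hom := permMap (Equiv.addRight g.toAdd)
      inv := permMap (Equiv.addRight (-g.toAdd))
      hom_inv_id := by
        rw [permMap_comp, ← permMap_one]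
        congr 1
        ext i
        simp
      inv_hom_id := by
        rw [permMap_comp, ← permMap_one]
        congr 1
        ext i
        simp }
  map_one' := by
    refine Iso.ext ((congrArg permMap ?_).trans permMap_one)
    ext i
    simp
  map_mul' g h := by
    refine Iso.ext (Eq.trans ?_ (permMap_comp _ _).symm)
    change permMap _ = permMap _
    congr 1
    ext i
    simp [add_comm]

end ProjectiveSpace

/-! ### Quotients by group actions -/

section Quotient

variable {G : Type} [Group G] {X Y : Scheme.{u}}

/-- `π : X ⟶ Y` is the quotient of the scheme `X` by the action `ρ` of the group `G`, as a (locally)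
ringed space: `Y` carries the quotient topology of the space of orbits, and the sections of `𝒪_Y`
over `U` are exactly the `G`-invariant sections of `𝒪_X` over `π⁻¹ U`. This determines `Y` and `π`
up to a unique isomorphism. -/
structure IsQuotient (ρ : G →* Aut X) (π : X ⟶ Y) : Prop where
  invariant : ∀ g, (ρ g).hom ≫ π = π
  isQuotientMap : Topology.IsQuotientMap π
  eq_iff : ∀ x y : X, π x = π y ↔ ∃ g, (ρ g).hom x = y
  app_injective : ∀ U : Y.Opens, Function.Injective (π.app U)
  range_app : ∀ U : Y.Opens, Set.range (π.app U) =
    {s : Γ(X, π ⁻¹ᵁ U) | ∀ g, (ρ g).hom.appLE (π ⁻¹ᵁ U) (π ⁻¹ᵁ U)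
      (by rw [← Scheme.Hom.comp_preimage, invariant g]) s = s}

end Quotient

/-! ### The hypersurface -/

section Hypersurface

open MvPolynomial

variable (p : ℕ) [Fact p.Prime] (k : Type u) [Field k]

/-- The polynomial `X_0 ⋯ X_{p-1} + ∑ X_i ^ (p-1) X_{i+1}`, with indices in `ℤ/p`. -/
def poly : MvPolynomial (ZMod p) k :=
  ∏ i, X i + ∑ i, X i ^ (p - 1) * X (i + 1)

theorem poly_isHomogeneous : (poly p k).IsHomogeneous p := by
  refine IsHomogeneous.add ?_ (IsHomogeneous.sum _ _ _ fun i _ => ?_)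
  · have h := IsHomogeneous.prod (R := k) (Finset.univ : Finset (ZMod p)) X (fun _ => 1)
      fun i _ => isHomogeneous_X k i
    simpa [ZMod.card] using h
  · have h := ((isHomogeneous_X k i).pow (p - 1)).mul (isHomogeneous_X k (i + 1))
    rwa [one_mul, Nat.sub_add_cancel (Fact.out (p := p.Prime)).one_le] at h

/-- The closed subscheme of `ℙ^{p-1}` defined by `poly p k`. -/
def hypersurface : Scheme.{u} := zeroScheme (poly_isHomogeneous p k)

/-- The inclusion of the hypersurface in `ℙ^{p-1}`. -/
def hypersurface.ι : hypersurface p k ⟶ ProjSpace (ZMod p) k :=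
  zeroScheme.ι (poly_isHomogeneous p k)

/-- The structure morphism of the hypersurface. -/
def hypersurface.toSpec : hypersurface p k ⟶ Spec (.of k) :=
  hypersurface.ι p k ≫ ProjSpace.toSpec (ZMod p) k

end Hypersurface

end CyclicQuotient

end

/-!
Write `f` for the equation, `m j` for `x_j ^ (p - 1) x_{j+1}` and `P` for the product of the
coordinates. At a singular point of the affine cone of `X` the equations `x_j ∂_j f = 0` say that
`m j = m (j - 1) + P`; as the sum of the `m j` is then `0` (here `p > 2`), `f = 0` gives `P = 0`, and
all coordinates vanish one after the other (`eq_zero_of_eval_poly`). The Jacobian criterion shows that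
the affine charts of `X` are smooth (`smooth_quotient_of_eval`), and `X` is irreducible because the
factors of a reducible form in at least three variables have a common zero, where it is singular
(`irreducible_of_isHomogeneous`). A closed point fixed by a nontrivial shift would have all its
coordinates equal, because `1` is the only `p`-th root of unity in characteristic `p`, and `f` does not
vanish there (`hypersurfaceAction_ne`).

The quotient is constructed for any finite commutative group `G` that acts on a finitely generated
graded algebra `S`. Symmetric functions of the conjugates of linear forms give invariant forms of the
same degree without a common zero; adding numerators of generators of the rings of invariant fractions,
which are finitely generated by the Artin–Tate argument, one gets finitely many invariant forms of the
same degree whose quotients generate all these rings (`exists_invariant_family`). They define a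
morphism `Proj S ⟶ ℙ^N` (`exists_invariant_morphism`) whose scheme-theoretic image `Y` has the rings of
invariants as affine coordinate rings (`IsInvariantChart`). So `Y` is projective by construction,
and invariants commute with localization, which gives that `Y` is the quotient as a ringed space
(`isQuotient_of_invariantChart`).

Since `G` has no fixed closed points, the elements `g b - b` generate the unit ideal of each chart for
`g ≠ 1`. By the argument of Chase, Harrison and Rosenberg the coordinate ring of the chart is then
finite étale over the invariants (`finite_and_etale_of_free`). Smoothness descends from `X` to `Y`
because differentials and the first cotangent homology commute with étale base change
(`smooth_of_etale_of_smooth`), and the dimensions agree because the extension is integral.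
-/

noncomputable section

namespace CyclicQuotient

/-! ### Free actions of finite groups on rings -/

section FreeAction

open TensorProduct

variable {C B G : Type*} [CommRing C] [CommRing B] [Algebra C B] [Group G]
  [MulSemiringAction G B] [SMulCommClass G C B]

variable (C) in
/-- The algebra homomorphism `x ⊗ y ↦ x * g • y`. -/
def twistedMul (g : G) : B ⊗[C] B →ₐ[C] B :=
  Algebra.TensorProduct.lift (AlgHom.id C B) (MulSemiringAction.toAlgHom C B g)
    fun _ _ => Commute.all _ _

@[simp]
theorem twistedMul_tmul (g : G) (x y : B) : twistedMul C g (x ⊗ₜ y) = x * g • y := by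
  simp [twistedMul]

theorem exists_twistedMul_eq_zero {g : G} (h : Ideal.span (Set.range fun b : B => g • b - b) = ⊤) :
    ∃ e : B ⊗[C] B, twistedMul C (1 : G) e = 1 ∧ twistedMul C g e = 0 := by
  -- The ideal of all values at `1` of elements of the kernel of `twistedMul C g`; it contains all
  -- the elements `g • b - b`, as the values of `g • b ⊗ 1 - 1 ⊗ b`.
  let J : Ideal B := ((RingHom.ker (twistedMul C g)).map (twistedMul (B := B) C (1 : G)))
  have hs : Function.Surjective (twistedMul (B := B) C (1 : G)) := fun b => ⟨b ⊗ₜ 1, by simp⟩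
  have hJ : J = ⊤ := by
    rw [eq_top_iff, ← h, Ideal.span_le]
    rintro _ ⟨b, rfl⟩
    have : (g • b) ⊗ₜ[C] (1 : B) - (1 : B) ⊗ₜ[C] b ∈ RingHom.ker (twistedMul C g) := by
      simp [RingHom.mem_ker]
    simpa using Ideal.mem_map_of_mem (twistedMul (B := B) C (1 : G)) this
  obtain ⟨e, he, he'⟩ := (Ideal.mem_map_iff_of_surjective _ hs).1
    (hJ ▸ Submodule.mem_top : (1 : B) ∈ J)
  exact ⟨e, he', he⟩

variable (C G) in
/-- A free action has an element of `B ⊗ B` that separates the identity from the rest of the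
group. This is the Galois property of Chase, Harrison and Rosenberg. -/
theorem exists_separating_tensor [Finite G]
    (h : ∀ g : G, g ≠ 1 → Ideal.span (Set.range fun b : B => g • b - b) = ⊤) :
    ∃ e : B ⊗[C] B, twistedMul C (1 : G) e = 1 ∧ ∀ g : G, g ≠ 1 → twistedMul C g e = 0 := by
  classical
  cases nonempty_fintype G
  choose! e he he' using fun g hg => exists_twistedMul_eq_zero (C := C) (h g hg)
  refine ⟨∏ g ∈ Finset.univ.erase (1 : G), e g, ?_, fun g hg => ?_⟩
  · rw [map_prod]
    exact Finset.prod_eq_one fun g hg => he g (Finset.ne_of_mem_erase hg)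
  · rw [map_prod]
    exact Finset.prod_eq_zero (Finset.mem_erase.2 ⟨hg, Finset.mem_univ g⟩) (he' g hg)

variable (C B G) in
/-- The trace `b ↦ ∑ g • b` with values in the ring of invariants. -/
theorem exists_trace [Fintype G] [Algebra.IsInvariant C B G]
    (hinj : Function.Injective (algebraMap C B)) :
    ∃ t : B →ₗ[C] C, ∀ b, algebraMap C B (t b) = ∑ g : G, g • b := by
  choose t ht using fun b : B => Algebra.IsInvariant.isInvariant (A := C) (G := G)
    (∑ g : G, g • b) fun g => by
      rw [Finset.smul_sum]
      simp_rw [← mul_smul]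
      exact Fintype.sum_equiv (Equiv.mulLeft g) _ _ fun _ => rfl
  refine ⟨⟨⟨t, fun a b => hinj ?_⟩, fun c b => hinj ?_⟩, ht⟩
  · simp [ht, Finset.sum_add_distrib]
  · simp only [ht, RingHom.id_apply, smul_eq_mul, map_mul]
    rw [Finset.mul_sum]
    refine Finset.sum_congr rfl fun g _ => ?_
    rw [smul_comm, Algebra.smul_def]

/-- A ring with a free action of a finite group is finite étale over its ring of invariants:
the separating tensor `∑ xᵢ ⊗ yᵢ` gives a dual basis `b = ∑ xᵢ tr(yᵢ b)`, and it is a separability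
idempotent. -/
theorem finite_and_etale_of_free [Finite G] [Algebra.IsInvariant C B G]
    (hinj : Function.Injective (algebraMap C B))
    (h : ∀ g : G, g ≠ 1 → Ideal.span (Set.range fun b : B => g • b - b) = ⊤) :
    Module.Finite C B ∧ Algebra.Etale C B := by
  classical
  cases nonempty_fintype G
  obtain ⟨e, he1, he⟩ := exists_separating_tensor C G h
  obtain ⟨t, ht⟩ := exists_trace C B G hinj
  obtain ⟨s, hs⟩ := TensorProduct.exists_finset e
  have key (b : B) : ∑ i ∈ s, t (i.2 * b) • i.1 = b := by
    have : ∑ g : G, twistedMul C g (e * (1 ⊗ₜ b)) = b := by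
      rw [Finset.sum_eq_single 1 (fun g _ hg => by rw [map_mul, he g hg, zero_mul]) (by simp),
        map_mul, he1]
      simp
    refine Eq.trans ?_ this
    rw [hs]
    simp only [Finset.sum_mul, Algebra.TensorProduct.tmul_mul_tmul, mul_one, map_sum,
      twistedMul_tmul, Algebra.smul_def, ht]
    rw [Finset.sum_comm]
    refine Finset.sum_congr rfl fun i _ => ?_
    exact Finset.sum_congr rfl fun g _ => mul_comm _ _
  have hflip (b : B) : (1 ⊗ₜ b) * e = ∑ i ∈ s, (b * i.2) ⊗ₜ i.1 := by
    calc (1 ⊗ₜ b) * e = ∑ i ∈ s, i.1 ⊗ₜ (∑ j ∈ s, t (j.2 * (b * i.2)) • j.1) := by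
          rw [hs, Finset.mul_sum]
          exact Finset.sum_congr rfl fun i _ => by
            rw [Algebra.TensorProduct.tmul_mul_tmul, one_mul, key]
      _ = ∑ j ∈ s, (∑ i ∈ s, t (i.2 * (b * j.2)) • i.1) ⊗ₜ j.1 := by
          simp only [TensorProduct.tmul_sum, TensorProduct.sum_tmul, TensorProduct.tmul_smul,
            TensorProduct.smul_tmul']
          rw [Finset.sum_comm]
          refine Finset.sum_congr rfl fun i _ => Finset.sum_congr rfl fun j _ => ?_
          rw [show i.2 * (b * j.2) = j.2 * (b * i.2) by ring]
      _ = _ := Finset.sum_congr rfl fun j _ => by rw [key]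
  let i : B →ₗ[C] (s → C) := LinearMap.pi fun j => t ∘ₗ LinearMap.mulLeft C j.1.2
  let r : (s → C) →ₗ[C] B := Fintype.linearCombination C fun j : s => j.1.1
  have hri : r ∘ₗ i = LinearMap.id := by
    ext b
    simp only [LinearMap.comp_apply, r, Fintype.linearCombination_apply, i, LinearMap.id_apply]
    conv_rhs => rw [← key b]
    exact Finset.sum_coe_sort s fun j => t (j.2 * b) • j.1
  have hfin : Module.Finite C B :=
    Module.Finite.of_surjective r fun b => ⟨i b, DFunLike.congr_fun hri b⟩
  have hproj : Module.Projective C B := .of_split i r hri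
  have hunr : Algebra.FormallyUnramified C B := by
    refine Algebra.FormallyUnramified.iff_exists_tensorProduct.2 ⟨e, fun b => ?_, ?_⟩
    · have h1 := hflip 1
      rw [← Algebra.TensorProduct.one_def, one_mul] at h1
      rw [sub_mul, hflip, sub_eq_zero]
      conv_rhs => rw [h1]
      simp [Finset.mul_sum]
    · rw [← he1]
      congr 1
      ext
      · simp
      · simp
  have := Module.finitePresentation_of_projective C B
  have : Algebra.FinitePresentation C B := Algebra.FinitePresentation.of_finitePresentation C B
  exact ⟨hfin, Algebra.Etale.of_formallyUnramified_of_flat⟩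

end FreeAction

/-! ### Descent of smoothness along étale covers -/

section EtaleDescent

open TensorProduct Polynomial

universe w

/-- Standard étale algebras lift along surjective ring homomorphisms. -/
theorem exists_etale_lift {R C B : Type*} [CommRing R] [CommRing C] [CommRing B] [Algebra R C]
    [Algebra C B] [Algebra R B] [IsScalarTower R C B]
    (hRC : Function.Surjective (algebraMap R C)) [Algebra.IsStandardEtale C B] :
    ∃ (F : StandardEtalePair R) (φ : F.Ring →ₐ[R] B), Function.Surjective φ ∧
      RingHom.ker φ = (RingHom.ker (algebraMap R C)).map (algebraMap R F.Ring) := by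
  obtain ⟨E⟩ := Algebra.IsStandardEtale.nonempty_standardEtalePresentation (R := C) (S := B)
  have hlift (q : C[X]) : ∃ q' : R[X], q'.map (algebraMap R C) = q :=
    Polynomial.map_surjective _ hRC q
  obtain ⟨f, hf, -, hfm⟩ := Polynomial.lifts_and_natDegree_eq_and_monic
    ((Polynomial.mem_lifts _).2 (hlift E.f)) E.monic_f
  obtain ⟨g, hg⟩ := hlift E.g
  obtain ⟨p₁, p₂, n, hE⟩ := E.cond
  obtain ⟨p₁, rfl⟩ := hlift p₁
  obtain ⟨p₂, rfl⟩ := hlift p₂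
  -- `derivative f * p₁ + f * p₂` lifts a power of the polynomial to be inverted
  let F : StandardEtalePair R :=
    { f := f
      monic_f := hfm
      g := g * (derivative f * p₁ + f * p₂)
      cond := ⟨g * p₁, g * p₂, 1, by ring⟩ }
  have hFg : F.g.map (algebraMap R C) = E.g ^ (n + 1) := by
    simp only [F, Polynomial.map_mul, Polynomial.map_add, ← derivative_map, hf, hg, hE]
    ring
  have hE' {D : Type _} [CommRing D] [Algebra C D] (x : D) :
      (F.map (algebraMap R C)).HasMap x ↔ E.HasMap x := by
    simp only [StandardEtalePair.HasMap, StandardEtalePair.map_f, StandardEtalePair.map_g, hFg,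
      map_pow, isUnit_pow_iff (Nat.succ_ne_zero n)]
    rw [show F.f.map (algebraMap R C) = E.f from hf]
  let e₁ : (F.map (algebraMap R C)).Ring ≃ₐ[C] E.Ring :=
    .ofAlgHom ((F.map (algebraMap R C)).lift E.X ((hE' _).2 E.hasMap_X))
      (E.lift (F.map (algebraMap R C)).X ((hE' _).1 (F.map (algebraMap R C)).hasMap_X))
      (by apply StandardEtalePair.hom_ext; simp) (by apply StandardEtalePair.hom_ext; simp)
  let pres : StandardEtalePresentation R F.Ring :=
    ⟨F, F.X, F.hasMap_X, by simpa [StandardEtalePair.lift_X_left] using Function.bijective_id⟩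
  let e : C ⊗[R] F.Ring ≃ₐ[C] B :=
    ((pres.baseChange (T := C)).equivRing.trans e₁).trans E.equivRing.symm
  let φ : F.Ring →ₐ[R] B := (e.toAlgHom.restrictScalars R).comp Algebra.TensorProduct.includeRight
  refine ⟨F, φ, ?_, ?_⟩
  · refine e.surjective.comp fun x => ?_
    induction x using TensorProduct.induction_on with
    | zero => exact ⟨0, by simp⟩
    | tmul c q =>
      obtain ⟨r, rfl⟩ := hRC c
      exact ⟨r • q, by simp [Algebra.algebraMap_eq_smul_one, TensorProduct.smul_tmul]⟩
    | add x y hx hy =>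
      obtain ⟨a, rfl⟩ := hx
      obtain ⟨b, rfl⟩ := hy
      exact ⟨a + b, by simp [TensorProduct.tmul_add]⟩
  · have h := Algebra.TensorProduct.rTensor_ker (R := R) (S := R) (C := F.Ring)
      (Algebra.ofId R C) hRC
    have hφ (q : F.Ring) : φ q = 0 ↔ (1 : C) ⊗ₜ[R] q = 0 := by
      change e _ = 0 ↔ _
      rw [map_eq_zero_iff e e.injective]; rfl
    refine le_antisymm (fun q hq => ?_) (Ideal.map_le_iff_le_comap.2 fun r hr => ?_)
    · have h1 : (1 : R) ⊗ₜ[R] q ∈ RingHom.ker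
          (Algebra.TensorProduct.map (Algebra.ofId R C) (AlgHom.id R F.Ring)) := by
        rw [RingHom.mem_ker, Algebra.TensorProduct.map_tmul, map_one]
        exact (hφ q).1 hq
      rw [h] at h1
      have h2 : Ideal.map (Algebra.TensorProduct.includeLeft : R →ₐ[R] R ⊗[R] F.Ring)
          (RingHom.ker (Algebra.ofId R C)) ≤
          ((RingHom.ker (algebraMap R C)).map (algebraMap R F.Ring)).comap
            (Algebra.TensorProduct.lid R F.Ring) :=
        Ideal.map_le_iff_le_comap.2 fun r hr => by
          have e : Algebra.TensorProduct.lid R F.Ring (r ⊗ₜ (1 : F.Ring)) = algebraMap R F.Ring r := by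
            simp [Algebra.algebraMap_eq_smul_one]
          change Algebra.TensorProduct.lid R F.Ring (r ⊗ₜ (1 : F.Ring)) ∈
            (RingHom.ker (algebraMap R C)).map (algebraMap R F.Ring)
          rw [e]
          exact Ideal.mem_map_of_mem (algebraMap R F.Ring) hr
      simpa using h2 h1
    · rw [Ideal.mem_comap, RingHom.mem_ker, φ.commutes, IsScalarTower.algebraMap_apply R C B,
        RingHom.mem_ker.1 hr, map_zero]

section Extension

variable {k C B : Type*} [CommRing k] [CommRing C] [CommRing B] [Algebra k C] [Algebra k B]
  [Algebra C B]

/-- A standard étale algebra `B` over `C` is presented by an étale algebra over the ring that presents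
`C`, whose kernel is extended from the kernel of the presentation of `C`. -/
theorem exists_extension_of_isStandardEtale (P : Algebra.Extension.{w} k C)
    [IsScalarTower k C B] [Algebra.IsStandardEtale C B] :
    ∃ (Q : Algebra.Extension.{w} k B) (f : P.Hom Q) (_ : Algebra P.Ring Q.Ring)
      (_ : algebraMap P.Ring Q.Ring = f.toRingHom), Algebra.Etale P.Ring Q.Ring ∧
      IsScalarTower k P.Ring Q.Ring ∧ Q.ker ≤ P.ker.map (algebraMap P.Ring Q.Ring) := by
  let : Algebra P.Ring B := ((algebraMap C B).comp (algebraMap P.Ring C)).toAlgebra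
  have : IsScalarTower P.Ring C B := .of_algebraMap_eq' rfl
  obtain ⟨F, φ, hφ, hker⟩ := exists_etale_lift (B := B) P.algebraMap_surjective
  let : Algebra k F.Ring := ((algebraMap P.Ring F.Ring).comp (algebraMap k P.Ring)).toAlgebra
  have : IsScalarTower k P.Ring F.Ring := .of_algebraMap_eq' rfl
  have hφk (x : k) : φ (algebraMap k F.Ring x) = algebraMap k B x := by
    rw [IsScalarTower.algebraMap_apply k P.Ring F.Ring, φ.commutes,
      IsScalarTower.algebraMap_apply P.Ring C B, ← IsScalarTower.algebraMap_apply k P.Ring C,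
      ← IsScalarTower.algebraMap_apply]
  let φk : F.Ring →ₐ[k] B := { φ.toRingHom with commutes' := hφk }
  exact ⟨.ofSurjective φk hφ,
    { toRingHom := algebraMap P.Ring F.Ring
      toRingHom_algebraMap := fun x => rfl
      algebraMap_toRingHom := fun x => φ.commutes x },
    inferInstanceAs (Algebra P.Ring F.Ring), rfl,
    inferInstanceAs (Algebra.Etale P.Ring F.Ring),
    inferInstanceAs (IsScalarTower k P.Ring F.Ring), hker.le⟩

/-- If the kernel of one presentation generates that of another one that is flat over it, then it
becomes isomorphic to it by base change. -/
theorem liftBaseChange_mapKer_bijective {P : Algebra.Extension k C} {Q : Algebra.Extension k B}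
    (f : P.Hom Q) [Algebra P.Ring Q.Ring] (h : algebraMap P.Ring Q.Ring = f.toRingHom)
    [Module.Flat P.Ring Q.Ring] (hker : Q.ker ≤ P.ker.map (algebraMap P.Ring Q.Ring)) :
    Function.Bijective (LinearMap.liftBaseChange Q.Ring (f.mapKer h)) := by
  constructor
  · have hinj := Module.Flat.lTensor_preserves_injective_linearMap (M := Q.Ring)
      (P.ker.subtype) Subtype.val_injective
    have hcomp (x : Q.Ring ⊗[P.Ring] P.ker) :
        (LinearMap.liftBaseChange Q.Ring (f.mapKer h) x).1 =
          TensorProduct.rid P.Ring Q.Ring (LinearMap.lTensor Q.Ring P.ker.subtype x) := by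
      induction x using TensorProduct.induction_on with
      | zero => simp
      | tmul q i => simp [Algebra.smul_def, h, mul_comm]
      | add x y hx hy => simp [hx, hy]
    intro x y hxy
    refine hinj ((TensorProduct.rid P.Ring Q.Ring).injective ?_)
    rw [← hcomp, ← hcomp, hxy]
  · rintro ⟨x, hx⟩
    have key : ∀ x ∈ P.ker.map (algebraMap P.Ring Q.Ring), ∃ y,
        (LinearMap.liftBaseChange Q.Ring (f.mapKer h) y).1 = x := by
      intro x hx
      induction hx using Submodule.span_induction with
      | mem x hx =>
        obtain ⟨i, hi, rfl⟩ := hx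
        exact ⟨1 ⊗ₜ ⟨i, hi⟩, by simp [h]⟩
      | zero => exact ⟨0, by simp⟩
      | add x y _ _ hx hy =>
        obtain ⟨a, rfl⟩ := hx
        obtain ⟨b, rfl⟩ := hy
        exact ⟨a + b, by simp⟩
      | smul q x _ hx =>
        obtain ⟨a, rfl⟩ := hx
        exact ⟨q • a, by simp⟩
    obtain ⟨y, hy⟩ := key x (hker hx)
    exact ⟨y, Subtype.ext hy⟩

end Extension

/-- If `B` is standard étale over `C` and smooth over `k`, lift `B` to an étale algebra `Q` over a
polynomial ring that surjects onto `C`; the first cotangent homology of `B` can be computed with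
`Q`, which shows that it is the base change of that of `C`. -/
theorem subsingleton_tensor_h1Cotangent_of_isStandardEtale (k C B : Type*) [CommRing k]
    [CommRing C] [CommRing B] [Algebra k C] [Algebra k B] [Algebra C B] [IsScalarTower k C B]
    [Algebra.IsStandardEtale C B] [Algebra.FormallySmooth k B] :
    Subsingleton (B ⊗[C] Algebra.H1Cotangent k C) := by
  let P : Algebra.Extension k C := (Algebra.Generators.self k C).toExtension
  obtain ⟨Q, f, _, hf, _, _, hker⟩ := exists_extension_of_isStandardEtale (B := B) P
  have : Algebra.FormallySmooth k P.Ring :=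
    inferInstanceAs (Algebra.FormallySmooth k (MvPolynomial C k))
  have : Algebra.FormallySmooth k Q.Ring := .comp k P.Ring Q.Ring
  have hH1 : Subsingleton Q.H1Cotangent := Q.equivH1CotangentOfFormallySmooth.subsingleton
  exact (Algebra.Extension.tensorH1CotangentOfFormallyEtale f hf
    (hf ▸ RingHom.formallyEtale_algebraMap.2 inferInstance)
    (liftBaseChange_mapKer_bijective f hf hker)).subsingleton

/-- Smoothness descends along faithfully flat étale algebras: both the module of differentials and
the first cotangent homology commute with étale base change, so that projectivity of the former and
vanishing of the latter can be checked over `B`. -/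
theorem smooth_of_etale_of_smooth (k : Type u) {C B : Type u} [CommRing k]
    [CommRing C] [CommRing B] [Algebra k C] [Algebra k B] [Algebra C B] [IsScalarTower k C B]
    [Algebra.FinitePresentation k C] [Algebra.Etale C B] [Algebra.Smooth k B]
    [Module.FaithfullyFlat C B] : Algebra.Smooth k C := by
  refine ⟨⟨?_, ?_⟩, inferInstance⟩
  · have : Module.Projective B (B ⊗[C] Ω[C⁄k]) :=
      .of_equiv (KaehlerDifferential.tensorKaehlerEquivOfFormallyEtale k C B).symm
    have : Module.Flat C Ω[C⁄k] := .of_flat_tensorProduct _ _ B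
    exact Module.Flat.projective_of_finitePresentation
  · suffices Subsingleton (B ⊗[C] Algebra.H1Cotangent k C) from
      Module.FaithfullyFlat.lTensor_reflects_triviality C B (Algebra.H1Cotangent k C)
    rw [← Module.support_eq_empty_iff (R := B), Set.eq_empty_iff_forall_notMem]
    intro Q
    rw [Module.notMem_support_iff']
    intro m
    obtain ⟨f, hf, hstd⟩ := Algebra.IsEtaleAt.exists_isStandardEtale (R := C) Q.asIdeal
    have : Algebra.FormallySmooth k (Localization.Away f) := .comp k B _
    have hsub := subsingleton_tensor_h1Cotangent_of_isStandardEtale k (C := C)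
      (B := Localization.Away f)
    have e := AlgebraTensorModule.cancelBaseChange C B B (Localization.Away f)
      (Algebra.H1Cotangent k C)
    have := e.injective.subsingleton
    obtain ⟨⟨_, n, rfl⟩, hn⟩ := (IsLocalizedModule.eq_zero_iff (Submonoid.powers f)
      (TensorProduct.mk B (Localization.Away f) (B ⊗[C] Algebra.H1Cotangent k C) 1)).1
      (Subsingleton.elim (TensorProduct.mk B (Localization.Away f) _ 1 m) 0)
    exact ⟨f ^ n, fun h => hf (Q.2.mem_of_pow_mem n h), hn⟩

end EtaleDescent

/-! ### Dimension and finiteness of rings of invariants -/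

section Invariants

/-- Incomparability gives one inequality, lying over and going up the other one. -/
theorem ringKrullDim_eq_of_isIntegral {C B : Type*} [CommRing C] [CommRing B] [Algebra C B]
    [Algebra.IsIntegral C B] (h : Function.Injective (algebraMap C B)) :
    ringKrullDim C = ringKrullDim B := by
  have : FaithfulSMul C B := (faithfulSMul_iff_algebraMap_injective C B).2 h
  refine le_antisymm (iSup_le fun l => ?_) ?_
  · have : Algebra.HasGoingUp C B := Algebra.HasGoingUp.of_isIntegral
    obtain ⟨P, hP⟩ := Algebra.IsIntegral.comap_surjective C B l.head
    have : P.asIdeal.LiesOver l.head.asIdeal := ⟨by rw [← hP]; rfl⟩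
    obtain ⟨L, hL, -⟩ := Ideal.exists_ltSeries_of_hasGoingUp l P.asIdeal
    rw [← hL]
    exact le_iSup (fun L : LTSeries (PrimeSpectrum B) => (L.length : WithBot ℕ∞)) L
  · exact Order.krullDim_le_of_strictMono (PrimeSpectrum.comap (algebraMap C B))
      fun _ _ hPQ => Ideal.IsIntegral.comap_lt_comap hPQ

/-- The Artin–Tate argument: `B` is integral over the invariants, hence a finite module over them,
and a subalgebra over which a finitely generated algebra is finite is itself finitely generated. -/
theorem finiteType_of_isInvariant (k G : Type*) {C B : Type*} [Field k] [CommRing C] [CommRing B]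
    [Algebra k C] [Algebra k B] [Algebra C B] [IsScalarTower k C B] [Group G] [Finite G]
    [MulSemiringAction G B] [SMulCommClass G C B] [Algebra.IsInvariant C B G]
    [Algebra.FiniteType k B] (h : Function.Injective (algebraMap C B)) :
    Algebra.FiniteType k C := by
  have : Algebra.IsIntegral C B := Algebra.IsInvariant.isIntegral C B G
  have : Algebra.FiniteType C B := .of_restrictScalars_finiteType k C B
  have : Module.Finite C B := Algebra.IsIntegral.finite
  exact ⟨fg_of_fg_of_fg k C B ‹Algebra.FiniteType k B›.out Module.Finite.fg_top h⟩

end Invariants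

/-! ### Hypersurfaces in affine space -/

section AffineHypersurface

open MvPolynomial

variable {σ : Type*} {k : Type*} [Field k]

/-- The Jacobian criterion for one equation. If `1 = D F` modulo `F` for a derivation `D`, then
`q ↦ q - F * D q` is an algebra homomorphism modulo `F ^ 2` that kills `F`, that is a section of
the first order thickening of the hypersurface. -/
theorem formallySmooth_of_derivation {F : MvPolynomial σ k}
    (D : Derivation k (MvPolynomial σ k) (MvPolynomial σ k)) {b : MvPolynomial σ k}
    (h : D F + b * F = 1) : Algebra.FormallySmooth k (MvPolynomial σ k ⧸ Ideal.span {F}) := by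
  set f := Ideal.Quotient.mkₐ k (Ideal.span {F}) with hf
  have hker : RingHom.ker f.toRingHom = Ideal.span {F} := by
    ext x; simp [hf]
  have hsq (x : MvPolynomial σ k) : F ^ 2 * x ∈ RingHom.ker f.toRingHom ^ 2 := by
    rw [hker, Ideal.span_singleton_pow]
    exact Ideal.mul_mem_right _ _ (Ideal.mem_span_singleton_self _)
  refine (Algebra.FormallySmooth.iff_split_surjection f Ideal.Quotient.mk_surjective).2 ?_
  let π := Ideal.Quotient.mkₐ k (RingHom.ker f.toRingHom ^ 2)
  let g₀ : MvPolynomial σ k →ₐ[k] MvPolynomial σ k ⧸ RingHom.ker f.toRingHom ^ 2 :=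
    aeval fun j => π (X j - F * D (X j))
  have hg₀ (q : MvPolynomial σ k) : g₀ q = π (q - F * D q) := by
    induction q using MvPolynomial.induction_on with
    | C a =>
      rw [← MvPolynomial.algebraMap_eq, AlgHom.commutes, D.map_algebraMap, mul_zero, sub_zero,
        AlgHom.commutes]
    | add a b ha hb => rw [map_add, ha, hb, ← map_add, D.map_add]; congr 1; ring
    | mul_X q j hq =>
      have : g₀ (X j) = π (X j - F * D (X j)) := aeval_X _ _
      rw [map_mul, hq, this, ← map_mul, ← sub_eq_zero, ← map_sub]
      refine Ideal.Quotient.eq_zero_iff_mem.2 ?_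
      convert hsq (D q * D (X j)) using 1
      rw [D.leibniz, smul_eq_mul, smul_eq_mul]
      ring
  refine ⟨Ideal.Quotient.liftₐ _ g₀ fun x hx => ?_, ?_⟩
  · obtain ⟨y, rfl⟩ := Ideal.mem_span_singleton.1 hx
    have : g₀ F = 0 := by
      rw [hg₀]
      refine Ideal.Quotient.eq_zero_iff_mem.2 ?_
      convert hsq b using 1
      rw [eq_sub_of_add_eq h]
      ring
    rw [map_mul, this, zero_mul]
  · refine AlgHom.ext fun x => ?_
    obtain ⟨q, rfl⟩ := Ideal.Quotient.mk_surjective x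
    change f.kerSquareLift (g₀ q) = f q
    rw [hg₀]
    change f (q - F * D q) = f q
    have : f F = 0 := Ideal.Quotient.eq_zero_iff_mem.2 (Ideal.mem_span_singleton_self _)
    rw [map_sub, map_mul, this, zero_mul, sub_zero]

/-- The weak Nullstellensatz. -/
theorem eq_top_of_forall_exists_eval_ne_zero [IsAlgClosed k] [Finite σ]
    (I : Ideal (MvPolynomial σ k)) (h : ∀ v : σ → k, ∃ q ∈ I, eval v q ≠ 0) : I = ⊤ := by
  rw [← Ideal.radical_eq_top, ← vanishingIdeal_zeroLocus_eq_radical (K := k), eq_top_iff]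
  intro q _ v hv
  obtain ⟨r, hr, hr'⟩ := h v
  exact (hr' (by simpa [aeval_eq_eval] using hv r hr)).elim

/-- An affine hypersurface without singular points over an algebraically closed field is smooth. -/
theorem smooth_quotient_of_eval [IsAlgClosed k] [Finite σ] (F : MvPolynomial σ k)
    (h : ∀ v : σ → k, eval v F = 0 → (∀ j, eval v (pderiv j F) = 0) → False) :
    Algebra.Smooth k (MvPolynomial σ k ⧸ Ideal.span {F}) := by
  -- The ideal generated by `F` and its partial derivatives.
  let L : (Derivation k (MvPolynomial σ k) (MvPolynomial σ k)) × MvPolynomial σ k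
      →ₗ[MvPolynomial σ k] MvPolynomial σ k :=
    { toFun := fun x => x.1 F + x.2 * F
      map_add' := fun x y => by simp [Derivation.add_apply]; ring
      map_smul' := fun x y => by simp [Derivation.smul_apply]; ring }
  have hL : LinearMap.range L = ⊤ := by
    refine eq_top_of_forall_exists_eval_ne_zero _ fun v => ?_
    by_contra! hv
    refine h v (hv F ⟨(0, 1), by simp [L]⟩) fun j => hv _ ⟨(pderiv j, 0), by simp [L]⟩
  obtain ⟨⟨D, b⟩, hDb⟩ := LinearMap.range_eq_top.1 hL 1
  exact { formallySmooth := formallySmooth_of_derivation D hDb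
          finitePresentation := .quotient ⟨{F}, by simp⟩ }

/-- The ideal of the origin has height at least the number of variables, because of the chain of the
prime ideals generated by the variables in larger and larger sets. -/
theorem card_le_height_ker_constantCoeff [Finite σ] :
    (Nat.card σ : ℕ∞) ≤ (RingHom.ker (constantCoeff : MvPolynomial σ k →+* k)).height := by
  classical
  have := Fintype.ofFinite σ
  let ψ (s : Finset σ) : MvPolynomial σ k →ₐ[k] MvPolynomial σ k :=
    aeval fun i => if i ∈ s then 0 else X i
  have hp (s : Finset σ) : (RingHom.ker (ψ s)).IsPrime := RingHom.ker_isPrime _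
  have hψ (s : Finset σ) : (s.card : ℕ∞) ≤ (RingHom.ker (ψ s)).height := by
    induction s using Finset.induction_on with
    | empty => simp
    | insert a s ha ih =>
      rw [Finset.card_insert_of_notMem ha, Nat.cast_succ]
      refine (add_le_add_left ih 1).trans (Ideal.height_add_one_le_of_lt_of_isPrime ?_)
      have hcomp : ψ (insert a s) = (ψ {a}).comp (ψ s) := by
        refine MvPolynomial.algHom_ext fun i => ?_
        by_cases h1 : i ∈ s <;> rcases eq_or_ne i a with rfl | h2 <;> simp_all [ψ]
      refine lt_of_le_of_ne (fun q hq => ?_) fun he => ?_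
      · rw [RingHom.mem_ker] at hq ⊢
        rw [hcomp, AlgHom.comp_apply, hq, map_zero]
      · have : X a ∈ RingHom.ker (ψ (insert a s)) := by simp [ψ, RingHom.mem_ker]
        rw [← he] at this
        simp [ψ, RingHom.mem_ker, ha] at this
  have huniv : RingHom.ker (ψ Finset.univ) =
      RingHom.ker (constantCoeff : MvPolynomial σ k →+* k) := by
    have : ψ Finset.univ = (Algebra.ofId k _).comp (aeval fun _ => 0) :=
      MvPolynomial.algHom_ext fun i => by simp [ψ]
    ext q
    rw [RingHom.mem_ker, RingHom.mem_ker, this, AlgHom.comp_apply]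
    change C _ = 0 ↔ _
    rw [map_eq_zero_iff _ (C_injective σ k)]
    simp [constantCoeff_eq, aeval_def, eval₂_zero'_apply]
  simpa [huniv] using hψ Finset.univ

/-- A hypersurface through the origin of affine space has codimension one. The dimension is bounded
below at the origin, where the height of the maximal ideal is known. -/
theorem ringKrullDim_quotient_add_one [Finite σ] {F : MvPolynomial σ k} (hF : F ≠ 0)
    (h0 : constantCoeff F = 0) :
    ringKrullDim (MvPolynomial σ k ⧸ Ideal.span {F}) + 1 = Nat.card σ := by
  refine le_antisymm ?_ ?_
  · have := ringKrullDim_quotient_succ_le_of_nonZeroDivisor (mem_nonZeroDivisors_of_ne_zero hF)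
    simpa [MvPolynomial.ringKrullDim_of_isNoetherianRing] using this
  · have : (RingHom.ker (constantCoeff : MvPolynomial σ k →+* k)).IsPrime := RingHom.ker_isPrime _
    refine le_trans ?_ (Ideal.height_le_ringKrullDim_quotient_add_one
      (p := RingHom.ker (constantCoeff : MvPolynomial σ k →+* k)) h0)
    exact_mod_cast WithBot.coe_le_coe.2 (card_le_height_ker_constantCoeff (σ := σ) (k := k))

/-- Scaling the variables by a parameter `t` turns a form of degree `d` into `t ^ d` times itself;
this monomial in `t` has only monomial factors. -/
theorem isUnit_of_mul_isHomogeneous {g h : MvPolynomial σ k} {d : ℕ}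
    (hgh : (g * h).IsHomogeneous d) (hne : g * h ≠ 0) (hg : constantCoeff g ≠ 0) : IsUnit g := by
  let θ : MvPolynomial σ k →ₐ[k] Polynomial (MvPolynomial σ k) :=
    aeval fun i => Polynomial.C (X i) * Polynomial.X
  have hev (q : MvPolynomial σ k) : (θ q).eval 1 = q := by
    have : ((Polynomial.evalRingHom (1 : MvPolynomial σ k)).comp θ.toRingHom) = RingHom.id _ :=
      MvPolynomial.ringHom_ext (fun r => by simp [θ, ← MvPolynomial.algebraMap_eq])
        fun i => by simp [θ]
    exact RingHom.congr_fun this q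
  have hc (q : MvPolynomial σ k) : (θ q).coeff 0 = C (constantCoeff q) := by
    have : (Polynomial.constantCoeff.comp θ.toRingHom) =
        (C : k →+* MvPolynomial σ k).comp constantCoeff :=
      MvPolynomial.ringHom_ext (fun r => by simp [θ]) fun i => by simp [θ]
    exact RingHom.congr_fun this q
  have hhom : θ (g * h) = Polynomial.C (g * h) * Polynomial.X ^ d := by
    conv_lhs => rw [(g * h).as_sum]
    conv_rhs => rw [(g * h).as_sum]
    rw [map_sum, map_sum, Finset.sum_mul]
    refine Finset.sum_congr rfl fun m hm => ?_
    have hd := hgh (mem_support_iff.1 hm)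
    simp only [Finsupp.weight_apply, Pi.one_apply, smul_eq_mul, mul_one] at hd
    rw [aeval_monomial, MvPolynomial.monomial_eq, map_mul, Finsupp.prod, Finsupp.prod]
    simp only [mul_pow, Finset.prod_mul_distrib, Finset.prod_pow_eq_pow_sum, map_prod, map_pow]
    rw [show ∑ i ∈ m.support, m i = d from hd, mul_assoc]
    rfl
  have h0 : θ (g * h) ≠ 0 := fun h => hne (by rw [← hev (g * _), h, Polynomial.eval_zero])
  rw [map_mul] at h0
  have e1 := Polynomial.natDegree_mul (left_ne_zero_of_mul h0) (right_ne_zero_of_mul h0)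
  have e2 := Polynomial.natTrailingDegree_mul (left_ne_zero_of_mul h0) (right_ne_zero_of_mul h0)
  rw [← map_mul, hhom] at e1 e2
  rw [Polynomial.natDegree_C_mul_X_pow _ _ hne] at e1
  rw [Polynomial.C_mul_X_pow_eq_monomial, Polynomial.natTrailingDegree_monomial hne] at e2
  have e3 : (θ g).natTrailingDegree = 0 := by
    refine Polynomial.natTrailingDegree_eq_zero_of_constantCoeff_ne_zero ?_
    rw [Polynomial.constantCoeff_apply, hc]
    simpa using hg
  have e4 := Polynomial.natTrailingDegree_le_natDegree (θ h)
  have e5 : (θ g).natDegree = 0 := by omega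
  have e6 : g = C (constantCoeff g) := by
    rw [← hc]
    conv_lhs => rw [← hev g, Polynomial.eq_C_of_natDegree_eq_zero e5, Polynomial.eval_C]
  rw [e6]
  exact (isUnit_iff_ne_zero.2 hg).map C

/-- A form in at least three variables whose affine cone is singular at most at the origin is
irreducible: the cone is singular where two factors vanish, and two forms in at least three
variables have a common zero besides the origin, by Krull's height theorem. -/
theorem irreducible_of_isHomogeneous [IsAlgClosed k] [Finite σ] (hσ : 3 ≤ Nat.card σ)
    {F : MvPolynomial σ k} {d : ℕ} (hF : F.IsHomogeneous d) (hne : F ≠ 0) (hd : d ≠ 0)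
    (h : ∀ v : σ → k, eval v F = 0 → (∀ j, eval v (pderiv j F) = 0) → v = 0) :
    Irreducible F := by
  have hF0 : constantCoeff F = 0 := by
    rw [constantCoeff_eq]
    exact hF.coeff_eq_zero (by simpa using hd.symm)
  refine ⟨fun hu => ?_, fun g g' hgg => ?_⟩
  · have := hu.map (constantCoeff (σ := σ) (R := k))
    rw [hF0] at this
    exact not_isUnit_zero this
  by_contra! hu
  have h1 : constantCoeff g = 0 := by
    by_contra h1
    exact hu.1 (isUnit_of_mul_isHomogeneous (hgg ▸ hF) (hgg ▸ hne) h1)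
  have h2 : constantCoeff g' = 0 := by
    by_contra h2
    rw [mul_comm] at hgg
    exact hu.2 (isUnit_of_mul_isHomogeneous (hgg ▸ hF) (hgg ▸ hne) h2)
  let m := RingHom.ker (constantCoeff : MvPolynomial σ k →+* k)
  have hm : m.IsPrime := RingHom.ker_isPrime _
  have hle : Ideal.span {g, g'} ≤ m := by
    rw [Ideal.span_le]
    rintro _ (rfl | rfl)
    exacts [h1, h2]
  have hrad : m ≤ (Ideal.span {g, g'}).radical := by
    rw [← vanishingIdeal_zeroLocus_eq_radical (K := k)]
    intro q hq v hv
    have hg : eval v g = 0 := by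
      simpa [aeval_eq_eval] using hv g (Ideal.subset_span (by simp))
    have hg' : eval v g' = 0 := by
      simpa [aeval_eq_eval] using hv g' (Ideal.subset_span (by simp))
    have : v = 0 := h v (by simp [hgg, hg]) fun j => by simp [hgg, hg, hg']
    rw [this, aeval_eq_eval]
    simpa [m, constantCoeff_eq, RingHom.mem_ker, eval_zero] using hq
  have hmin : m ∈ (Ideal.span {g, g'}).minimalPrimes :=
    ⟨⟨hm, hle⟩, fun P hP _ => hrad.trans (hP.1.radical_le_iff.2 hP.2)⟩
  have hh := Ideal.height_le_card_of_mem_minimalPrimes_span (Set.toFinite _) hmin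
  have h3 := (card_le_height_ker_constantCoeff (σ := σ) (k := k)).trans hh
  have h4 : ({g, g'} : Set (MvPolynomial σ k)).ncard ≤ 2 :=
    (Set.ncard_insert_le _ _).trans (by simp)
  have : Nat.card σ ≤ ({g, g'} : Set (MvPolynomial σ k)).ncard := by exact_mod_cast h3
  omega

end AffineHypersurface

/-! ### The equation of the hypersurface -/

section Equation

open MvPolynomial

variable (p : ℕ) [Fact p.Prime] (k : Type u) [Field k]

variable {k} in
theorem eval_poly (v : ZMod p → k) :
    eval v (poly p k) = ∏ i, v i + ∑ i, v i ^ (p - 1) * v (i + 1) := by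
  simp [poly, map_prod]

/-- The value at `(1, …, 1)` is `1 + p = 1`. -/
theorem poly_ne_zero [CharP k p] : poly p k ≠ 0 := fun h => by
  have := eval_poly p (fun _ => (1 : k))
  simp [h] at this

theorem pderiv_prod_X {σ : Type*} (s : Finset σ) {j : σ} (hj : j ∉ s) :
    pderiv j (∏ i ∈ s, X i : MvPolynomial σ k) = 0 := by
  classical
  induction s using Finset.induction_on with
  | empty => simp
  | insert a s ha ih =>
    rw [Finset.mem_insert, not_or] at hj
    rw [Finset.prod_insert ha, pderiv_mul, ih hj.2, pderiv_X_of_ne (Ne.symm hj.1)]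
    simp

variable {k}

theorem eval_pderiv_poly [CharP k p] (v : ZMod p → k) (j : ZMod p) :
    eval v (pderiv j (poly p k)) = ∏ i ∈ Finset.univ.erase j, v i
      - v j ^ (p - 2) * v (j + 1) + v (j - 1) ^ (p - 1) := by
  have hp1 : ((p - 1 : ℕ) : k) = -1 := by
    rw [Nat.cast_sub (Fact.out (p := p.Prime)).one_le]; simp
  have h1 : pderiv j (∏ i, X i : MvPolynomial (ZMod p) k) = ∏ i ∈ Finset.univ.erase j, X i := by
    rw [← Finset.mul_prod_erase _ _ (Finset.mem_univ j), pderiv_mul,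
      pderiv_prod_X _ _ (Finset.notMem_erase _ _)]
    simp
  have h2 (i : ZMod p) : eval v (pderiv j (X i ^ (p - 1) * X (i + 1) : MvPolynomial (ZMod p) k)) =
      (if i = j then - (v j ^ (p - 2) * v (j + 1)) else 0) +
      if i = j - 1 then v (j - 1) ^ (p - 1) else 0 := by
    simp only [pderiv_mul, pderiv_pow, map_add, map_mul, map_pow, eval_X, pderiv_X, Pi.single_apply,
      eq_sub_iff_add_eq, map_natCast, hp1, show p - 1 - 1 = p - 2 from rfl]
    split_ifs with h h' h'
    · simp_all
    · simp_all
    · simp [← h']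
    · simp
  rw [poly, map_add, map_add, map_sum, map_sum, h1, Finset.sum_congr rfl fun i _ => h2 i,
    Finset.sum_add_distrib]
  simp [map_prod]
  ring

/-- With `m j = v j ^ (p - 1) * v (j + 1)` and `P` the product of the coordinates of `v`, the
equations `v j * ∂ⱼf = 0` say that `m j = m (j - 1) + P`, so `m j = m 0 + j P`. Summing over `j`
gives `f = P`; so one coordinate vanishes, hence all `m j` do, and then a nonzero coordinate `v j`
would contradict `∂ⱼ₊₁f = 0`. -/
theorem eq_zero_of_eval_poly [CharP k p] (hp : 2 < p) (v : ZMod p → k)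
    (h0 : eval v (poly p k) = 0) (h : ∀ j, eval v (pderiv j (poly p k)) = 0) : v = 0 := by
  set P := ∏ i, v i with hP
  set m : ZMod p → k := fun j => v j ^ (p - 1) * v (j + 1) with hm
  have hprime : p.Prime := Fact.out
  have hrec (j : ZMod p) : m (j + 1) = m j + P := by
    have h1 := congrArg (v (j + 1) * ·) (h (j + 1))
    simp only [eval_pderiv_poly, mul_zero, mul_add, mul_sub, Finset.mul_prod_erase _ v
      (Finset.mem_univ (j + 1)), add_sub_cancel_right] at h1
    have h2 : v (j + 1) * (v (j + 1) ^ (p - 2) * v (j + 1 + 1)) = m (j + 1) := by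
      rw [← mul_assoc, ← pow_succ', show p - 2 + 1 = p - 1 by omega]
    rw [h2, mul_comm] at h1
    linear_combination -h1
  have hcast (n : ℕ) : m n = m 0 + n * P := by
    induction n with
    | zero => simp
    | succ n ih => rw [Nat.cast_succ, hrec, ih, Nat.cast_succ]; ring
  have hval (j : ZMod p) : m j = m 0 + (ZMod.castHom dvd_rfl k j) * P := by
    have := hcast j.val
    rw [ZMod.natCast_zmod_val] at this
    rw [this]
    congr 2
    conv_rhs => rw [← ZMod.natCast_zmod_val j]
    rw [map_natCast]
  have hsum0 : ∑ j : ZMod p, j = 0 := by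
    have hinv : ∑ j : ZMod p, j = ∑ j : ZMod p, -j := (Equiv.sum_comp (Equiv.neg _) _).symm
    rw [Finset.sum_neg_distrib] at hinv
    have h2 : (2 : ZMod p) * ∑ j : ZMod p, j = 0 := by linear_combination hinv
    refine (mul_eq_zero.1 h2).resolve_left fun h2 => ?_
    have : ((2 : ℕ) : ZMod p) = 0 := by exact_mod_cast h2
    rw [ZMod.natCast_eq_zero_iff] at this
    exact absurd (Nat.le_of_dvd two_pos this) (by omega)
  have hsum : ∑ j, m j = 0 := by
    have hs : ∑ j, (ZMod.castHom dvd_rfl k) j * P = 0 := by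
      rw [← Finset.sum_mul, ← map_sum, hsum0, map_zero, zero_mul]
    rw [Finset.sum_congr rfl fun j _ => hval j, Finset.sum_add_distrib, hs]
    simp [ZMod.card]
  have hP0 : P = 0 := by
    rw [eval_poly] at h0
    change P + ∑ j, m j = 0 at h0
    rwa [hsum, add_zero] at h0
  obtain ⟨a, -, ha⟩ := Finset.prod_eq_zero_iff.1 hP0
  have hm0 (j : ZMod p) : m j = 0 := by
    have h1 : m a = 0 := by simp [hm, ha, show p - 1 ≠ 0 by omega]
    rw [hval, hP0, mul_zero, add_zero] at h1 ⊢
    exact h1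
  funext j
  by_contra hj
  have h1 : v (j + 1) = 0 := (mul_eq_zero.1 (hm0 j)).resolve_left (pow_ne_zero _ hj)
  have h2 : v (j - 1) = 0 := by
    have := hm0 (j - 1)
    simp only [hm, sub_add_cancel] at this
    exact (pow_eq_zero_iff (show p - 1 ≠ 0 by omega)).1 ((mul_eq_zero.1 this).resolve_right hj)
  have h3 := h (j + 1)
  have hne : j - 1 ≠ j + 1 := fun he => by
    have : ((2 : ℕ) : ZMod p) = 0 := by push_cast; linear_combination -he
    rw [ZMod.natCast_eq_zero_iff] at this
    exact absurd (Nat.le_of_dvd two_pos this) (by omega)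
  rw [eval_pderiv_poly, h1, zero_pow (show p - 2 ≠ 0 by omega), zero_mul, sub_zero,
    add_sub_cancel_right, Finset.prod_eq_zero (Finset.mem_erase.2 ⟨hne, Finset.mem_univ _⟩) h2,
    zero_add] at h3
  exact hj (pow_eq_zero_iff (show p - 1 ≠ 0 by omega) |>.1 h3)

variable (k) in
theorem poly_irreducible [CharP k p] [IsAlgClosed k] (hp : 2 < p) : Irreducible (poly p k) :=
  irreducible_of_isHomogeneous (by rw [Nat.card_zmod]; omega) (poly_isHomogeneous p k)
    (poly_ne_zero p k) (by omega) (eq_zero_of_eval_poly p hp)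

theorem rename_poly (c : ZMod p) : rename (Equiv.addRight c) (poly p k) = poly p k := by
  simp only [poly, map_add, map_prod, map_sum, map_mul, map_pow, rename_X, Equiv.coe_addRight]
  congr 1
  · exact Equiv.prod_comp (Equiv.addRight c) fun i => (X i : MvPolynomial (ZMod p) k)
  · rw [← Equiv.sum_comp (Equiv.addRight c)
      fun i => (X i ^ (p - 1) * X (i + 1) : MvPolynomial (ZMod p) k)]
    simp [add_right_comm]

end Equation

/-! ### Dehomogenization -/

section Dehomogenize

open MvPolynomial

variable {σ : Type} {k : Type u} [Field k] (i : σ)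

open Classical in
/-- Setting the `i`-th variable to `1`. -/
def dehomogenize : MvPolynomial σ k →ₐ[k] MvPolynomial {j // j ≠ i} k :=
  aeval fun j => if h : j = i then 1 else X ⟨j, h⟩

@[simp]
theorem dehomogenize_X_self : dehomogenize i (X i : MvPolynomial σ k) = 1 := by
  simp [dehomogenize]

theorem dehomogenize_X {j : σ} (h : j ≠ i) :
    dehomogenize i (X j : MvPolynomial σ k) = X ⟨j, h⟩ := by
  simp [dehomogenize, h]

theorem pderiv_dehomogenize (j : {j // j ≠ i}) (F : MvPolynomial σ k) :
    pderiv j (dehomogenize i F) = dehomogenize i (pderiv j.1 F) := by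
  classical
  induction F using MvPolynomial.induction_on with
  | C a =>
    rw [← MvPolynomial.algebraMap_eq, AlgHom.commutes, Derivation.map_algebraMap,
      Derivation.map_algebraMap, map_zero]
  | add a b ha hb => simp only [map_add, ha, hb]
  | mul_X q l hq =>
    have hl : pderiv j (dehomogenize i (X l : MvPolynomial σ k)) =
        dehomogenize i (pderiv j.1 (X l)) := by
      rcases eq_or_ne l i with rfl | hl
      · rw [dehomogenize_X_self, pderiv_one, pderiv_X_of_ne (Ne.symm j.2), map_zero]
      · rw [dehomogenize_X i hl]
        rcases eq_or_ne l j.1 with rfl | h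
        · rw [pderiv_X_self, pderiv_X_self, map_one]
        · rw [pderiv_X_of_ne h, pderiv_X_of_ne (fun he => h (congrArg Subtype.val he)), map_zero]
    rw [map_mul, pderiv_mul, pderiv_mul, map_add, map_mul, map_mul, hq, hl]

open Classical in
/-- The point with `i`-th homogeneous coordinate `1` and the given other coordinates. -/
def homogenizePoint (v : {j // j ≠ i} → k) (j : σ) : k :=
  if h : j = i then 1 else v ⟨j, h⟩

theorem eval_dehomogenize (v : {j // j ≠ i} → k) (F : MvPolynomial σ k) :
    eval v (dehomogenize i F) = eval (homogenizePoint i v) F := by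
  have : (eval v).comp (dehomogenize i).toRingHom = eval (homogenizePoint i v) := by
    refine MvPolynomial.ringHom_ext (fun r => ?_) fun j => ?_
    · simp [dehomogenize]
    · rcases eq_or_ne j i with rfl | hj
      · simp [homogenizePoint]
      · simp [homogenizePoint, dehomogenize_X i hj, hj]
  exact RingHom.congr_fun this F

end Dehomogenize

/-! ### The affine charts of the hypersurface -/

section Chart

open MvPolynomial

variable (p : ℕ) [Fact p.Prime] (k : Type u) [Field k]

theorem smooth_chart [CharP k p] [IsAlgClosed k] (hp : 2 < p) (i : ZMod p) :
    Algebra.Smooth k (MvPolynomial {j // j ≠ i} k ⧸ Ideal.span {dehomogenize i (poly p k)}) := by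
  refine smooth_quotient_of_eval _ fun v h0 h => ?_
  rw [eval_dehomogenize] at h0
  have h1 (j : ZMod p) (hj : j ≠ i) :
      eval (homogenizePoint i v) (pderiv j (poly p k)) = 0 := by
    rw [← eval_dehomogenize, ← pderiv_dehomogenize i ⟨j, hj⟩, h]
  have hi : eval (homogenizePoint i v) (X i) = 1 := by simp [homogenizePoint]
  -- The partial derivative with respect to `X i` is recovered from Euler's identity.
  have h2 : eval (homogenizePoint i v) (pderiv i (poly p k)) = 0 := by
    have := congrArg (eval (homogenizePoint i v)) (poly_isHomogeneous p k).sum_X_mul_pderiv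
    rw [map_sum, Finset.sum_eq_single i (fun j _ hj => by rw [map_mul, h1 j hj, mul_zero])
      (by simp), map_mul, hi, map_nsmul, h0, one_mul, smul_zero] at this
    exact this
  have h3 := eq_zero_of_eval_poly p hp _ h0 fun j => by
    rcases eq_or_ne j i with rfl | hj
    exacts [h2, h1 j hj]
  rw [h3] at hi
  simp at hi

theorem dehomogenize_poly_ne_zero [CharP k p] (i : ZMod p) :
    dehomogenize i (poly p k) ≠ 0 := fun h => by
  have h1 := eval_dehomogenize i (fun _ => (1 : k)) (poly p k)
  have h2 : homogenizePoint i (fun _ => (1 : k)) = fun _ => 1 := by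
    funext j; simp [homogenizePoint]
  rw [h, h2, eval_poly] at h1
  simp at h1

/-- The origin of the `i`-th chart, which is the `i`-th coordinate point, lies on the hypersurface. -/
theorem constantCoeff_dehomogenize_poly (hp : 2 < p) (i : ZMod p) :
    constantCoeff (dehomogenize i (poly p k)) = 0 := by
  have h1 := eval_dehomogenize i (0 : {j // j ≠ i} → k) (poly p k)
  have hone : (1 : ZMod p) ≠ 0 := one_ne_zero
  have h2 : ∏ j, homogenizePoint i (0 : {j // j ≠ i} → k) j = 0 :=
    Finset.prod_eq_zero (Finset.mem_univ (i + 1)) (by simp [homogenizePoint])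
  have h3 (j : ZMod p) : homogenizePoint i (0 : {j // j ≠ i} → k) j ^ (p - 1) *
      homogenizePoint i (0 : {j // j ≠ i} → k) (j + 1) = 0 := by
    rcases eq_or_ne j i with rfl | hj
    · simp [homogenizePoint]
    · simp [homogenizePoint, hj, show p - 1 ≠ 0 by omega]
  rw [eval_poly, h2, Finset.sum_eq_zero fun j _ => h3 j, add_zero, eval_zero] at h1
  exact h1

theorem ringKrullDim_chart [CharP k p] (hp : 2 < p) (i : ZMod p) :
    ringKrullDim (MvPolynomial {j // j ≠ i} k ⧸ Ideal.span {dehomogenize i (poly p k)}) =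
      ((p - 2 : ℕ) : WithBot ℕ∞) := by
  have h := ringKrullDim_quotient_add_one (dehomogenize_poly_ne_zero p k i)
    (constantCoeff_dehomogenize_poly p k hp i)
  have hc : Nat.card {j : ZMod p // j ≠ i} = p - 2 + 1 := by
    rw [Nat.card_eq_fintype_card, Fintype.card_subtype_compl, Fintype.card_subtype_eq, ZMod.card]
    omega
  rw [hc, Nat.cast_succ] at h
  generalize ringKrullDim
    (MvPolynomial {j // j ≠ i} k ⧸ Ideal.span {dehomogenize i (poly p k)}) = d at h ⊢
  cases d with
  | bot =>
    rw [WithBot.bot_add] at h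
    exact absurd h.symm (WithBot.coe_ne_bot (a := (((p - 2 : ℕ) : ℕ∞) + 1)))
  | coe d =>
    have h' : d + 1 = ((p - 2 : ℕ) : ℕ∞) + 1 := WithBot.coe_injective h
    exact congrArg WithBot.some (WithTop.add_right_cancel ENat.one_ne_top h')

end Chart

/-! ### Dimension is computed on an open cover -/

section Dimension

open TopologicalSpace

/-- A chain of irreducible closed subsets can be intersected with a member of the cover that meets
its smallest term. -/
theorem topologicalKrullDim_eq_iSup_of_cover {X : Type*} [TopologicalSpace X] [Nonempty X]
    {ι : Type*} {U : ι → Type*} [∀ i, TopologicalSpace (U i)] (f : ∀ i, U i → X)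
    (hf : ∀ i, Topology.IsOpenEmbedding (f i)) (hcov : ∀ x, ∃ i, x ∈ Set.range (f i)) :
    topologicalKrullDim X = ⨆ i, topologicalKrullDim (U i) := by
  refine le_antisymm ?_ (iSup_le fun i => (hf i).isInducing.topologicalKrullDim_le)
  rw [topologicalKrullDim, Order.krullDim_eq_iSup_coheight]
  refine iSup_le fun Z => ?_
  obtain ⟨z, hz⟩ := Z.isIrreducible.nonempty
  obtain ⟨i, u, rfl⟩ := hcov z
  let W : {V : IrreducibleCloseds X | (f i ⁻¹' V).Nonempty} := ⟨Z, u, hz⟩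
  let Z' : IrreducibleCloseds (U i) :=
    (IrreducibleCloseds.orderIsoOfIsOpenEmbedding (f i) (hf i)).symm W
  have hZ' : IrreducibleCloseds.map (f i) (hf i).continuous Z' = Z :=
    congrArg Subtype.val
      ((IrreducibleCloseds.orderIsoOfIsOpenEmbedding (f i) (hf i)).apply_symm_apply W)
  rw [← hZ', (hf i).coheight_map]
  exact (Order.coheight_le_krullDim Z').trans (le_iSup (fun i => topologicalKrullDim (U i)) i)

theorem topologicalKrullDim_eq_of_cover {X : Type*} [TopologicalSpace X] [Nonempty X] {ι : Type*}
    {U : ι → Type*} [∀ i, TopologicalSpace (U i)] (f : ∀ i, U i → X)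
    (hf : ∀ i, Topology.IsOpenEmbedding (f i)) (hcov : ∀ x, ∃ i, x ∈ Set.range (f i))
    {d : WithBot ℕ∞} (hd : ∀ i, topologicalKrullDim (U i) = d) : topologicalKrullDim X = d := by
  obtain ⟨i, -⟩ := hcov (Classical.arbitrary X)
  have : Nonempty ι := ⟨i⟩
  rw [topologicalKrullDim_eq_iSup_of_cover f hf hcov, iSup_congr hd, ciSup_const]

end Dimension

/-! ### The projective scheme of a graded algebra over a field -/

section Proj

open HomogeneousIdeal HomogeneousLocalization

variable {k : Type u} [Field k] {S T : Type u} [CommRing S] [Algebra k S] [CommRing T] [Algebra k T]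
  (𝒮 : ℕ → Submodule k S) [GradedAlgebra 𝒮] (𝒯 : ℕ → Submodule k T) [GradedAlgebra 𝒯]

/-- The structure morphism of `Proj` of a graded `k`-algebra. -/
def projToSpec : Proj 𝒮 ⟶ Spec (.of k) :=
  Proj.toSpecZero 𝒮 ≫ Spec.map (CommRingCat.ofHom (algebraMap k (𝒮 0)))

/-- The degree zero part of the localization of a graded `k`-algebra away from `f` is a
`k`-algebra. The scalar multiplication is defined by the structure morphism; it is not
definitionally the one that `HomogeneousLocalization` takes from the localization. -/
instance awayAlgebra (f : S) : Algebra k (Away 𝒮 f) :=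
  ((fromZeroRingHom 𝒮 (.powers f)).comp (algebraMap k (𝒮 0))).toAlgebra

theorem val_algebraMap_away (f : S) (c : k) :
    (algebraMap k (Away 𝒮 f) c).val = algebraMap S (Localization.Away f) (algebraMap k S c) := by
  rw [← Localization.mk_one_eq_algebraMap]; rfl

theorem awayι_projToSpec {f : S} {d : ℕ} (hf : f ∈ 𝒮 d) (hd : 0 < d) :
    Proj.awayι 𝒮 f hf hd ≫ projToSpec 𝒮 =
      Spec.map (CommRingCat.ofHom (algebraMap k (Away 𝒮 f))) := by
  rw [projToSpec, Proj.awayι_toSpecZero_assoc, ← Spec.map_comp]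
  rfl

theorem iSup_basicOpen_eq_top_of_adjoin {ι : Type*} (x : ι → S) (hx : ∀ i, x i ∈ 𝒮 1)
    (hgen : Algebra.adjoin k (Set.range x) = ⊤) : ⨆ i, Proj.basicOpen 𝒮 (x i) = ⊤ := by
  refine Proj.iSup_basicOpen_eq_top' 𝒮 x (fun i => ⟨1, hx i⟩) (eq_top_iff.2 fun s _ => ?_)
  have hs : s ∈ Algebra.adjoin k (Set.range x) := hgen ▸ Algebra.mem_top
  induction hs using Algebra.adjoin_induction with
  | mem y hy => exact Algebra.subset_adjoin hy
  | algebraMap c => exact (Algebra.adjoin (𝒮 0) (Set.range x)).algebraMap_mem (algebraMap k (𝒮 0) c)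
  | add a b _ _ ha hb => exact add_mem (ha trivial) (hb trivial)
  | mul a b _ _ ha hb => exact mul_mem (ha trivial) (hb trivial)

/-- The standard affine charts attached to homogeneous elements of positive degree without a common
zero. -/
def projCover {ι : Type*} (x : ι → S) {d : ι → ℕ} (hx : ∀ i, x i ∈ 𝒮 (d i)) (hd : ∀ i, 0 < d i)
    (hcov : ⨆ i, Proj.basicOpen 𝒮 (x i) = ⊤) : (Proj 𝒮).AffineOpenCover where
  I₀ := ι
  X i := .of (Away 𝒮 (x i))
  f i := Proj.awayι 𝒮 (x i) (hx i) (hd i)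
  idx y := (TopologicalSpace.Opens.mem_iSup.1 (hcov.ge (Set.mem_univ y))).choose
  covers y := by
    change y ∈ (Proj.awayι 𝒮 _ _ _).opensRange
    rw [Proj.opensRange_awayι]
    exact (TopologicalSpace.Opens.mem_iSup.1 (hcov.ge (Set.mem_univ y))).choose_spec

variable {𝒮 𝒯}

theorem awayMap_algebraMap (g : 𝒮 →+*ᵍ 𝒯) (hg : ∀ c, g (algebraMap k S c) = algebraMap k T c)
    (f : S) (c : k) : Away.map g f (algebraMap k (Away 𝒮 f) c) = algebraMap k (Away 𝒯 (g f)) c := by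
  refine HomogeneousLocalization.val_injective _ ?_
  have h1 : (⟨g 1, 0, by simp⟩ : Submonoid.powers (g f)) = 1 := Subtype.ext (map_one g)
  change Localization.mk (g (algebraMap k S c)) ⟨g 1, _⟩ = Localization.mk (algebraMap k T c) 1
  rw [hg, h1]

theorem map_projToSpec (g : 𝒮 →+*ᵍ 𝒯) (hirr) (hg : ∀ c, g (algebraMap k S c) = algebraMap k T c) :
    Proj.map g hirr ≫ projToSpec 𝒮 = projToSpec 𝒯 := by
  have key {n : ℕ} (hn : 0 < n) {a : S} (ha : a ∈ 𝒮 n) :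
      Proj.awayι 𝒯 (g a) (g.2 ha) hn ≫ Proj.map g hirr ≫ projToSpec 𝒮 =
        Proj.awayι 𝒯 (g a) (g.2 ha) hn ≫ projToSpec 𝒯 := by
    rw [← Category.assoc, Proj.awayι_comp_map g hirr hn a ha, Category.assoc,
      awayι_projToSpec, awayι_projToSpec, ← Spec.map_comp, ← CommRingCat.ofHom_comp]
    congr 2
    exact RingHom.ext (awayMap_algebraMap g hg a)
  exact (Proj.mapAffineOpenCover g hirr).openCover.hom_ext _ _ fun s => key s.1.2 s.2.2

theorem isClosedImmersion_map_restrict (g : 𝒮 →+*ᵍ 𝒯) (hirr)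
    (hg : ∀ n, ∀ b ∈ 𝒯 n, ∃ a ∈ 𝒮 n, g a = b) {n : ℕ} (hn : 0 < n) {a : S} (ha : a ∈ 𝒮 n) :
    IsClosedImmersion (Proj.map g hirr ∣_ Proj.basicOpen 𝒮 a) := by
  have hsurj : Function.Surjective (Away.map g a) := fun y => by
    obtain ⟨n, b, hb, rfl⟩ := Away.mk_surjective 𝒯 (g.2 ha) y
    obtain ⟨c, hc, rfl⟩ := hg _ b hb
    exact ⟨Away.mk 𝒮 ha n c hc, Away.map_mk g _ ha n c hc⟩
  have := IsClosedImmersion.spec_of_surjective (CommRingCat.ofHom (Away.map g a)) hsurj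
  let e₁ := Proj.basicOpenIsoSpec 𝒯 (g a) (g.2 ha) hn
  let e₂ := Proj.basicOpenIsoSpec 𝒮 a ha hn
  have he₁ : e₁.inv ≫ (Proj.basicOpen 𝒯 (g a)).ι = Proj.awayι 𝒯 (g a) (g.2 ha) hn := rfl
  have he₂ : e₂.inv ≫ (Proj.basicOpen 𝒮 a).ι = Proj.awayι 𝒮 a ha hn := rfl
  let r : (Proj.basicOpen 𝒯 (g a)).toScheme ⟶ (Proj.basicOpen 𝒮 a).toScheme :=
    Proj.map g hirr ∣_ Proj.basicOpen 𝒮 a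
  have hr : r ≫ (Proj.basicOpen 𝒮 a).ι =
      (Proj.basicOpen 𝒯 (g a)).ι ≫ Proj.map g hirr := morphismRestrict_ι _ _
  have h : r = e₁.hom ≫ Spec.map (CommRingCat.ofHom (Away.map g a)) ≫ e₂.inv := by
    rw [← Iso.inv_comp_eq, ← cancel_mono (Proj.basicOpen 𝒮 a).ι, Category.assoc,
      Category.assoc, hr, he₂, ← Proj.awayι_comp_map g hirr hn a ha, ← Category.assoc, he₁]
  have : IsClosedImmersion r := by rw [h]; infer_instance
  exact this

/-- A graded homomorphism that is surjective in every degree induces a closed immersion. -/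
theorem isClosedImmersion_map (g : 𝒮 →+*ᵍ 𝒯) (hirr) (hg : ∀ n, ∀ b ∈ 𝒯 n, ∃ a ∈ 𝒮 n, g a = b) :
    IsClosedImmersion (Proj.map g hirr) := by
  refine IsZariskiLocalAtTarget.of_iSup_eq_top (P := @IsClosedImmersion)
    (fun s : Σ i : PNat, 𝒮 i => Proj.basicOpen 𝒮 (s.2 : S)) ?_ fun s =>
    isClosedImmersion_map_restrict g hirr hg s.1.pos s.2.2
  have h := (Proj.affineOpenCover 𝒮).openCover.iSup_opensRange
  refine h.symm ▸ iSup_congr fun (s : Σ i : PNat, 𝒮 i) => ?_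
  exact (Proj.opensRange_awayι 𝒮 (s.2 : S) s.2.2 s.1.2).symm

section Irreducible

variable (𝒮)

/-- The zero ideal is a generic point. -/
theorem irreducibleSpace_proj [IsDomain S] {x : S} (hx : x ∈ 𝒮 1) (hx0 : x ≠ 0) :
    IrreducibleSpace (Proj 𝒮) := by
  let η : Proj 𝒮 :=
    { asHomogeneousIdeal := ⊥
      isPrime := Ideal.isPrime_bot
      not_irrelevant_le := fun h => hx0 (h (mem_irrelevant_of_mem 𝒮 one_pos hx)) }
  have hη (U : (Proj 𝒮).Opens) (hU : (U : Set (Proj 𝒮)).Nonempty) : η ∈ U := by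
    obtain ⟨y, hy⟩ := hU
    obtain ⟨_, ⟨a, rfl⟩, hya, haU⟩ :=
      TopologicalSpace.Opens.isBasis_iff_nbhd.1 (Proj.isBasis_basicOpen 𝒮) hy
    refine haU fun (ha : a = 0) => hya ?_
    rw [ha]
    exact y.asHomogeneousIdeal.toIdeal.zero_mem
  have : PreirreducibleSpace (Proj 𝒮) := ⟨fun U V hU hV hU' hV' =>
    ⟨η, trivial, hη ⟨U, hU⟩ (by simpa using hU'), hη ⟨V, hV⟩ (by simpa using hV')⟩⟩
  exact ⟨⟨η⟩⟩

end Irreducible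

end Proj

/-! ### The closed subscheme defined by a form -/

section Hypersurface

open MvPolynomial HomogeneousIdeal

attribute [local instance] MvPolynomial.gradedAlgebra

variable {σ : Type} {k : Type u} [Field k] {F : MvPolynomial σ k} {d : ℕ} (hF : F.IsHomogeneous d)

theorem zeroScheme_ι_isClosedImmersion : IsClosedImmersion (zeroScheme.ι hF) := by
  let := quotGradedAlgebra (homogeneousSubmodule σ k) (span_isHomogeneous hF)
  refine isClosedImmersion_map (𝒮 := homogeneousSubmodule σ k) (𝒯 := coordGrading F) _ _ ?_
  rintro n _ ⟨a, ha, rfl⟩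
  exact ⟨a, ha, rfl⟩

theorem zeroScheme_ι_toSpec :
    letI := quotGradedAlgebra (homogeneousSubmodule σ k) (span_isHomogeneous hF)
    zeroScheme.ι hF ≫ ProjSpace.toSpec σ k = projToSpec (coordGrading F) := by
  let := quotGradedAlgebra (homogeneousSubmodule σ k) (span_isHomogeneous hF)
  exact map_projToSpec (𝒮 := homogeneousSubmodule σ k) (𝒯 := coordGrading F) _ _ fun _ => rfl

end Hypersurface

/-! ### The standard charts of a projective hypersurface -/

section HypersurfaceChart

open MvPolynomial HomogeneousIdeal HomogeneousLocalization

attribute [local instance] MvPolynomial.gradedAlgebra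

variable {σ : Type} {k : Type u} [Field k]

theorem aeval_mul_of_isHomogeneous {A : Type*} [CommRing A] [Algebra k A] {q : MvPolynomial σ k}
    {n : ℕ} (hq : q.IsHomogeneous n) (r : A) (f : σ → A) :
    aeval (fun j => r * f j) q = r ^ n * aeval f q := by
  rw [q.as_sum, map_sum, map_sum, Finset.mul_sum]
  refine Finset.sum_congr rfl fun m hm => ?_
  have hd := hq (mem_support_iff.1 hm)
  simp only [Finsupp.weight_apply, Pi.one_apply, smul_eq_mul, mul_one] at hd
  rw [aeval_monomial, aeval_monomial, Finsupp.prod, Finsupp.prod]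
  simp only [mul_pow, Finset.prod_mul_distrib, Finset.prod_pow_eq_pow_sum]
  rw [show ∑ i ∈ m.support, m i = n from hd]
  ring

variable (F : MvPolynomial σ k) (i : σ)

/-- The class of the coordinate `X i` in the homogeneous coordinate ring of the hypersurface. -/
abbrev coordX (i : σ) : MvPolynomial σ k ⧸ Ideal.span {F} := Ideal.Quotient.mk _ (X i)

variable {F} in
theorem mk_mem_coordGrading {q : MvPolynomial σ k} {n : ℕ} (hq : q.IsHomogeneous n) :
    Ideal.Quotient.mk (Ideal.span {F}) q ∈ coordGrading F n :=
  mk_mem_quotGrading (homogeneousSubmodule σ k) _ hq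

theorem coordX_mem : coordX F i ∈ coordGrading F 1 := mk_mem_coordGrading (isHomogeneous_X k i)

theorem adjoin_coordX : Algebra.adjoin k (Set.range (coordX F)) = ⊤ := by
  have h : Set.range (coordX F) = Ideal.Quotient.mkₐ k (Ideal.span {F}) '' Set.range X :=
    Set.range_comp (Ideal.Quotient.mkₐ k (Ideal.span {F})) X
  rw [h, ← AlgHom.map_adjoin, adjoin_range_X, Algebra.map_top, AlgHom.range_eq_top]
  exact Ideal.Quotient.mk_surjective

/-- The coordinate ring of the chart `X i ≠ 0` of the hypersurface `F = 0`. -/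
abbrev ChartRing : Type u := MvPolynomial {j // j ≠ i} k ⧸ Ideal.span {dehomogenize i F}

/-- Dehomogenization, from the homogeneous coordinate ring to the coordinate ring of a chart. -/
def coordToChart : (MvPolynomial σ k ⧸ Ideal.span {F}) →ₐ[k] ChartRing F i :=
  Ideal.quotientMapₐ _ (dehomogenize i) (by
    rw [Ideal.span_le, Set.singleton_subset_iff]
    exact Ideal.mem_span_singleton_self _)

theorem coordToChart_mk (q : MvPolynomial σ k) :
    coordToChart F i (Ideal.Quotient.mk _ q) = Ideal.Quotient.mk _ (dehomogenize i q) := rfl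

theorem coordToChart_coordX_self : coordToChart F i (coordX F i) = 1 := by
  rw [coordToChart_mk, dehomogenize_X_self, map_one]

theorem isUnit_coordToChart : IsUnit ((coordToChart F i).toRingHom (coordX F i)) := by
  change IsUnit (coordToChart F i (coordX F i))
  rw [coordToChart_coordX_self]
  exact isUnit_one

variable [GradedAlgebra (coordGrading F)]

/-- The degree zero part of the localization of the homogeneous coordinate ring away from `X i` maps
to the coordinate ring of the chart `X i ≠ 0`. -/
def awayToChart : Away (coordGrading F) (coordX F i) →ₐ[k] ChartRing F i where
  __ := (Localization.awayLift (coordToChart F i).toRingHom (coordX F i)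
    (isUnit_coordToChart F i)).comp
      (algebraMap _ (Localization.Away (coordX F i)))
  commutes' c := by
    change Localization.awayLift (coordToChart F i).toRingHom (coordX F i)
      (isUnit_coordToChart F i)
      (algebraMap k (Away (coordGrading F) (coordX F i)) c).val = _
    rw [val_algebraMap_away, Localization.awayLift, IsLocalization.Away.lift_eq]
    exact (coordToChart F i).commutes c

theorem awayToChart_mk (n : ℕ) (s : MvPolynomial σ k ⧸ Ideal.span {F}) (hs) :
    awayToChart F i (Away.mk (coordGrading F) (coordX_mem F i) n s hs) = coordToChart F i s := by
  change Localization.awayLift (coordToChart F i).toRingHom (coordX F i)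
      (isUnit_coordToChart F i)
    (Localization.mk s _) = _
  have h := coordToChart_coordX_self F i
  rw [Localization.mk_eq_mk', Localization.awayLift, IsLocalization.Away.lift,
    IsLocalization.lift_mk'_spec]
  simp [h]

/-- The fractions `X j / X i`. -/
def chartCoord (j : σ) : Away (coordGrading F) (coordX F i) :=
  Away.mk (coordGrading F) (coordX_mem F i) 1 (coordX F j) (by simpa using coordX_mem F j)

theorem coordX_mul_chartCoord (j : σ) :
    algebraMap _ (Localization.Away (coordX F i)) (coordX F i) * (chartCoord F i j).val =
      algebraMap _ (Localization.Away (coordX F i)) (coordX F j) := by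
  rw [chartCoord, Away.val_mk, Localization.mk_eq_mk', mul_comm]
  simp

/-- Homogenization: it sends a polynomial in the variables `j ≠ i` to its value at the fractions
`X j / X i`. -/
def chartToAway : MvPolynomial {j // j ≠ i} k →ₐ[k] Away (coordGrading F) (coordX F i) :=
  aeval fun j => chartCoord F i j

/-- Values in degree zero are compared with those in the full localization. -/
def awayVal : Away (coordGrading F) (coordX F i) →ₐ[k] Localization.Away (coordX F i) where
  __ := algebraMap (Away (coordGrading F) (coordX F i)) (Localization.Away (coordX F i))
  commutes' c := (val_algebraMap_away (coordGrading F) (coordX F i) c).trans rfl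

/-- A form of degree `n` is `X i ^ n` times the value of its dehomogenization at the `X j / X i`. -/
theorem awayVal_chartToAway {q : MvPolynomial σ k} {n : ℕ} (hq : q.IsHomogeneous n) :
    algebraMap _ (Localization.Away (coordX F i)) (coordX F i) ^ n *
      awayVal F i (chartToAway F i (dehomogenize i q)) =
        algebraMap (MvPolynomial σ k ⧸ Ideal.span {F}) (Localization.Away (coordX F i))
          (Ideal.Quotient.mk (Ideal.span {F}) q) := by
  have h1 : (awayVal F i).comp ((chartToAway F i).comp (dehomogenize i)) =
      aeval fun j => (chartCoord F i j).val := by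
    refine MvPolynomial.algHom_ext fun j => ?_
    rw [aeval_X, AlgHom.comp_apply, AlgHom.comp_apply]
    rcases eq_or_ne j i with rfl | hj
    · rw [dehomogenize_X_self, map_one, map_one, chartCoord, Away.val_mk]
      simp only [pow_one]
      exact (Localization.mk_self
        (⟨coordX F j, 1, by simp⟩ : Submonoid.powers (coordX F j))).symm
    · rw [dehomogenize_X i hj, chartToAway, aeval_X]
      rfl
  have h2 : (IsScalarTower.toAlgHom k (MvPolynomial σ k ⧸ Ideal.span {F})
      (Localization.Away (coordX F i))).comp (Ideal.Quotient.mkₐ k (Ideal.span {F})) = aeval fun j =>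
        algebraMap _ (Localization.Away (coordX F i)) (coordX F i) * (chartCoord F i j).val := by
    refine MvPolynomial.algHom_ext fun j => ?_
    rw [aeval_X, coordX_mul_chartCoord]
    rfl
  have h3 := AlgHom.congr_fun h1 q
  have h4 := AlgHom.congr_fun h2 q
  rw [aeval_mul_of_isHomogeneous hq, ← h3] at h4
  exact h4.symm

theorem chartToAway_dehomogenize_self {d : ℕ} (hF : F.IsHomogeneous d) :
    chartToAway F i (dehomogenize i F) = 0 := by
  have h := awayVal_chartToAway F i hF
  rw [Ideal.Quotient.eq_zero_iff_mem.2 (Ideal.mem_span_singleton_self F), map_zero] at h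
  have hu := (IsLocalization.Away.algebraMap_isUnit (S := Localization.Away (coordX F i))
    (coordX F i)).pow d
  exact HomogeneousLocalization.val_injective _ ((hu.mul_right_eq_zero.1 h).trans
    (map_zero (awayVal F i)).symm)

theorem chartToAway_dehomogenize (n : ℕ) (q : MvPolynomial σ k) (hq : q.IsHomogeneous n) (hs) :
    chartToAway F i (dehomogenize i q) =
      Away.mk (coordGrading F) (coordX_mem F i) n (Ideal.Quotient.mk _ q) hs := by
  have h := awayVal_chartToAway F i hq
  have hu := (IsLocalization.Away.algebraMap_isUnit (S := Localization.Away (coordX F i))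
    (coordX F i)).pow n
  refine HomogeneousLocalization.val_injective _ (hu.mul_left_cancel (h.trans ?_))
  rw [Away.val_mk, Localization.mk_eq_mk', mul_comm]
  have := IsLocalization.mk'_spec (Localization.Away (coordX F i)) (Ideal.Quotient.mk _ q)
    (⟨coordX F i ^ n, n, rfl⟩ : Submonoid.powers (coordX F i))
  simpa using this.symm

theorem awayToChart_bijective {d : ℕ} (hF : F.IsHomogeneous d) :
    Function.Bijective (awayToChart F i) := by
  constructor
  · refine (injective_iff_map_eq_zero _).2 fun y hy => ?_
    obtain ⟨n, s, hs, rfl⟩ := Away.mk_surjective _ (coordX_mem F i) y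
    have hs' := hs
    obtain ⟨q, hq, rfl⟩ := hs'
    rw [awayToChart_mk] at hy
    have hq' : q.IsHomogeneous n := by simpa using hq
    obtain ⟨r, hr⟩ := Ideal.mem_span_singleton.1 (Ideal.Quotient.eq_zero_iff_mem.1 hy)
    refine (chartToAway_dehomogenize F i n q hq' hs).symm.trans ?_
    rw [show dehomogenize i q = _ from hr, map_mul, chartToAway_dehomogenize_self F i hF, zero_mul]
  · intro y
    obtain ⟨q, rfl⟩ := Ideal.Quotient.mk_surjective y
    refine ⟨chartToAway F i q, ?_⟩
    have : (awayToChart F i).comp (chartToAway F i) = Ideal.Quotient.mkₐ k _ := by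
      refine MvPolynomial.algHom_ext fun j => ?_
      rw [AlgHom.comp_apply, chartToAway, aeval_X, chartCoord, awayToChart_mk, coordToChart_mk,
        dehomogenize_X i j.2]
      rfl
    exact AlgHom.congr_fun this q

/-- The chart `X i ≠ 0` of the hypersurface `F = 0` is the affine hypersurface defined by the
dehomogenization of `F`. -/
def awayEquivChart {d : ℕ} (hF : F.IsHomogeneous d) :
    Away (coordGrading F) (coordX F i) ≃ₐ[k] ChartRing F i :=
  AlgEquiv.ofBijective (awayToChart F i) (awayToChart_bijective F i hF)

end HypersurfaceChart

/-! ### Smoothness, irreducibility and dimension of the hypersurface -/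

section HypersurfaceGeometry

open MvPolynomial HomogeneousLocalization

attribute [local instance] MvPolynomial.gradedAlgebra

variable (p : ℕ) [Fact p.Prime] (k : Type u) [Field k]

/-- The homogeneous coordinate ring of the hypersurface is a graded algebra. -/
instance coordGradedAlgebra : GradedAlgebra (coordGrading (poly p k)) :=
  quotGradedAlgebra (homogeneousSubmodule (ZMod p) k) (span_isHomogeneous (poly_isHomogeneous p k))

theorem hypersurface_toSpec : hypersurface.toSpec p k = projToSpec (coordGrading (poly p k)) :=
  zeroScheme_ι_toSpec (poly_isHomogeneous p k)

theorem isHypersurface_ι [CharP k p] : IsHypersurface (hypersurface.ι p k) p :=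
  ⟨zeroScheme_ι_isClosedImmersion _, poly p k, poly_isHomogeneous p k, poly_ne_zero p k, Iso.refl _,
    Category.id_comp _⟩

theorem iSup_basicOpen_coordX :
    ⨆ i, Proj.basicOpen (coordGrading (poly p k)) (coordX (poly p k) i) = ⊤ :=
  iSup_basicOpen_eq_top_of_adjoin _ _ (coordX_mem _) (adjoin_coordX _)

/-- The standard affine charts of the hypersurface. -/
def hypersurfaceCover : (Proj (coordGrading (poly p k))).AffineOpenCover :=
  projCover _ (coordX (poly p k)) (coordX_mem _) (fun _ => one_pos) (iSup_basicOpen_coordX p k)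

/-- The form `X i` is not a multiple of the equation, which vanishes at the `i`-th coordinate point. -/
theorem coordX_ne_zero (hp : 2 < p) (i : ZMod p) : coordX (poly p k) i ≠ 0 := fun h => by
  obtain ⟨q, hq⟩ := Ideal.mem_span_singleton.1 (Ideal.Quotient.eq_zero_iff_mem.1 h)
  have h1 := congrArg (eval (homogenizePoint i (0 : {j // j ≠ i} → k))) hq
  rw [map_mul, ← eval_dehomogenize i _ (poly p k), eval_zero,
    constantCoeff_dehomogenize_poly p k hp, zero_mul, eval_X] at h1
  simp [homogenizePoint] at h1

variable [CharP k p] [IsAlgClosed k]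

theorem smooth_hypersurface (hp : 2 < p) : Smooth (hypersurface.toSpec p k) := by
  rw [hypersurface_toSpec]
  have : IsZariskiLocalAtSource @Smooth.{u} := HasRingHomProperty.instIsZariskiLocalAtSource
  refine IsZariskiLocalAtSource.of_openCover (P := @Smooth.{u}) (hypersurfaceCover p k).openCover
    fun i => ?_
  have h := awayι_projToSpec (coordGrading (poly p k)) (coordX_mem (poly p k) i) one_pos
  refine (congrArg (@Smooth _ _) h).mpr ?_
  rw [HasRingHomProperty.Spec_iff (P := @Smooth), CommRingCat.hom_ofHom, RingHom.smooth_algebraMap]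
  have := smooth_chart p k hp i
  exact .of_equiv (awayEquivChart (poly p k) i (poly_isHomogeneous p k)).symm

theorem isDomain_coord (hp : 2 < p) : IsDomain (MvPolynomial (ZMod p) k ⧸ Ideal.span {poly p k}) :=
  (Ideal.Quotient.isDomain_iff_prime _).2
    ((Ideal.span_singleton_prime (poly_ne_zero p k)).2 (poly_irreducible p k hp).prime)

theorem irreducibleSpace_hypersurface (hp : 2 < p) : IrreducibleSpace (hypersurface p k) :=
  have := isDomain_coord p k hp
  irreducibleSpace_proj (coordGrading (poly p k)) (coordX_mem (poly p k) 0) (coordX_ne_zero p k hp 0)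

theorem topologicalKrullDim_hypersurface (hp : 2 < p) :
    topologicalKrullDim (hypersurface p k) = ((p - 2 : ℕ) : WithBot ℕ∞) := by
  have : IrreducibleSpace (Proj (coordGrading (poly p k))) := irreducibleSpace_hypersurface p k hp
  let φ (i : ZMod p) := Proj.awayι (coordGrading (poly p k)) _ (coordX_mem (poly p k) i) one_pos
  refine topologicalKrullDim_eq_of_cover (X := Proj (coordGrading (poly p k))) (fun i => φ i)
    (fun i => (φ i).isOpenEmbedding) (fun x => ?_) fun i => ?_
  · obtain ⟨i, hi⟩ := TopologicalSpace.Opens.mem_iSup.1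
      ((iSup_basicOpen_coordX p k).ge (Set.mem_univ x))
    refine ⟨i, ?_⟩
    rw [← Proj.opensRange_awayι _ _ (coordX_mem (poly p k) i) one_pos] at hi
    exact hi
  · refine (PrimeSpectrum.topologicalKrullDim_eq_ringKrullDim _).trans ?_
    rw [← ringKrullDim_chart p k hp i]
    exact ringKrullDim_eq_of_ringEquiv
      (awayEquivChart (poly p k) i (poly_isHomogeneous p k)).toRingEquiv

end HypersurfaceGeometry

/-! ### Actions on the projective scheme of a graded algebra -/

section GradedAutomorphism

variable {k : Type u} [Field k] {S : Type u} [CommRing S] [Algebra k S] {𝒮 : ℕ → Submodule k S}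
  {G : Type} [CommGroup G] (θ : G →* (S ≃ₐ[k] S)) (hθ : ∀ g n, ∀ a ∈ 𝒮 n, θ g a ∈ 𝒮 n)

/-- A graded automorphism, as a graded ring homomorphism. -/
def actionHom (g : G) : 𝒮 →+*ᵍ 𝒮 where
  __ := (θ g : S →+* S)
  map_mem := fun h => hθ g _ _ h

theorem actionHom_apply (g : G) (a : S) : actionHom θ hθ g a = θ g a := rfl

end GradedAutomorphism

section GradedAction

open HomogeneousIdeal HomogeneousLocalization

variable {k : Type u} [Field k] {S : Type u} [CommRing S] [Algebra k S]
  (𝒮 : ℕ → Submodule k S) [GradedAlgebra 𝒮]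

theorem finiteType_over_degreeZero [Algebra.FiniteType k S] : Algebra.FiniteType (𝒮 0) S := by
  have h : ((algebraMap (𝒮 0) S).comp (algebraMap k (𝒮 0))).FiniteType :=
    (RingHom.finiteType_algebraMap (A := k) (B := S)).2 inferInstance
  exact RingHom.finiteType_algebraMap.1 (RingHom.FiniteType.of_comp_finiteType h)

theorem finiteType_away [Algebra.FiniteType k S] (h0 : Function.Surjective (algebraMap k (𝒮 0)))
    {f : S} {d : ℕ} (hf : f ∈ 𝒮 d) : Algebra.FiniteType k (Away 𝒮 f) := by
  have := finiteType_over_degreeZero 𝒮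
  have h := (RingHom.finiteType_algebraMap (A := 𝒮 0) (B := Away 𝒮 f)).2 (Away.finiteType f d hf)
  exact RingHom.finiteType_algebraMap.1 (h.comp (RingHom.FiniteType.of_surjective _ h0))

/-- If the scalars are all the elements of degree zero, then `Proj` is proper over the field. -/
theorem isProper_projToSpec [Algebra.FiniteType k S]
    (h0 : Function.Surjective (algebraMap k (𝒮 0))) : IsProper (projToSpec 𝒮) := by
  have := finiteType_over_degreeZero 𝒮
  have := IsClosedImmersion.spec_of_surjective (CommRingCat.ofHom (algebraMap k (𝒮 0))) h0
  rw [projToSpec]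
  infer_instance

variable {𝒮}

/-- At a closed point over an algebraically closed field the linear forms are pairwise
proportional. -/
theorem exists_sub_smul_mem [IsAlgClosed k] {f a : S} (hf : f ∈ 𝒮 1) (ha : a ∈ 𝒮 1)
    [Algebra.FiniteType k (Away 𝒮 f)] {x : Proj 𝒮} (hx : IsClosed {x})
    (hfx : f ∉ x.asHomogeneousIdeal) : ∃ c : k, a - c • f ∈ x.asHomogeneousIdeal := by
  have hx' : x ∈ (Proj.awayι 𝒮 f hf one_pos).opensRange := by
    rw [Proj.opensRange_awayι]; exact hfx
  obtain ⟨y, rfl⟩ := hx'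
  have hy : IsClosed {y} := by
    have h := hx.preimage (Proj.awayι 𝒮 f hf one_pos).continuous
    rwa [← Set.image_singleton, Set.preimage_image_eq _
      (Proj.awayι 𝒮 f hf one_pos).isOpenEmbedding.injective] at h
  have hmax : y.asIdeal.IsMaximal := (PrimeSpectrum.isClosed_singleton_iff_isMaximal y).1 hy
  let : Field (Away 𝒮 f ⧸ y.asIdeal) := Ideal.Quotient.field _
  have : Algebra.FiniteType k (Away 𝒮 f ⧸ y.asIdeal) :=
    .of_surjective (Ideal.Quotient.mkₐ k y.asIdeal) Ideal.Quotient.mk_surjective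
  have := finite_of_finite_type_of_isJacobsonRing k (Away 𝒮 f ⧸ y.asIdeal)
  obtain ⟨c, hc⟩ := (IsAlgClosed.algebraMap_bijective_of_isIntegral (k := k)
    (K := Away 𝒮 f ⧸ y.asIdeal)).2
    (Ideal.Quotient.mk _ (Away.mk 𝒮 hf 1 a (by simpa using ha)))
  refine ⟨c, ?_⟩
  have hac : a - c • f ∈ 𝒮 1 := sub_mem ha (Submodule.smul_mem _ c hf)
  by_contra hn
  have h1 : y ∈ Proj.awayι 𝒮 f hf one_pos ⁻¹ᵁ Proj.basicOpen 𝒮 (a - c • f) := hn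
  rw [Proj.awayι_preimage_basicOpen 𝒮 hf one_pos hac one_pos] at h1
  refine h1 ?_
  have h2 : Away.isLocalizationElem hf hac =
      Away.mk 𝒮 hf 1 a (by simpa using ha) - algebraMap k (Away 𝒮 f) c := by
    refine HomogeneousLocalization.val_injective _ ?_
    rw [val_sub, val_algebraMap_away, Away.val_mk, Away.val_mk, pow_one, ← sub_eq_zero]
    have hu := IsLocalization.Away.algebraMap_isUnit (S := Localization.Away f) f
    have hmk (z : S) : algebraMap S (Localization.Away f) f *
        Localization.mk z (⟨f ^ 1, 1, rfl⟩ : Submonoid.powers f) = algebraMap S _ z := by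
      rw [Localization.mk_eq_mk']; simp
    refine hu.mul_right_eq_zero.1 ?_
    rw [mul_sub, mul_sub, hmk, hmk, ← map_mul, ← map_sub, ← map_sub, Algebra.smul_def]
    rw [mul_comm f, sub_self, map_zero]
  rw [h2, ← Ideal.Quotient.eq_zero_iff_mem, map_sub, ← hc]
  exact sub_self _

variable {G : Type} [CommGroup G] (θ : G →* (S ≃ₐ[k] S)) (hθ : ∀ g n, ∀ a ∈ 𝒮 n, θ g a ∈ 𝒮 n)

theorem irrelevant_le_map_actionHom (g : G) :
    irrelevant 𝒮 ≤ (irrelevant 𝒮).map (actionHom θ hθ g) :=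
  (HomogeneousIdeal.irrelevant_le _).2 fun i hi a ha => by
    have h : actionHom θ hθ g (θ g⁻¹ a) = a := by
      rw [actionHom_apply, ← AlgEquiv.mul_apply, ← map_mul, mul_inv_cancel, map_one]
      rfl
    rw [← h]
    exact Ideal.mem_map_of_mem _ (mem_irrelevant_of_mem _ hi (hθ _ _ _ ha))

/-- The automorphism of `Proj` induced by a graded automorphism. -/
def actionMap (g : G) : Proj 𝒮 ⟶ Proj 𝒮 :=
  Proj.map (actionHom θ hθ g) (irrelevant_le_map_actionHom θ hθ g)

theorem actionMap_one : actionMap θ hθ 1 = 𝟙 _ := by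
  have h : actionHom θ hθ 1 = GradedRingHom.id _ := by
    ext1 x
    rw [actionHom_apply, map_one]
    rfl
  refine Eq.trans ?_ (Proj.map_id (𝒜 := 𝒮))
  simp only [actionMap, h]

theorem actionMap_comp (g h : G) : actionMap θ hθ g ≫ actionMap θ hθ h = actionMap θ hθ (g * h) := by
  have e : actionHom θ hθ (g * h) = (actionHom θ hθ g).comp (actionHom θ hθ h) := by
    ext1 x
    rw [actionHom_apply, map_mul]
    rfl
  refine (Proj.map_comp _ _ (irrelevant_le_map_actionHom θ hθ h)
    (irrelevant_le_map_actionHom θ hθ g)).symm.trans ?_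
  simp only [actionMap, e]

/-- The action on `Proj` of a commutative group acting on a graded algebra. -/
def projAction : G →* Aut (Proj 𝒮) where
  toFun g :=
    { hom := actionMap θ hθ g
      inv := actionMap θ hθ g⁻¹
      hom_inv_id := by rw [actionMap_comp, mul_inv_cancel, actionMap_one]
      inv_hom_id := by rw [actionMap_comp, inv_mul_cancel, actionMap_one] }
  map_one' := Iso.ext (actionMap_one θ hθ)
  map_mul' g h := Iso.ext (by
    refine Eq.trans ?_ (actionMap_comp θ hθ h g).symm
    change actionMap θ hθ _ = actionMap θ hθ _
    rw [mul_comm])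

/-- The homogeneous ideal of a fixed point is stable. -/
theorem mem_of_projAction_eq {g : G} {x : Proj 𝒮} (hx : (projAction θ hθ g).hom x = x) {a : S}
    (ha : a ∈ x.asHomogeneousIdeal) : θ g a ∈ x.asHomogeneousIdeal := by
  have h : a ∈ ((projAction θ hθ g).hom x).asHomogeneousIdeal := by rwa [hx]
  exact h

end GradedAction

/-! ### The action on the hypersurface and its fixed points -/

section Shift

open MvPolynomial HomogeneousIdeal HomogeneousLocalization

attribute [local instance] MvPolynomial.gradedAlgebra

variable (p : ℕ) [Fact p.Prime] (k : Type u) [Field k]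

/-- The action of `ℤ/p` on the homogeneous coordinate ring of the hypersurface by shifts of the
variables. -/
def shift : Multiplicative (ZMod p) →* ((MvPolynomial (ZMod p) k ⧸ Ideal.span {poly p k}) ≃ₐ[k]
    (MvPolynomial (ZMod p) k ⧸ Ideal.span {poly p k})) where
  toFun g := Ideal.quotientEquivAlg _ _ (renameEquiv k (Equiv.addRight g.toAdd)) (by
    rw [Ideal.map_span, Set.image_singleton]
    congr 2
    exact (rename_poly p g.toAdd).symm)
  map_one' := by
    ext x
    obtain ⟨q, rfl⟩ := Ideal.Quotient.mk_surjective x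
    change Ideal.Quotient.mk _ (rename _ q) = Ideal.Quotient.mk _ q
    simp
  map_mul' g h := by
    ext x
    obtain ⟨q, rfl⟩ := Ideal.Quotient.mk_surjective x
    change Ideal.Quotient.mk _ (rename _ q) = Ideal.Quotient.mk _ (rename _ (rename _ q))
    rw [rename_rename]
    congr 3
    funext i
    simp [add_comm, add_left_comm]

theorem shift_mk (g : Multiplicative (ZMod p)) (q : MvPolynomial (ZMod p) k) :
    shift p k g (Ideal.Quotient.mk _ q) =
      Ideal.Quotient.mk _ (rename (Equiv.addRight g.toAdd) q) := rfl

theorem shift_mem (g : Multiplicative (ZMod p)) (n : ℕ) :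
    ∀ a ∈ coordGrading (poly p k) n, shift p k g a ∈ coordGrading (poly p k) n := by
  rintro _ ⟨q, hq, rfl⟩
  exact mk_mem_coordGrading (IsHomogeneous.rename_isHomogeneous hq)

/-- The action of `ℤ/p` on the hypersurface by shifts of the coordinates. -/
def hypersurfaceAction : Multiplicative (ZMod p) →* Aut (Proj (coordGrading (poly p k))) :=
  projAction (shift p k) (shift_mem p k)

/-- The projection to the homogeneous coordinate ring of the hypersurface. -/
def coordHom : homogeneousSubmodule (ZMod p) k →+*ᵍ coordGrading (poly p k) where
  __ := Ideal.Quotient.mk (Ideal.span {poly p k})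
  map_mem := fun h => mk_mem_quotGrading _ _ h

theorem irrelevant_le_map_coordHom : irrelevant (coordGrading (poly p k)) ≤
    (irrelevant (homogeneousSubmodule (ZMod p) k)).map (coordHom p k) :=
  (HomogeneousIdeal.irrelevant_le _).2 fun i hi => by
    rintro _ ⟨a, ha, rfl⟩
    exact Ideal.mem_map_of_mem _ (mem_irrelevant_of_mem _ hi ha)

theorem hypersurfaceAction_ι (g : Multiplicative (ZMod p)) :
    (hypersurfaceAction p k g).hom ≫ (hypersurface.ι p k :
      Proj (coordGrading (poly p k)) ⟶ ProjSpace (ZMod p) k) =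
        hypersurface.ι p k ≫ (shiftAction k p g).hom := by
  have h : (actionHom (shift p k) (shift_mem p k) g).comp (coordHom p k) =
      (coordHom p k).comp (permHom (Equiv.addRight g.toAdd)) := by
    ext1 x
    rfl
  have h1 := Proj.map_comp (coordHom p k) (actionHom (shift p k) (shift_mem p k) g)
    (irrelevant_le_map_coordHom p k) (irrelevant_le_map_actionHom (shift p k) (shift_mem p k) g)
  have h2 := Proj.map_comp (permHom (Equiv.addRight g.toAdd)) (coordHom p k)
    (irrelevant_le_map_permHom _) (irrelevant_le_map_coordHom p k)
  refine h1.symm.trans (Eq.trans ?_ h2)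
  simp only [h]

theorem map_poly_of_forall_eq {A : Type*} [CommRing A] (φ : MvPolynomial (ZMod p) k →+* A) {a : A}
    (h : ∀ j, φ (X j) = a) : φ (poly p k) = a ^ p + p * a ^ p := by
  have hp1 : p - 1 + 1 = p := Nat.sub_add_cancel (Fact.out (p := p.Prime)).one_le
  simp [poly, h, ZMod.card, ← pow_succ, hp1]

variable {p k} in
/-- The group acts on the hypersurface without fixed closed points. At a fixed closed point the shift
by `c` multiplies the coordinates by a scalar `l` with `l ^ p = 1`, so that `l = 1` in
characteristic `p`. Hence all the coordinates agree, but the equation takes the value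
`x ^ p + p x ^ p = x ^ p` at `(x, …, x)`. -/
theorem hypersurfaceAction_ne [CharP k p] [IsAlgClosed k] (hp : 2 < p)
    {g : Multiplicative (ZMod p)} (hg : g ≠ 1) {x : Proj (coordGrading (poly p k))}
    (hx : IsClosed {x}) : (hypersurfaceAction p k g).hom x ≠ x := by
  intro hgx
  obtain ⟨i, hi⟩ := TopologicalSpace.Opens.mem_iSup.1
    ((iSup_basicOpen_coordX p k).ge (Set.mem_univ x))
  change coordX (poly p k) i ∉ x.asHomogeneousIdeal at hi
  set c := g.toAdd with hc
  have hc0 : c ≠ 0 := fun h => hg (Multiplicative.toAdd.injective h)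
  have hshift (j : ZMod p) : shift p k g (coordX (poly p k) j) = coordX (poly p k) (j + c) := by
    rw [shift_mk, rename_X]; rfl
  let I := x.asHomogeneousIdeal.toIdeal
  have hI : I.IsPrime := x.isPrime
  have : Algebra.FiniteType k (Away (coordGrading (poly p k)) (coordX (poly p k) i)) :=
    .equiv inferInstance (awayEquivChart (poly p k) i (poly_isHomogeneous p k)).symm
  obtain ⟨l, hl⟩ := exists_sub_smul_mem (coordX_mem (poly p k) i) (coordX_mem (poly p k) (i + c))
    hx hi
  -- Iterating the shift `n` times multiplies the coordinate by `l ^ n` at the point `x`.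
  have hiter (n : ℕ) :
      coordX (poly p k) (i + n * c) - (l ^ n) • coordX (poly p k) i ∈ I := by
    induction n with
    | zero => simp
    | succ n ih =>
      have h1 := mem_of_projAction_eq (shift p k) (shift_mem p k) hgx ih
      rw [map_sub, map_smul, hshift, hshift] at h1
      have h2 := I.add_mem h1 (Submodule.smul_of_tower_mem I (l ^ n) hl)
      convert h2 using 1
      rw [smul_sub, smul_smul, pow_succ, Nat.cast_succ, add_mul, one_mul, add_assoc]
      abel
  have hl1 : l = 1 := by
    have h1 := hiter p
    rw [CharP.cast_eq_zero, zero_mul, add_zero] at h1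
    have h2 : (1 - l ^ p) • coordX (poly p k) i ∈ I := by rwa [sub_smul, one_smul]
    have h3 : 1 - l ^ p = 0 := by
      by_contra h3
      have h4 := Submodule.smul_of_tower_mem I (1 - l ^ p)⁻¹ h2
      rw [smul_smul, inv_mul_cancel₀ h3, one_smul] at h4
      exact hi h4
    rw [← one_pow p, ← sub_pow_char, pow_eq_zero_iff (by omega)] at h3
    exact (sub_eq_zero.1 h3).symm
  have hall (j : ZMod p) : Ideal.Quotient.mk I (coordX (poly p k) j) =
      Ideal.Quotient.mk I (coordX (poly p k) i) := by
    have h1 := hiter ((j - i) * c⁻¹).val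
    rw [ZMod.natCast_zmod_val, mul_assoc, inv_mul_cancel₀ hc0, mul_one, hl1, one_pow, one_smul,
      add_sub_cancel] at h1
    exact Ideal.Quotient.eq.2 h1
  have h0 : Ideal.Quotient.mk I (Ideal.Quotient.mk (Ideal.span {poly p k}) (poly p k)) = 0 := by
    rw [Ideal.Quotient.eq_zero_iff_mem.2 (Ideal.mem_span_singleton_self _), map_zero]
  have h1 := map_poly_of_forall_eq p k
    ((Ideal.Quotient.mk I).comp (Ideal.Quotient.mk (Ideal.span {poly p k}))) hall
  rw [RingHom.comp_apply, h0] at h1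
  have hpz : ((p : ℕ) : (MvPolynomial (ZMod p) k ⧸ Ideal.span {poly p k}) ⧸ I) = 0 := by
    have := congrArg (algebraMap k ((MvPolynomial (ZMod p) k ⧸ Ideal.span {poly p k}) ⧸ I))
      (CharP.cast_eq_zero k p)
    rwa [map_natCast, map_zero] at this
  rw [hpz, zero_mul, add_zero, ← map_pow, eq_comm, Ideal.Quotient.eq_zero_iff_mem] at h1
  exact hi (hI.mem_of_pow_mem _ h1)

end Shift

/-! ### Morphisms of projective schemes that multiply degrees -/

section Scale

open HomogeneousIdeal HomogeneousLocalization

variable {k : Type u} [Field k] {A B : Type u} [CommRing A] [Algebra k A] [CommRing B] [Algebra k B]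
  {𝒜 : ℕ → Submodule k A} {ℬ : ℕ → Submodule k B}
  (ψ : B →ₐ[k] A) {e : ℕ} (hψ : ∀ n, ∀ b ∈ ℬ n, ψ b ∈ 𝒜 (e * n))

/-- The map between degree zero parts of localizations induced by a homomorphism that multiplies
degrees by `e`. -/
def scaleFun {P : Submonoid B} {Q : Submonoid A} (hPQ : P ≤ Q.comap (ψ : B →+* A)) :
    HomogeneousLocalization ℬ P → HomogeneousLocalization 𝒜 Q :=
  Quotient.map'
    (fun x => ⟨e * x.deg, ⟨_, hψ _ _ x.num.2⟩, ⟨_, hψ _ _ x.den.2⟩, hPQ x.den_mem⟩)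
    fun x y (h : x.embedding = y.embedding) => by
      apply_fun IsLocalization.map (Localization Q) (ψ : B →+* A) hPQ at h
      simp_rw [HomogeneousLocalization.NumDenSameDeg.embedding, Localization.mk_eq_mk',
        IsLocalization.map_mk', ← Localization.mk_eq_mk'] at h
      exact h

theorem val_scaleFun {P : Submonoid B} {Q : Submonoid A} (hPQ : P ≤ Q.comap (ψ : B →+* A))
    (y : HomogeneousLocalization ℬ P) :
    (scaleFun ψ hψ hPQ y).val = IsLocalization.map (Localization Q) (ψ : B →+* A) hPQ y.val := by
  obtain ⟨x, rfl⟩ := mk_surjective y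
  rw [val_mk, Localization.mk_eq_mk', IsLocalization.map_mk', ← Localization.mk_eq_mk']
  rfl

variable [GradedAlgebra 𝒜] [GradedAlgebra ℬ]

/-- A homomorphism that multiplies degrees by `e` induces a homomorphism between the degree zero
parts of localizations. -/
def scaleMap {P : Submonoid B} {Q : Submonoid A} (hPQ : P ≤ Q.comap (ψ : B →+* A)) :
    HomogeneousLocalization ℬ P →+* HomogeneousLocalization 𝒜 Q where
  toFun := scaleFun ψ hψ hPQ
  map_add' x y := val_injective _ (by simp only [val_add, val_scaleFun, map_add])
  map_mul' x y := val_injective _ (by simp only [val_mul, val_scaleFun, map_mul])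
  map_zero' := val_injective _ (by simp only [val_zero, val_scaleFun, map_zero])
  map_one' := val_injective _ (by simp only [val_one, val_scaleFun, map_one])

theorem val_scaleMap {P : Submonoid B} {Q : Submonoid A} (hPQ : P ≤ Q.comap (ψ : B →+* A))
    (y : HomogeneousLocalization ℬ P) :
    (scaleMap ψ hψ hPQ y).val = IsLocalization.map (Localization Q) (ψ : B →+* A) hPQ y.val :=
  val_scaleFun ψ hψ hPQ y

variable {t : B} {s : A} (hts : ψ t = s)

/-- A homomorphism `ψ` that multiplies degrees by `e` induces a homomorphism from the degree zero
part of the localization away from `t` to the one away from `s = ψ t`. -/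
def scaleAway : Away ℬ t →+* Away 𝒜 s :=
  scaleMap ψ hψ (by
    rintro _ ⟨n, rfl⟩
    exact ⟨n, by simp [hts]⟩)

theorem scaleAway_mk {m d : ℕ} (ht : t ∈ ℬ m) (hs : s ∈ 𝒜 d) (n : ℕ) (b : B) (hb : b ∈ ℬ (n • m))
    (hb' : ψ b ∈ 𝒜 (n • d)) :
    scaleAway ψ hψ hts (Away.mk ℬ ht n b hb) = Away.mk 𝒜 hs n (ψ b) hb' := by
  refine val_injective _ ?_
  rw [scaleAway, val_scaleMap, Away.val_mk, Away.val_mk, Localization.mk_eq_mk',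
    IsLocalization.map_mk', ← Localization.mk_eq_mk']
  congr 1
  exact Subtype.ext (by simp [hts])

theorem scaleAway_algebraMap (c : k) :
    scaleAway ψ hψ hts (algebraMap k (Away ℬ t) c) = algebraMap k (Away 𝒜 s) c := by
  refine val_injective _ ?_
  rw [scaleAway, val_scaleMap, val_algebraMap_away, val_algebraMap_away, IsLocalization.map_eq]
  congr 1
  exact ψ.commutes c

theorem scaleAway_comp_awayMap {m m' d d' : ℕ} {t' x : B} {s' y : A} (hts' : ψ t' = s')
    (ht : t ∈ ℬ m) (hs : s ∈ 𝒜 d) (ht' : t' ∈ ℬ m') (hs' : s' ∈ 𝒜 d') (hx : x = t * t')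
    (hy : y = s * s') (hxy : ψ x = y) (hd : d = e * m) :
    (scaleAway ψ hψ hxy).comp (awayMap ℬ ht' hx) =
      (awayMap 𝒜 hs' hy).comp (scaleAway ψ hψ hts) := by
  refine RingHom.ext fun z => ?_
  obtain ⟨n, b, hb, rfl⟩ := Away.mk_surjective ℬ ht z
  have hb' : ψ b ∈ 𝒜 (n • d) := by
    have := hψ _ _ hb
    rwa [show e * (n • m) = n • d by rw [hd]; simp only [smul_eq_mul]; ring] at this
  rw [RingHom.comp_apply, RingHom.comp_apply, awayMap_mk, scaleAway_mk ψ hψ hts ht hs n b hb hb',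
    awayMap_mk]
  refine val_injective _ ?_
  rw [scaleAway, val_scaleMap, Away.val_mk, Away.val_mk, Localization.mk_eq_mk',
    IsLocalization.map_mk', ← Localization.mk_eq_mk']
  refine congrArg₂ _ ?_ (Subtype.ext ?_)
  · simp [hts']
  · simp [hxy]

variable {ι : Type*} {t : ι → B} {s : ι → A} (hts : ∀ i, ψ (t i) = s i) (ht : ∀ i, t i ∈ ℬ 1)
  (hs : ∀ i, s i ∈ 𝒜 e) (he : 0 < e) (hcov : ⨆ i, Proj.basicOpen 𝒜 (s i) = ⊤)

/-- The local pieces of a morphism of projective schemes defined by forms of the same degree. -/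
def scaleProjAux (i : ι) : Spec (.of (Away 𝒜 (s i))) ⟶ Proj ℬ :=
  Spec.map (CommRingCat.ofHom (scaleAway ψ hψ (hts i))) ≫ Proj.awayι ℬ (t i) (ht i) one_pos

theorem scaleProjAux_compat (i j : ι) :
    Limits.pullback.fst (Proj.awayι 𝒜 (s i) (hs i) he) (Proj.awayι 𝒜 (s j) (hs j) he) ≫
      scaleProjAux ψ hψ hts ht i =
    Limits.pullback.snd (Proj.awayι 𝒜 (s i) (hs i) he) (Proj.awayι 𝒜 (s j) (hs j) he) ≫
      scaleProjAux ψ hψ hts ht j := by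
  have hij : ψ (t i * t j) = s i * s j := by rw [map_mul, hts, hts]
  rw [← cancel_epi (Proj.pullbackAwayιIso 𝒜 (hs i) he (hs j) he rfl).inv,
    Proj.pullbackAwayιIso_inv_fst_assoc, Proj.pullbackAwayιIso_inv_snd_assoc, scaleProjAux,
    scaleProjAux, ← Spec.map_comp_assoc, ← Spec.map_comp_assoc, ← CommRingCat.ofHom_comp,
    ← CommRingCat.ofHom_comp,
    ← scaleAway_comp_awayMap ψ hψ (hts i) (hts j) (ht i) (hs i) (ht j) (hs j) rfl rfl hij
      (mul_one e).symm,
    ← scaleAway_comp_awayMap ψ hψ (hts j) (hts i) (ht j) (hs j) (ht i) (hs i)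
      (mul_comm (t i) (t j)) (mul_comm (s i) (s j)) hij (mul_one e).symm,
    CommRingCat.ofHom_comp, CommRingCat.ofHom_comp, Spec.map_comp_assoc, Spec.map_comp_assoc,
    Proj.SpecMap_awayMap_awayι, Proj.SpecMap_awayMap_awayι]

/-- The morphism of projective schemes defined by a homomorphism `ψ` that multiplies degrees by `e`,
provided that the images `s i` of some elements `t i` of degree `1` have no common zero. -/
def scaleProj : Proj 𝒜 ⟶ Proj ℬ :=
  (projCover 𝒜 s hs (fun _ => he) hcov).openCover.glueMorphisms (scaleProjAux ψ hψ hts ht)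
    (scaleProjAux_compat ψ hψ hts ht hs he)

theorem awayι_scaleProj (i : ι) :
    Proj.awayι 𝒜 (s i) (hs i) he ≫ scaleProj ψ hψ hts ht hs he hcov =
      Spec.map (CommRingCat.ofHom (scaleAway ψ hψ (hts i))) ≫ Proj.awayι ℬ (t i) (ht i) one_pos :=
  (projCover 𝒜 s hs (fun _ => he) hcov).openCover.ι_glueMorphisms _ _ i

variable (𝒜) in
theorem proj_hom_ext {ι : Type*} {s : ι → A} {e : ℕ} (hs : ∀ i, s i ∈ 𝒜 e) (he : 0 < e)
    (hcov : ⨆ i, Proj.basicOpen 𝒜 (s i) = ⊤) {Z : Scheme.{u}} {f g : Proj 𝒜 ⟶ Z}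
    (h : ∀ i, Proj.awayι 𝒜 (s i) (hs i) he ≫ f = Proj.awayι 𝒜 (s i) (hs i) he ≫ g) : f = g :=
  (projCover 𝒜 s hs (fun _ => he) hcov).openCover.hom_ext _ _ h

theorem scaleProj_projToSpec :
    scaleProj ψ hψ hts ht hs he hcov ≫ projToSpec ℬ = projToSpec 𝒜 := by
  refine proj_hom_ext 𝒜 hs he hcov fun i => ?_
  rw [← Category.assoc, awayι_scaleProj, Category.assoc, awayι_projToSpec, awayι_projToSpec,
    ← Spec.map_comp, ← CommRingCat.ofHom_comp]
  congr 2
  exact RingHom.ext (scaleAway_algebraMap ψ hψ (hts i))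

/-- On the chart of `s j` the function `s i ^ e / s j ^ e` that cuts out the intersection with the chart
of `s i` is the `e`-th power of the image of `t i / t j`. -/
theorem scaleProj_preimage_basicOpen (i : ι) :
    scaleProj ψ hψ hts ht hs he hcov ⁻¹ᵁ Proj.basicOpen ℬ (t i) = Proj.basicOpen 𝒜 (s i) := by
  have key (j : ι) : Proj.awayι 𝒜 (s j) (hs j) he ⁻¹ᵁ
      (scaleProj ψ hψ hts ht hs he hcov ⁻¹ᵁ Proj.basicOpen ℬ (t i)) =
        Proj.awayι 𝒜 (s j) (hs j) he ⁻¹ᵁ Proj.basicOpen 𝒜 (s i) := by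
    rw [← Scheme.Hom.comp_preimage, awayι_scaleProj, Scheme.Hom.comp_preimage,
      Proj.awayι_preimage_basicOpen ℬ (ht j) one_pos (ht i) one_pos,
      Proj.awayι_preimage_basicOpen 𝒜 (hs j) he (hs i) he]
    have hel : Away.isLocalizationElem (hs j) (hs i) =
        scaleAway ψ hψ (hts j) (Away.isLocalizationElem (ht j) (ht i)) ^ e := by
      refine val_injective _ ?_
      rw [val_pow, scaleAway, val_scaleMap, Away.val_mk, Away.val_mk,
        Localization.mk_eq_mk'_apply (t i ^ 1),
        IsLocalization.map_mk', ← Localization.mk_eq_mk', Localization.mk_pow]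
      refine congrArg₂ _ ?_ (Subtype.ext ?_)
      · simp [hts]
      · simp [hts]
    rw [hel, PrimeSpectrum.basicOpen_pow _ _ he]
    rfl
  ext x
  obtain ⟨j, hj⟩ := TopologicalSpace.Opens.mem_iSup.1 (hcov.ge (Set.mem_univ x))
  rw [← Proj.opensRange_awayι 𝒜 (s j) (hs j) he] at hj
  obtain ⟨y, rfl⟩ := hj
  exact (SetLike.ext_iff.1 (key j) y)

end Scale

/-! ### Invariant forms -/

/-- The invariants of a finite group in a finitely generated algebra are finitely generated. -/
theorem exists_finset_adjoin_invariants (k : Type*) {G B : Type*} [Field k] [CommRing B]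
    [Algebra k B] [Algebra.FiniteType k B] [Group G] [Finite G] [MulSemiringAction G B]
    (hk : ∀ (g : G) (c : k), g • algebraMap k B c = algebraMap k B c) :
    ∃ T : Finset B, (∀ t ∈ T, ∀ g : G, g • t = t) ∧
      ∀ y : B, (∀ g : G, g • y = y) → y ∈ Algebra.adjoin k (T : Set B) := by
  classical
  have : SMulCommClass G k B := ⟨fun g c y => by
    rw [Algebra.smul_def, Algebra.smul_def, smul_mul', hk]⟩
  let C := FixedPoints.subalgebra k B G
  have : SMulCommClass G C B := ⟨fun g c y => by
    change g • ((c : B) * y) = c * g • y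
    rw [smul_mul', c.2 g]⟩
  have : Algebra.IsInvariant C B G := ⟨fun y hy => ⟨⟨y, hy⟩, rfl⟩⟩
  have hC : Algebra.FiniteType k C := finiteType_of_isInvariant k G (C := C) (B := B)
    Subtype.val_injective
  obtain ⟨T, hT⟩ := hC.out
  refine ⟨T.image C.val, fun t ht => ?_, fun y hy => ?_⟩
  · obtain ⟨t, -, rfl⟩ := Finset.mem_image.1 ht
    exact t.2
  · have h1 : (⟨y, hy⟩ : C) ∈ Algebra.adjoin k (T : Set C) := hT ▸ Algebra.mem_top
    have h2 : C.val ⟨y, hy⟩ ∈ (Algebra.adjoin k (T : Set C)).map C.val := ⟨_, h1, rfl⟩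
    rwa [AlgHom.map_adjoin, ← Finset.coe_image] at h2


section InvariantForms

open HomogeneousIdeal HomogeneousLocalization

variable {k : Type u} [Field k] {S : Type u} [CommRing S] [Algebra k S]
  {𝒮 : ℕ → Submodule k S} [GradedAlgebra 𝒮]
  {G : Type} [CommGroup G] (θ : G →* (S ≃ₐ[k] S))
  (hθ : ∀ g n, ∀ a ∈ 𝒮 n, θ g a ∈ 𝒮 n)

/-- The `j`-th elementary symmetric function of the conjugates of `x`. -/
def symmForm [Finite G] (x : S) (j : ℕ) : S :=
  letI := Fintype.ofFinite G
  MvPolynomial.aeval (fun g => θ g x) (MvPolynomial.esymm G k j)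

theorem symmForm_invariant [Finite G] (x : S) (j : ℕ) (g : G) :
    θ g (symmForm θ x j) = symmForm θ x j := by
  let := Fintype.ofFinite G
  change (θ g : S →ₐ[k] S) (MvPolynomial.aeval _ _) = MvPolynomial.aeval _ _
  rw [← AlgHom.comp_apply, MvPolynomial.comp_aeval]
  conv_rhs => rw [← MvPolynomial.rename_esymm G k j (Equiv.mulLeft g), MvPolynomial.aeval_rename]
  congr 2
  funext h
  simp

theorem symmForm_mem [Finite G] {x : S} (hx : ∀ g, θ g x ∈ 𝒮 1) (j : ℕ) : symmForm θ x j ∈ 𝒮 j := by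
  let := Fintype.ofFinite G
  rw [symmForm, MvPolynomial.esymm, map_sum]
  refine sum_mem fun t ht => ?_
  rw [map_prod]
  have h := SetLike.prod_mem_graded 𝒮 (fun _ => 1) (fun g => θ g x) (F := t) fun g _ => hx g
  simpa [(Finset.mem_powersetCard.1 ht).2] using h

/-- `x` is a root of the polynomial `∏ (T - g x)`, whose nonleading coefficients are symmetric
functions of the conjugates of `x`. -/
theorem mem_of_symmForm_mem [Finite G] {I : Ideal S} (hI : I.IsPrime) {x : S}
    (h : ∀ j < Nat.card G, symmForm θ x (j + 1) ∈ I) : x ∈ I := by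
  let := Fintype.ofFinite G
  have h0 := congrArg (Polynomial.eval x) (Multiset.prod_X_sub_X_eq_sum_esymm
    (Multiset.map (fun g => θ g x) Finset.univ.val))
  rw [Polynomial.eval_multiset_prod, Multiset.prod_eq_zero, Multiset.card_map,
    Finset.card_val, Finset.card_univ, Polynomial.eval_finsetSum, Finset.sum_range_succ'] at h0
  · simp only [← MvPolynomial.aeval_esymm_eq_multiset_esymm G k, Polynomial.eval_mul,
      Polynomial.eval_pow, Polynomial.eval_neg, Polynomial.eval_one, Polynomial.eval_C,
      Polynomial.eval_X, pow_zero, one_mul, MvPolynomial.esymm_zero, map_one, Nat.sub_zero] at h0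
    refine hI.mem_of_pow_mem (Fintype.card G) ?_
    rw [← I.add_mem_iff_right (a := ∑ j ∈ Finset.range (Fintype.card G), (-1) ^ (j + 1) *
      (symmForm θ x (j + 1) * x ^ (Fintype.card G - (j + 1))))]
    · exact (congrArg (· ∈ I) h0).mp I.zero_mem
    · exact sum_mem fun j hj => I.mul_mem_left _ (I.mul_mem_right _
        (h j (by rw [Nat.card_eq_fintype_card]; exact Finset.mem_range.1 hj)))
  · refine Multiset.mem_map.2 ⟨Polynomial.X - Polynomial.C x, ?_, by simp⟩
    exact Multiset.mem_map.2 ⟨x, Multiset.mem_map.2 ⟨1, Finset.mem_univ _, by simp⟩, rfl⟩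

/-- There are finitely many invariant forms of the same degree without a common zero, namely powers
of the symmetric functions of the conjugates of linear forms. -/
theorem exists_invariant_cover [Finite G] {σ : Type} [Finite σ] {x : σ → S} (hx : ∀ i, x i ∈ 𝒮 1)
    (hcov : ⨆ i, Proj.basicOpen 𝒮 (x i) = ⊤) (hθ : ∀ g n, ∀ a ∈ 𝒮 n, θ g a ∈ 𝒮 n) :
    ∃ (d : ℕ) (h : σ × Fin (Nat.card G) → S), 0 < d ∧ (∀ i, h i ∈ 𝒮 d) ∧
      (∀ i g, θ g (h i) = h i) ∧ ⨆ i, Proj.basicOpen 𝒮 (h i) = ⊤ := by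
  -- The degrees `j + 1 ≤ |G|` of the symmetric functions all divide `|G|!`.
  refine ⟨(Nat.card G).factorial,
    fun i => symmForm θ (x i.1) (i.2 + 1) ^ ((Nat.card G).factorial / (i.2 + 1)),
    Nat.factorial_pos _, fun i => ?_, fun i g => ?_, eq_top_iff.2 fun y _ => ?_⟩
  · have h := SetLike.pow_mem_graded ((Nat.card G).factorial / (i.2 + 1))
      (symmForm_mem θ (fun g => hθ g 1 _ (hx i.1)) (i.2 + 1))
    rwa [smul_eq_mul, Nat.div_mul_cancel (Nat.dvd_factorial (Nat.succ_pos _) i.2.2)] at h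
  · rw [map_pow, symmForm_invariant]
  · obtain ⟨i, hi⟩ := TopologicalSpace.Opens.mem_iSup.1 (hcov.ge (Set.mem_univ y))
    by_contra hn
    refine hi (mem_of_symmForm_mem θ y.isPrime fun j hj => ?_)
    by_contra hj'
    refine hn (TopologicalSpace.Opens.mem_iSup.2 ⟨(i, ⟨j, hj⟩), ?_⟩)
    exact fun h => hj' (y.isPrime.mem_of_pow_mem _ h)

/-- The endomorphism of the degree zero part of the localization away from an invariant element. -/
def actAway {f : S} (hf : ∀ g, θ g f = f) (g : G) : Away 𝒮 f →+* Away 𝒮 f :=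
  scaleAway (θ g : S →ₐ[k] S) (e := 1) (fun n a ha => by rw [one_mul]; exact hθ g n a ha) (hf g)

theorem actAway_mk {f : S} (hf : ∀ g, θ g f = f) {d : ℕ} (hd : f ∈ 𝒮 d) (g : G) (n : ℕ) (a : S)
    (ha : a ∈ 𝒮 (n • d)) :
    actAway θ hθ hf g (Away.mk 𝒮 hd n a ha) = Away.mk 𝒮 hd n (θ g a) (hθ g _ a ha) :=
  scaleAway_mk _ _ _ hd hd n a ha _

/-- The action on the degree zero part of the localization away from an invariant element. -/
abbrev awayAction {f : S} (hf : ∀ g, θ g f = f) {d : ℕ} (hd : f ∈ 𝒮 d) :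
    MulSemiringAction G (Away 𝒮 f) where
  smul g y := actAway θ hθ hf g y
  one_smul y := by
    obtain ⟨n, a, ha, rfl⟩ := Away.mk_surjective 𝒮 hd y
    refine (actAway_mk θ hθ hf hd 1 n a ha).trans ?_
    simp only [map_one, AlgEquiv.one_apply]
  mul_smul g h y := by
    obtain ⟨n, a, ha, rfl⟩ := Away.mk_surjective 𝒮 hd y
    refine (actAway_mk θ hθ hf hd (g * h) n a ha).trans ?_
    simp only [map_mul, AlgEquiv.mul_apply]
    exact ((congrArg _ (actAway_mk θ hθ hf hd h n a ha)).trans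
      (actAway_mk θ hθ hf hd g n _ _)).symm
  smul_zero g := map_zero _
  smul_add g := map_add _
  smul_one g := map_one _
  smul_mul g := map_mul _

/-- An invariant fraction has an invariant numerator, up to multiplication with a power of the
denominator. -/
theorem exists_invariant_num [Finite G] {f : S} (hf : ∀ g, θ g f = f) {d : ℕ} (hd : f ∈ 𝒮 d)
    {y : Away 𝒮 f} (hy : ∀ g, actAway θ hθ hf g y = y) :
    ∃ (n : ℕ) (a : S) (ha : a ∈ 𝒮 (n • d)), (∀ g, θ g a = a) ∧ Away.mk 𝒮 hd n a ha = y := by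
  have := Fintype.ofFinite G
  obtain ⟨n, a, ha, rfl⟩ := Away.mk_surjective 𝒮 hd y
  have h1 (g : G) : ∃ m : ℕ, f ^ m * θ g a = f ^ m * a := by
    have h2 := congrArg HomogeneousLocalization.val (hy g)
    rw [actAway_mk, Away.val_mk, Away.val_mk, Localization.mk_eq_mk_iff,
      Localization.r_iff_exists] at h2
    obtain ⟨⟨_, m, rfl⟩, h2⟩ := h2
    refine ⟨m + n, ?_⟩
    simp only [← mul_assoc, ← pow_add] at h2
    exact h2
  choose m hm using h1
  have hma : f ^ (∑ g, m g) * a ∈ 𝒮 ((∑ g, m g + n) • d) := by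
    rw [add_smul]
    exact SetLike.mul_mem_graded (SetLike.pow_mem_graded _ hd) ha
  refine ⟨∑ g, m g + n, _, hma, fun g => ?_, ?_⟩
  · obtain ⟨r, hr⟩ := Nat.exists_eq_add_of_le
      (Finset.single_le_sum (f := m) (fun _ _ => Nat.zero_le _) (Finset.mem_univ g))
    rw [map_mul, map_pow, hf, hr, add_comm, pow_add, mul_assoc, hm, mul_assoc]
  · refine val_injective _ ?_
    rw [Away.val_mk, Away.val_mk, Localization.mk_eq_mk_iff, Localization.r_iff_exists]
    refine ⟨1, ?_⟩
    simp only [OneMemClass.coe_one, one_mul, pow_add]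
    ring

/-- The invariant fractions with a given invariant denominator are generated by finitely many
fractions with invariant numerators. -/
theorem exists_invariant_generators [Finite G] [Algebra.FiniteType k S]
    (h0 : Function.Surjective (algebraMap k (𝒮 0))) {f : S} (hf : ∀ g, θ g f = f) {d : ℕ}
    (hd : f ∈ 𝒮 d) :
    ∃ (m : ℕ) (n : Fin m → ℕ) (a : Fin m → S) (ha : ∀ t, a t ∈ 𝒮 (n t • d)),
      (∀ t g, θ g (a t) = a t) ∧ ∀ y : Away 𝒮 f, (∀ g, actAway θ hθ hf g y = y) →
        y ∈ Algebra.adjoin k (Set.range fun t => Away.mk 𝒮 hd (n t) (a t) (ha t)) := by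
  let := awayAction θ hθ hf hd
  have := finiteType_away 𝒮 h0 hd
  obtain ⟨T, hT, hTadj⟩ := exists_finset_adjoin_invariants k (G := G) (B := Away 𝒮 f)
    fun g c => scaleAway_algebraMap (θ g : S →ₐ[k] S) _ (hf g) c
  have hnum (t : T) := exists_invariant_num θ hθ hf hd (hT t t.2)
  choose n a ha hinv hy using hnum
  let e := T.equivFin.symm
  refine ⟨T.card, fun t => n (e t), fun t => a (e t), fun t => ha (e t), fun t => hinv (e t),
    fun y hy' => Algebra.adjoin_mono ?_ (hTadj y hy')⟩
  intro t ht
  exact ⟨e.symm ⟨t, ht⟩, by simp only [Equiv.apply_symm_apply, hy]⟩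

end InvariantForms

/-! ### Invariant forms of the same degree that generate the invariant fractions -/

section InvariantFamily

open HomogeneousIdeal HomogeneousLocalization

variable {k : Type u} [Field k] {S : Type u} [CommRing S] [Algebra k S]
  {𝒮 : ℕ → Submodule k S} [GradedAlgebra 𝒮] {G : Type} [CommGroup G] [Finite G]
  (θ : G →* (S ≃ₐ[k] S)) (hθ : ∀ g n, ∀ a ∈ 𝒮 n, θ g a ∈ 𝒮 n)

/-- The map `Away f → Away (f ^ (m + 1))` as a homomorphism of `k`-algebras. -/
def awayPow {f : S} {d : ℕ} (hd : f ∈ 𝒮 d) (m : ℕ) : Away 𝒮 f →ₐ[k] Away 𝒮 (f ^ (m + 1)) where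
  __ := awayMap 𝒮 (SetLike.pow_mem_graded m hd) (pow_succ' f m)
  commutes' c := awayMap_fromZeroRingHom 𝒮 _ _ (algebraMap k (𝒮 0) c)

/-- The fraction `a / f ^ n` rewritten with denominator `f ^ (r * (m + 1))`. -/
theorem awayPow_mk {f : S} {d : ℕ} (hd : f ∈ 𝒮 d) (m n r : ℕ) (hn : n ≤ r * (m + 1)) (a : S)
    (ha : a ∈ 𝒮 (n • d)) (ha' : a * f ^ (r * (m + 1) - n) ∈ 𝒮 (r • ((m + 1) • d))) :
    awayPow hd m (Away.mk 𝒮 hd n a ha) =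
      Away.mk 𝒮 (SetLike.pow_mem_graded _ hd) r (a * f ^ (r * (m + 1) - n)) ha' := by
  refine (awayMap_mk 𝒮 (SetLike.pow_mem_graded m hd) (pow_succ' f m) n hd a ha).trans
    (val_injective _ ?_)
  rw [Away.val_mk, Away.val_mk, Localization.mk_eq_mk_iff, Localization.r_iff_exists]
  refine ⟨1, ?_⟩
  obtain ⟨q, hq⟩ := Nat.exists_eq_add_of_le hn
  have h : (f ^ (m + 1)) ^ r = f ^ (n + q) := by rw [← pow_mul, mul_comm, hq]
  simp only [OneMemClass.coe_one, one_mul, h, hq, Nat.add_sub_cancel_left]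
  ring

/-- There are finitely many invariant forms of the same degree, some of which have no common zero,
such that the fractions with one of these as denominator and all the forms as numerators generate
all the invariant fractions. -/
theorem exists_invariant_family [Algebra.FiniteType k S]
    (h0 : Function.Surjective (algebraMap k (𝒮 0))) {σ : Type} [Finite σ] [Nonempty σ] {x : σ → S}
    (hx : ∀ i, x i ∈ 𝒮 1) (hcov : ⨆ i, Proj.basicOpen 𝒮 (x i) = ⊤) :
    ∃ (N e : ℕ) (_ : 0 < e) (s : Fin (N + 1) → S) (hs : ∀ l, s l ∈ 𝒮 e)
      (hinv : ∀ l g, θ g (s l) = s l) (J : Set (Fin (N + 1))),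
      ⨆ j : J, Proj.basicOpen 𝒮 (s j) = ⊤ ∧
      ∀ j ∈ J, ∀ y : Away 𝒮 (s j), (∀ g, actAway θ hθ (hinv j) g y = y) →
        y ∈ Algebra.adjoin k (Set.range fun l => Away.mk 𝒮 (hs j) 1 (s l)
          (by rw [one_smul]; exact hs l)) := by
  obtain ⟨d, h, hd, hh, hhinv, hhcov⟩ := exists_invariant_cover θ hx hcov hθ
  choose m n a ha hainv hgen using fun i => exists_invariant_generators θ hθ h0 (hhinv i) (hh i)
  obtain ⟨M, hM⟩ : ∃ M, ∀ i t, n i t ≤ M + 1 := by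
    have := Fintype.ofFinite σ
    refine ⟨∑ i, ∑ t, n i t, fun i t => Nat.le_succ_of_le ?_⟩
    exact (Finset.single_le_sum (f := fun t => n i t) (fun _ _ => Nat.zero_le _)
      (Finset.mem_univ t)).trans (Finset.single_le_sum (f := fun i => ∑ t, n i t)
        (fun _ _ => Nat.zero_le _) (Finset.mem_univ i))
  -- The forms are the `h i ^ (M + 1)` and, for the generators `a / h i ^ n` of the invariant
  -- fractions with denominators `h i`, the numerators over the common denominator `h i ^ (M + 1)`.
  let κ := (σ × Fin (Nat.card G)) ⊕ (Σ i : σ × Fin (Nat.card G), Fin (m i))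
  let b : κ → S := Sum.elim (fun i => h i ^ (M + 1))
    (fun t => a t.1 t.2 * h t.1 ^ (M + 1 - n t.1 t.2))
  have hb (l : κ) : b l ∈ 𝒮 ((M + 1) • d) := by
    rcases l with i | ⟨i, t⟩
    · exact SetLike.pow_mem_graded _ (hh i)
    · have := SetLike.mul_mem_graded (ha i t)
        (SetLike.pow_mem_graded (M + 1 - n i t) (hh i))
      rwa [← add_smul, Nat.add_sub_cancel' (hM i t)] at this
  have hbinv (l : κ) (g : G) : θ g (b l) = b l := by
    rcases l with i | ⟨i, t⟩
    · change θ g (h i ^ (M + 1)) = h i ^ (M + 1)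
      rw [map_pow, hhinv]
    · change θ g (a i t * h i ^ (M + 1 - n i t)) = a i t * h i ^ (M + 1 - n i t)
      rw [map_mul, map_pow, hhinv, hainv]
  have : Nonempty κ := ⟨.inl (Classical.arbitrary σ, ⟨0, Nat.card_pos⟩)⟩
  obtain ⟨N, hN⟩ : ∃ N, Nat.card κ = N + 1 := ⟨_, (Nat.succ_pred Nat.card_pos.ne').symm⟩
  let E : Fin (N + 1) ≃ κ := (Finite.equivFinOfCardEq hN).symm
  have hbcov (i : σ × Fin (Nat.card G)) : Proj.basicOpen 𝒮 (h i ^ (M + 1)) =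
    Proj.basicOpen 𝒮 (h i) := Proj.basicOpen_pow _ _ _ M.succ_pos
  refine ⟨N, (M + 1) • d, by positivity, fun l => b (E l), fun l => hb _, fun l => hbinv _,
    {l | ∃ i, E l = .inl i}, ?_, ?_⟩
  · refine eq_top_iff.2 (hhcov.ge.trans (iSup_le fun i => ?_))
    refine le_trans (le_of_eq ?_) (le_iSup _ ⟨E.symm (.inl i), i, E.apply_symm_apply _⟩)
    simp only [E.apply_symm_apply]
    exact (hbcov i).symm
  · rintro j ⟨i, hi⟩
    have key {f : S} (hf : f = h i ^ (M + 1)) (hfinv : ∀ g, θ g f = f)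
        (hf' : f ∈ 𝒮 ((M + 1) • d)) (y : Away 𝒮 f) (hy : ∀ g, actAway θ hθ hfinv g y = y) :
        y ∈ Algebra.adjoin k (Set.range fun l => Away.mk 𝒮 hf' 1 (b (E l))
          (by rw [one_smul]; exact hb _)) := by
      subst hf
      obtain ⟨r, c, hc, hcinv, rfl⟩ := exists_invariant_num θ hθ hfinv hf' hy
      have hc' : c ∈ 𝒮 ((r * (M + 1)) • d) := by rwa [mul_smul]
      have h1 := hgen i (Away.mk 𝒮 (hh i) (r * (M + 1)) c hc') fun g => by
        rw [actAway_mk]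
        simp only [hcinv]
      have h2 := (Subalgebra.mem_map (f := awayPow (hh i) M)).2 ⟨_, h1, rfl⟩
      rw [awayPow_mk (hh i) M _ r le_rfl c hc' (by simpa using hc), AlgHom.map_adjoin] at h2
      simp only [Nat.sub_self, pow_zero, mul_one] at h2
      refine Algebra.adjoin_mono ?_ h2
      rintro _ ⟨_, ⟨t, rfl⟩, rfl⟩
      have hn : n i t ≤ 1 * (M + 1) := by simpa using hM i t
      refine ⟨E.symm (.inr ⟨i, t⟩), ?_⟩
      have h3 := hb (.inr ⟨i, t⟩)
      refine Eq.trans ?_ (awayPow_mk (hh i) M _ 1 hn (a i t) (ha i t)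
        (by simpa [b] using h3)).symm
      simp only [E.apply_symm_apply, one_mul]
      rfl
    exact key (by simp only [hi]; rfl) (hbinv _) (hb _)

end InvariantFamily

/-! ### Sections over the range of an affine chart -/

section ChartSections

/-- Restriction of sections along a morphism from an affine scheme. -/
def restrictHom {X : Scheme.{u}} {A : Type u} [CommRing A] (a : Spec (.of A) ⟶ X) (U : X.Opens)
    (h : ⊤ ≤ a ⁻¹ᵁ U) : Γ(X, U) →+* A :=
  (a.appLE U ⊤ h ≫ (Scheme.ΓSpecIso (.of A)).hom).hom

theorem restrictHom_bijective {X : Scheme.{u}} {A : Type u} [CommRing A] (a : Spec (.of A) ⟶ X)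
    [IsOpenImmersion a] {U : X.Opens} (hU : a.opensRange = U) (h : ⊤ ≤ a ⁻¹ᵁ U) :
    Function.Bijective (restrictHom a U h) := by
  obtain rfl : a ''ᵁ ⊤ = U := by rw [Scheme.Hom.image_top_eq_opensRange, hU]
  have h1 : a.appLE (a ''ᵁ ⊤) ⊤ h = (a.appIso ⊤).hom := (Scheme.Hom.appIso_hom' a ⊤).symm
  rw [restrictHom, h1]
  exact ConcreteCategory.bijective_of_isIso _

theorem restrictHom_appLE {X Y : Scheme.{u}} {A B : Type u} [CommRing A] [CommRing B]
    (a : Spec (.of A) ⟶ X) (b : Spec (.of B) ⟶ Y) (f : X ⟶ Y) (α : B →+* A)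
    (hf : a ≫ f = Spec.map (CommRingCat.ofHom α) ≫ b) (U : X.Opens) (V : Y.Opens)
    (ha : ⊤ ≤ a ⁻¹ᵁ U) (hb : ⊤ ≤ b ⁻¹ᵁ V) (h : U ≤ f ⁻¹ᵁ V) (t : Γ(Y, V)) :
    restrictHom a U ha (f.appLE V U h t) = α (restrictHom b V hb t) := by
  have key : f.appLE V U h ≫ a.appLE U ⊤ ha ≫ (Scheme.ΓSpecIso (.of A)).hom =
      (b.appLE V ⊤ hb ≫ (Scheme.ΓSpecIso (.of B)).hom) ≫ CommRingCat.ofHom α := by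
    have h1 := Scheme.Hom.appLE_comp_appLE a f V U ⊤ h ha
    have h2 : b.appLE V ⊤ hb ≫ (Spec.map (CommRingCat.ofHom α)).appTop =
        (Spec.map (CommRingCat.ofHom α) ≫ b).appLE V ⊤ (fun z _ => hb trivial) := by
      rw [Scheme.Hom.appTop, Scheme.Hom.app_eq_appLE]
      exact Scheme.Hom.appLE_comp_appLE _ b V ⊤ ⊤ hb le_top
    rw [Category.assoc, ← Scheme.ΓSpecIso_naturality, ← Category.assoc, ← Category.assoc, h1, h2]
    simp only [hf]
  exact congr($key t)

end ChartSections

/-! ### The morphism to a projective space defined by invariant forms -/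

section InvariantMorphism

open HomogeneousIdeal HomogeneousLocalization

variable {k : Type u} [Field k] {S : Type u} [CommRing S] [Algebra k S]
  {𝒮 : ℕ → Submodule k S} [GradedAlgebra 𝒮] {G : Type} [CommGroup G]
  (θ : G →* (S ≃ₐ[k] S)) (hθ : ∀ g n, ∀ a ∈ 𝒮 n, θ g a ∈ 𝒮 n)

theorem awayι_projAction {f : S} (hf : ∀ g, θ g f = f) {d : ℕ} (hd : f ∈ 𝒮 d) (hd0 : 0 < d)
    (g : G) : Proj.awayι 𝒮 f hd hd0 ≫ (projAction θ hθ g).hom =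
      Spec.map (CommRingCat.ofHom (actAway θ hθ hf g)) ≫ Proj.awayι 𝒮 f hd hd0 := by
  have key {b : S} (hb : θ g f = b) (hbd : b ∈ 𝒮 d) : Proj.awayι 𝒮 b hbd hd0 ≫
      (projAction θ hθ g).hom = Spec.map (CommRingCat.ofHom (scaleAway (θ g : S →ₐ[k] S) (e := 1)
        (fun n a ha => by rw [one_mul]; exact hθ g n a ha) hb)) ≫ Proj.awayι 𝒮 f hd hd0 := by
    subst hb
    refine (Proj.awayι_comp_map (actionHom θ hθ g) (irrelevant_le_map_actionHom θ hθ g) hd0 f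
      hd).trans ?_
    congr 3
    refine RingHom.ext fun y => ?_
    obtain ⟨n, a, ha, rfl⟩ := Away.mk_surjective 𝒮 hd y
    exact (Away.map_mk _ _ hd n a ha).trans
      (scaleAway_mk (θ g : S →ₐ[k] S) _ _ hd hbd n a ha (hθ g _ a ha)).symm
  exact key (hf g) hd

section

variable {B : Type u} [CommRing B] [Algebra k B] {ℬ : ℕ → Submodule k B} [GradedAlgebra ℬ]
  (ψ : B →ₐ[k] S) {e : ℕ} (hψ : ∀ n, ∀ b ∈ ℬ n, ψ b ∈ 𝒮 (e * n)) {ι : Type*} {t : ι → B} {s : ι → S}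
  (hts : ∀ i, ψ (t i) = s i) (ht : ∀ i, t i ∈ ℬ 1) (hs : ∀ i, s i ∈ 𝒮 e) (he : 0 < e)
  (hcov : ⨆ i, Proj.basicOpen 𝒮 (s i) = ⊤)

theorem projAction_scaleProj (hψinv : ∀ g b, θ g (ψ b) = ψ b) (g : G) :
    (projAction θ hθ g).hom ≫ scaleProj ψ hψ hts ht hs he hcov =
      scaleProj ψ hψ hts ht hs he hcov := by
  refine proj_hom_ext 𝒮 hs he hcov fun j => ?_
  have hinv (g : G) : θ g (s j) = s j := by rw [← hts, hψinv]
  rw [← Category.assoc, awayι_projAction θ hθ hinv (hs j) he, Category.assoc, awayι_scaleProj,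
    ← Spec.map_comp_assoc, ← CommRingCat.ofHom_comp]
  congr 3
  refine RingHom.ext fun y => ?_
  obtain ⟨n, a, ha, rfl⟩ := Away.mk_surjective ℬ (ht j) y
  have ha' : ψ a ∈ 𝒮 (n • e) := by simpa [mul_comm] using hψ _ a ha
  rw [RingHom.comp_apply, scaleAway_mk ψ hψ (hts j) (ht j) (hs j) n a ha ha', actAway_mk]
  simp only [hψinv]

/-- If the invariant fractions with denominator `s j` come from `ℬ`, then so do the invariant
sections over the locus where `s j` does not vanish. -/
theorem mem_range_app_scaleProj (j : ι) (hinv : ∀ g, θ g (s j) = s j)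
    (hgen : ∀ y : Away 𝒮 (s j), (∀ g, actAway θ hθ hinv g y = y) →
      ∃ z, scaleAway ψ hψ (hts j) z = y) {φ : Proj 𝒮 ⟶ Proj ℬ}
    (hφ : φ = scaleProj ψ hψ hts ht hs he hcov) (hφinv : ∀ g, (projAction θ hθ g).hom ≫ φ = φ)
    (v : Γ(Proj 𝒮, φ ⁻¹ᵁ Proj.basicOpen ℬ (t j)))
    (hv : ∀ g, (projAction θ hθ g).hom.appLE (φ ⁻¹ᵁ Proj.basicOpen ℬ (t j))
      (φ ⁻¹ᵁ Proj.basicOpen ℬ (t j)) (by rw [← Scheme.Hom.comp_preimage, hφinv g]) v = v) :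
    v ∈ Set.range (φ.app (Proj.basicOpen ℬ (t j))) := by
  have hφV : φ ⁻¹ᵁ Proj.basicOpen ℬ (t j) = Proj.basicOpen 𝒮 (s j) := by
    rw [hφ, scaleProj_preimage_basicOpen]
  have hφι : Proj.awayι 𝒮 (s j) (hs j) he ≫ φ =
      Spec.map (CommRingCat.ofHom (scaleAway ψ hψ (hts j))) ≫ Proj.awayι ℬ (t j) (ht j) one_pos := by
    rw [hφ, awayι_scaleProj]
  have ha : ⊤ ≤ Proj.awayι 𝒮 (s j) (hs j) he ⁻¹ᵁ φ ⁻¹ᵁ Proj.basicOpen ℬ (t j) := by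
    rw [hφV, ← Proj.opensRange_awayι 𝒮 (s j) (hs j) he]
    exact fun z _ => ⟨z, rfl⟩
  have hb : ⊤ ≤ Proj.awayι ℬ (t j) (ht j) one_pos ⁻¹ᵁ Proj.basicOpen ℬ (t j) := by
    rw [← Proj.opensRange_awayι ℬ (t j) (ht j) one_pos]
    exact fun z _ => ⟨z, rfl⟩
  obtain ⟨z, hz⟩ := hgen (restrictHom _ _ ha v) fun g => by
    rw [← restrictHom_appLE _ _ _ _ (awayι_projAction θ hθ hinv (hs j) he g) _ _ ha ha
      (by rw [← Scheme.Hom.comp_preimage, hφinv g]), hv g]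
  obtain ⟨w, rfl⟩ := (restrictHom_bijective (Proj.awayι ℬ (t j) (ht j) one_pos)
    (Proj.opensRange_awayι ..) hb).2 z
  refine ⟨w, (restrictHom_bijective (Proj.awayι 𝒮 (s j) (hs j) he)
    ((Proj.opensRange_awayι ..).trans hφV.symm) ha).1 ?_⟩
  rw [Scheme.Hom.app_eq_appLE, restrictHom_appLE _ _ _ _ hφι _ _ ha hb]
  exact hz

/-- The image of `scaleAway` contains the algebra generated by the fractions `ψ q / f`. -/
theorem exists_scaleAway_eq {f : S} {b : B} (hb : b ∈ ℬ 1) (hf : f ∈ 𝒮 e) (hbf : ψ b = f)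
    {τ : Type*} {r : τ → S} {q : τ → B} (hr : ∀ l, r l ∈ 𝒮 (1 • e)) (hq : ∀ l, q l ∈ ℬ (1 • 1))
    (hqr : ∀ l, ψ (q l) = r l) {y : Away 𝒮 f}
    (hy : y ∈ Algebra.adjoin k (Set.range fun l => Away.mk 𝒮 hf 1 (r l) (hr l))) :
    ∃ z, scaleAway ψ hψ hbf z = y := by
  let scale : Away ℬ b →ₐ[k] Away 𝒮 f :=
    { __ := scaleAway ψ hψ hbf
      commutes' := scaleAway_algebraMap ψ hψ hbf }
  refine (Algebra.adjoin_le (S := scale.range) ?_ hy)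
  rintro _ ⟨l, rfl⟩
  refine ⟨Away.mk ℬ hb 1 (q l) (hq l), ?_⟩
  refine (scaleAway_mk ψ hψ hbf hb hf 1 (q l) (hq l) (by rw [hqr]; exact hr l)).trans ?_
  simp only [hqr]

end

theorem aeval_mem_of_isHomogeneous {τ : Type*} [Finite τ] {e : ℕ} {s : τ → S}
    (hs : ∀ l, s l ∈ 𝒮 e) {n : ℕ} {b : MvPolynomial τ k} (hb : b.IsHomogeneous n) :
    MvPolynomial.aeval s b ∈ 𝒮 (e * n) := by
  have := Fintype.ofFinite τ
  rw [MvPolynomial.aeval_def, MvPolynomial.eval₂_eq']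
  refine sum_mem fun d hd => ?_
  rw [← Algebra.smul_def]
  refine Submodule.smul_mem _ _ ?_
  have h := SetLike.prod_mem_graded 𝒮 (fun i => d i • e) (fun i => s i ^ d i) (F := Finset.univ)
    fun i _ => SetLike.pow_mem_graded (d i) (hs i)
  have hn : ∑ i, d i = n := by
    rw [← hb (MvPolynomial.mem_support_iff.1 hd), Finsupp.weight_apply, Finsupp.sum_fintype _ _
      (fun _ => by simp)]
    simp
  rwa [← Finset.sum_smul, hn, smul_eq_mul, mul_comm] at h

attribute [local instance] MvPolynomial.gradedAlgebra

open MvPolynomial in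
/-- The quotient of a projective scheme by a finite group acting linearly, mapped to a projective
space by sufficiently many invariant forms of the same degree: sections invariant under the group
come from the projective space, locally on the latter. -/
theorem exists_invariant_morphism [Finite G] [Algebra.FiniteType k S]
    (h0 : Function.Surjective (algebraMap k (𝒮 0))) {σ : Type} [Finite σ] [Nonempty σ] {x : σ → S}
    (hx : ∀ i, x i ∈ 𝒮 1) (hcov : ⨆ i, Proj.basicOpen 𝒮 (x i) = ⊤) :
    ∃ (N : ℕ) (φ : Proj 𝒮 ⟶ ProjSpace (Fin (N + 1)) k) (hφ : ∀ g, (projAction θ hθ g).hom ≫ φ = φ)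
      (J : Set (Fin (N + 1))) (V : J → (ProjSpace (Fin (N + 1)) k).Opens),
      φ ≫ ProjSpace.toSpec (Fin (N + 1)) k = projToSpec 𝒮 ∧ (∀ j, IsAffineOpen (V j)) ∧
      (∀ j, IsAffineOpen (φ ⁻¹ᵁ V j)) ∧ ⨆ j, φ ⁻¹ᵁ V j = ⊤ ∧
      ∀ j (t : Γ(Proj 𝒮, φ ⁻¹ᵁ V j)), (∀ g, (projAction θ hθ g).hom.appLE (φ ⁻¹ᵁ V j) (φ ⁻¹ᵁ V j)
        (by rw [← Scheme.Hom.comp_preimage, hφ g]) t = t) → t ∈ Set.range (φ.app (V j)) := by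
  obtain ⟨N, e, he, s, hs, hinv, J, hJ, hgen⟩ := exists_invariant_family θ hθ h0 hx hcov
  have hψ (n : ℕ) (b) (hb : b ∈ homogeneousSubmodule (Fin (N + 1)) k n) :
    aeval (R := k) s b ∈ 𝒮 (e * n) := aeval_mem_of_isHomogeneous hs hb
  have hts (l : Fin (N + 1)) : aeval (R := k) s (X l) = s l := aeval_X _ _
  have hX (l : Fin (N + 1)) : (X l : MvPolynomial (Fin (N + 1)) k) ∈
    homogeneousSubmodule (Fin (N + 1)) k 1 := isHomogeneous_X k l
  have hψinv (g : G) (b : MvPolynomial (Fin (N + 1)) k) : θ g (aeval s b) = aeval s b := by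
    change ((θ g : S →ₐ[k] S).comp (aeval s)) b = aeval s b
    congr 1
    refine algHom_ext fun l => ?_
    simp [hinv]
  obtain ⟨φ, hφ⟩ : ∃ φ, φ = scaleProj (aeval (R := k) s) hψ (t := fun j : J => X j.1)
    (s := fun j : J => s j.1) (fun j => hts j) (fun j => hX j) (fun j => hs j) he hJ := ⟨_, rfl⟩
  have hφV (j : J) : φ ⁻¹ᵁ Proj.basicOpen (homogeneousSubmodule (Fin (N + 1)) k) (X j.1) =
      Proj.basicOpen 𝒮 (s j) := by
    rw [hφ]
    exact scaleProj_preimage_basicOpen (aeval (R := k) s) hψ (t := fun j : J => X j.1) _ _ _ he hJ j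
  have hφinv (g : G) : (projAction θ hθ g).hom ≫ φ = φ := by
    rw [hφ]
    exact projAction_scaleProj θ hθ _ hψ _ _ _ he hJ hψinv g
  have hφk : φ ≫ projToSpec (homogeneousSubmodule (Fin (N + 1)) k) = projToSpec 𝒮 := by
    rw [hφ]
    exact scaleProj_projToSpec _ hψ _ _ _ he hJ
  refine ⟨N, φ, hφinv, J, fun j => Proj.basicOpen (homogeneousSubmodule (Fin (N + 1)) k) (X j.1),
    hφk, fun j => Proj.isAffineOpen_basicOpen _ _ (hX j) one_pos, fun j => ?_, ?_, fun j v hv => ?_⟩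
  · have h : IsAffineOpen (φ ⁻¹ᵁ Proj.basicOpen (homogeneousSubmodule (Fin (N + 1)) k) (X j.1)) := by
      rw [hφV]
      exact Proj.isAffineOpen_basicOpen 𝒮 _ (hs j) he
    exact h
  · exact (iSup_congr hφV).trans hJ
  · exact mem_range_app_scaleProj θ hθ (aeval (R := k) s) hψ (t := fun j : J => X j.1)
      (s := fun j : J => s j.1) (fun j => hts j) (fun j => hX j) (fun j => hs j) he hJ j (hinv j)
      (fun y hy => exists_scaleAway_eq (aeval (R := k) s) hψ (hX j) (hs j) (hts j) _
        (fun l => by simpa using hX l) hts (hgen j j.2 y hy)) hφ hφinv v hv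

end InvariantMorphism

/-! ### Rings of invariants and localization -/

section InvariantsAway

variable {C C' B B' : Type*} [CommRing C] [CommRing C'] [CommRing B] [CommRing B'] [Algebra C C']
  [Algebra B B']

theorem injective_away_of_injective (c : C) (f : C →+* B) (f' : C' →+* B')
    [IsLocalization.Away c C'] [IsLocalization.Away (f c) B']
    (hcomm : ∀ x, f' (algebraMap C C' x) = algebraMap B B' (f x)) (hf : Function.Injective f) :
    Function.Injective f' := by
  refine (injective_iff_map_eq_zero f').2 fun z hz => ?_
  obtain ⟨n, a, ha⟩ := IsLocalization.Away.surj c z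
  have h1 : algebraMap B B' (f a) = algebraMap B B' 0 := by
    rw [← hcomm, ← ha, map_mul, hz, zero_mul, map_zero]
  obtain ⟨m, hm⟩ := IsLocalization.Away.exists_of_eq (f c) h1
  rw [mul_zero, ← map_pow, ← map_mul, map_eq_zero_iff f hf] at hm
  have h2 := congrArg (algebraMap C C') hm
  rw [map_mul, ← ha, map_pow, map_zero] at h2
  have hu : IsUnit (algebraMap C C' c) := IsLocalization.Away.algebraMap_isUnit c
  exact (hu.pow n).mul_left_eq_zero.1 ((hu.pow m).mul_right_eq_zero.1 h2)

theorem mem_range_away_of_invariant (c : C) (f : C →+* B) (f' : C' →+* B')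
    [IsLocalization.Away c C'] [IsLocalization.Away (f c) B']
    (hcomm : ∀ x, f' (algebraMap C C' x) = algebraMap B B' (f x)) {G : Type*} [Finite G]
    (τ : G → B →+* B) (τ' : G → B' →+* B')
    (hτ : ∀ g b, τ' g (algebraMap B B' b) = algebraMap B B' (τ g b)) (hτc : ∀ g, τ g (f c) = f c)
    (hf : ∀ b, (∀ g, τ g b = b) → b ∈ Set.range f) {y : B'} (hy : ∀ g, τ' g y = y) :
    y ∈ Set.range f' := by
  have := Fintype.ofFinite G
  obtain ⟨n, b, hb⟩ := IsLocalization.Away.surj (f c) y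
  have h1 (g : G) : ∃ m : ℕ, f c ^ m * τ g b = f c ^ m * b := by
    refine IsLocalization.Away.exists_of_eq (S := B') (f c) ?_
    rw [← hτ, ← hb, map_mul, hy, map_pow, hτ, hτc]
  choose m hm using h1
  obtain ⟨a, ha⟩ := hf (f c ^ (∑ g, m g) * b) fun g => by
    obtain ⟨r, hr⟩ := Nat.exists_eq_add_of_le
      (Finset.single_le_sum (f := m) (fun _ _ => Nat.zero_le _) (Finset.mem_univ g))
    rw [map_mul, map_pow, hτc, hr, add_comm, pow_add, mul_assoc, hm, mul_assoc]
  have hu : IsUnit (algebraMap C C' c) := IsLocalization.Away.algebraMap_isUnit c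
  have hu' : IsUnit (algebraMap B B' (f c)) := IsLocalization.Away.algebraMap_isUnit (f c)
  obtain ⟨v, hv⟩ := (hu.pow (n + ∑ g, m g)).exists_right_inv
  refine ⟨algebraMap C C' a * v, (hu'.pow (n + ∑ g, m g)).mul_left_injective ?_⟩
  have h2 := congrArg f' hv
  rw [map_mul, map_pow, hcomm, map_one] at h2
  dsimp only
  rw [map_mul, hcomm, ha, mul_assoc, mul_comm (f' v), h2, mul_one, map_mul, ← hb, map_pow, pow_add]
  ring

end InvariantsAway

/-! ### Quotients that are affine locally given by rings of invariants -/

section LocalQuotient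

variable {G : Type} [CommGroup G] {X Y : Scheme.{u}} {ρ : G →* Aut X} {π : X ⟶ Y}

theorem preimage_le_preimage (hπ : ∀ g, (ρ g).hom ≫ π = π) (V : Y.Opens) (g : G) :
    π ⁻¹ᵁ V ≤ (ρ g).hom ⁻¹ᵁ π ⁻¹ᵁ V := by
  rw [← Scheme.Hom.comp_preimage, hπ g]

variable (hπ : ∀ g, (ρ g).hom ≫ π = π)

/-- The action of the group on the sections over the preimage of an open subset of the target of
an invariant morphism. -/
def sectionAct (V : Y.Opens) (g : G) : Γ(X, π ⁻¹ᵁ V) →+* Γ(X, π ⁻¹ᵁ V) :=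
  ((ρ g).hom.appLE (π ⁻¹ᵁ V) (π ⁻¹ᵁ V) (preimage_le_preimage hπ V g)).hom

theorem sectionAct_app (V : Y.Opens) (g : G) (c : Γ(Y, V)) :
    sectionAct hπ V g (π.app V c) = π.app V c := by
  have h := Scheme.Hom.comp_appLE (ρ g).hom π V (π ⁻¹ᵁ V) (preimage_le_preimage hπ V g)
  have h2 : π.app V ≫ (ρ g).hom.appLE (π ⁻¹ᵁ V) (π ⁻¹ᵁ V) (preimage_le_preimage hπ V g) =
      π.app V := by
    rw [← h, Scheme.Hom.app_eq_appLE]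
    simp only [hπ]
  exact congr($h2 c)

theorem sectionAct_map {V W : Y.Opens} (i : W ≤ V) (g : G) (s : Γ(X, π ⁻¹ᵁ V)) :
    sectionAct hπ W g (X.presheaf.map (homOfLE (π.preimage_mono i)).op s) =
      X.presheaf.map (homOfLE (π.preimage_mono i)).op (sectionAct hπ V g s) := by
  have h := (Scheme.Hom.map_appLE (ρ g).hom (preimage_le_preimage hπ W g)
    (homOfLE (π.preimage_mono i)).op).trans
    (Scheme.Hom.appLE_map (ρ g).hom (preimage_le_preimage hπ V g)
      (homOfLE (π.preimage_mono i)).op).symm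
  exact congr($h s)

theorem sectionAct_one (V : Y.Opens) (s : Γ(X, π ⁻¹ᵁ V)) : sectionAct hπ V 1 s = s := by
  have h : (ρ 1).hom = 𝟙 X := by rw [map_one]; rfl
  have h2 : (ρ 1).hom.appLE (π ⁻¹ᵁ V) (π ⁻¹ᵁ V) (preimage_le_preimage hπ V 1) = 𝟙 _ := by
    simp only [h]
    exact (Scheme.Hom.appLE_eq_app (𝟙 X)).trans (Scheme.Hom.id_app _)
  exact congr($h2 s)

theorem sectionAct_mul (V : Y.Opens) (g h : G) (s : Γ(X, π ⁻¹ᵁ V)) :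
    sectionAct hπ V (g * h) s = sectionAct hπ V g (sectionAct hπ V h s) := by
  have e : (ρ (g * h)).hom = (ρ g).hom ≫ (ρ h).hom := by rw [mul_comm, map_mul]; rfl
  have h2 : (ρ (g * h)).hom.appLE (π ⁻¹ᵁ V) (π ⁻¹ᵁ V) (preimage_le_preimage hπ V _) =
      (ρ h).hom.appLE (π ⁻¹ᵁ V) (π ⁻¹ᵁ V) (preimage_le_preimage hπ V _) ≫
        (ρ g).hom.appLE (π ⁻¹ᵁ V) (π ⁻¹ᵁ V) (preimage_le_preimage hπ V _) := by
    rw [Scheme.Hom.appLE_comp_appLE]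
    simp only [e]
  exact congr($h2 s)

/-- The action of the group on the ring of sections, see `sectionAct`. -/
abbrev sectionAction (V : Y.Opens) : MulSemiringAction G Γ(X, π ⁻¹ᵁ V) where
  smul g s := sectionAct hπ V g s
  one_smul := sectionAct_one hπ V
  mul_smul := sectionAct_mul hπ V
  smul_zero _ := map_zero _
  smul_add _ := map_add _
  smul_one _ := map_one _
  smul_mul _ := map_mul _

/-- Over the affine open subset `V`, the morphism `π` is the quotient of an affine scheme by a
group, in the sense that the functions on `V` are the invariant functions on its preimage. -/
structure IsInvariantChart (V : Y.Opens) : Prop where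
  isAffineOpen : IsAffineOpen V
  isAffineOpen_preimage : IsAffineOpen (π ⁻¹ᵁ V)
  injective : Function.Injective (π.app V)
  mem_range : ∀ s, (∀ g, sectionAct hπ V g s = s) → s ∈ Set.range (π.app V)

variable {hπ} {V : Y.Opens}

/-- Invariants commute with localization, so a principal open subset of a chart is a chart. -/
theorem IsInvariantChart.basicOpen [Finite G] (hV : IsInvariantChart hπ V) (c : Γ(Y, V)) :
    IsInvariantChart hπ (Y.basicOpen c) := by
  have hle : Y.basicOpen c ≤ V := Y.basicOpen_le c
  let : Algebra Γ(Y, V) Γ(Y, Y.basicOpen c) := (Y.presheaf.map (homOfLE hle).op).hom.toAlgebra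
  let : Algebra Γ(X, π ⁻¹ᵁ V) Γ(X, π ⁻¹ᵁ Y.basicOpen c) :=
    (X.presheaf.map (homOfLE (π.preimage_mono hle)).op).hom.toAlgebra
  have : IsLocalization.Away c Γ(Y, Y.basicOpen c) :=
    hV.isAffineOpen.isLocalization_of_eq_basicOpen c (homOfLE hle) rfl
  have : IsLocalization.Away ((π.app V).hom c) Γ(X, π ⁻¹ᵁ Y.basicOpen c) :=
    hV.isAffineOpen_preimage.isLocalization_of_eq_basicOpen _ (homOfLE (π.preimage_mono hle))
      (Scheme.preimage_basicOpen π c)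
  have hcomm (x : Γ(Y, V)) : (π.app (Y.basicOpen c)).hom (algebraMap _ _ x) =
      algebraMap Γ(X, π ⁻¹ᵁ V) Γ(X, π ⁻¹ᵁ Y.basicOpen c) ((π.app V).hom x) := by
    have h := Scheme.Hom.naturality π (homOfLE hle).op
    exact congr($h x)
  refine ⟨hV.isAffineOpen.basicOpen c, ?_, ?_, fun s hs => ?_⟩
  · rw [Scheme.preimage_basicOpen]
    exact hV.isAffineOpen_preimage.basicOpen _
  · exact injective_away_of_injective c (π.app V).hom (π.app (Y.basicOpen c)).hom hcomm hV.injective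
  · exact mem_range_away_of_invariant c (π.app V).hom (π.app (Y.basicOpen c)).hom hcomm
      (sectionAct hπ V) (sectionAct hπ (Y.basicOpen c)) (sectionAct_map hπ hle)
      (fun g => sectionAct_app hπ V g c) hV.mem_range hs

variable {ι : Type*} {V : ι → Y.Opens}

theorem iSup_invariantChart [Finite G] (hV : ∀ i, IsInvariantChart hπ (V i)) (hcov : ⨆ i, V i = ⊤)
    (U : Y.Opens) : U ≤ ⨆ W : {W : Y.Opens // IsInvariantChart hπ W ∧ W ≤ U}, (W : Y.Opens) := by
  intro y hy
  obtain ⟨i, hi⟩ := TopologicalSpace.Opens.mem_iSup.1 (hcov.ge (Set.mem_univ y))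
  obtain ⟨c, hcU, hyc⟩ := (hV i).isAffineOpen.exists_basicOpen_le ⟨y, hy⟩ hi
  exact TopologicalSpace.Opens.mem_iSup.2 ⟨⟨_, (hV i).basicOpen c, hcU⟩, hyc⟩

theorem app_injective_of_invariantChart [Finite G] (hV : ∀ i, IsInvariantChart hπ (V i))
    (hcov : ⨆ i, V i = ⊤) (U : Y.Opens) : Function.Injective (π.app U) := by
  intro s t hst
  refine TopCat.Sheaf.eq_of_locally_eq' Y.sheaf _ U (fun W => homOfLE W.2.2)
    (iSup_invariantChart hV hcov U) s t fun W => W.2.1.injective ?_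
  have h := Scheme.Hom.naturality π (homOfLE W.2.2).op
  refine (congr($h s)).trans (Eq.trans ?_ (congr($h t)).symm)
  exact congrArg (X.presheaf.map _) hst

/-- Sections that come from the charts are glued; they agree on the overlaps by injectivity. -/
theorem range_app_of_invariantChart [Finite G] (hV : ∀ i, IsInvariantChart hπ (V i))
    (hcov : ⨆ i, V i = ⊤) (U : Y.Opens) :
    Set.range (π.app U) = {s | ∀ g, sectionAct hπ U g s = s} := by
  refine Set.Subset.antisymm ?_ fun s hs => ?_
  · rintro _ ⟨c, rfl⟩ g
    exact sectionAct_app hπ U g c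
  let T := {W : Y.Opens // IsInvariantChart hπ W ∧ W ≤ U}
  have h1 (W : T) : ∃ t : Γ(Y, W.1), π.app W.1 t =
      X.presheaf.map (homOfLE (π.preimage_mono W.2.2)).op s :=
    W.2.1.mem_range _ fun g => by rw [sectionAct_map hπ W.2.2, hs g]
  choose t ht using h1
  have hcompat : TopCat.Presheaf.IsCompatible Y.presheaf (fun W : T => W.1) t := by
    intro W W'
    refine app_injective_of_invariantChart hV hcov _ ?_
    have h2 := Scheme.Hom.naturality π (TopologicalSpace.Opens.infLELeft W.1 W'.1).op
    have h3 := Scheme.Hom.naturality π (TopologicalSpace.Opens.infLERight W.1 W'.1).op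
    refine (congr($h2 (t W))).trans (Eq.trans ?_ (congr($h3 (t W'))).symm)
    change X.presheaf.map _ (π.app W.1 (t W)) = X.presheaf.map _ (π.app W'.1 (t W'))
    rw [ht, ht, ← ConcreteCategory.comp_apply, ← ConcreteCategory.comp_apply, ← X.presheaf.map_comp,
      ← X.presheaf.map_comp]
    rfl
  obtain ⟨r, hr, -⟩ := TopCat.Sheaf.existsUnique_gluing' Y.sheaf (fun W : T => W.1) U
    (fun W => homOfLE W.2.2) (iSup_invariantChart hV hcov U) t hcompat
  refine ⟨r, TopCat.Sheaf.eq_of_locally_eq' X.sheaf (fun W : T => π ⁻¹ᵁ W.1) (π ⁻¹ᵁ U)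
    (fun W => homOfLE (π.preimage_mono W.2.2)) ?_ _ _ fun W => ?_⟩
  · intro x hx
    obtain ⟨W, hW⟩ := TopologicalSpace.Opens.mem_iSup.1 (iSup_invariantChart hV hcov U hx)
    exact TopologicalSpace.Opens.mem_iSup.2 ⟨W, hW⟩
  · have h := Scheme.Hom.naturality π (homOfLE W.2.2).op
    refine (congr($h r)).symm.trans (Eq.trans ?_ (ht W))
    exact congrArg (π.app W.1) (hr W)

end LocalQuotient

/-! ### Geometry of the quotient -/

section QuotientGeometry

open scoped Pointwise

variable {G : Type} [CommGroup G] {X Y : Scheme.{u}} {ρ : G →* Aut X} {π : X ⟶ Y}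
  {hπ : ∀ g, (ρ g).hom ≫ π = π} {V : Y.Opens}

theorem action_fromSpec (hV : IsInvariantChart hπ V) (g : G) (z : Spec Γ(X, π ⁻¹ᵁ V)) :
    (ρ g).hom (hV.isAffineOpen_preimage.fromSpec z) =
      hV.isAffineOpen_preimage.fromSpec (PrimeSpectrum.comap (sectionAct hπ V g) z) := by
  have h := IsAffineOpen.SpecMap_appLE_fromSpec (ρ g).hom hV.isAffineOpen_preimage
    hV.isAffineOpen_preimage (preimage_le_preimage hπ V g)
  exact congr($h.symm z)

theorem app_fromSpec (hV : IsInvariantChart hπ V) (z : Spec Γ(X, π ⁻¹ᵁ V)) :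
    π (hV.isAffineOpen_preimage.fromSpec z) =
      hV.isAffineOpen.fromSpec (PrimeSpectrum.comap (π.app V).hom z) := by
  have h := IsAffineOpen.SpecMap_appLE_fromSpec π hV.isAffineOpen hV.isAffineOpen_preimage le_rfl
  rw [Scheme.Hom.appLE_eq_app] at h
  exact congr($h.symm z)

theorem isIntegral_app [Finite G] (hV : IsInvariantChart hπ V) : (π.app V).hom.IsIntegral := by
  algebraize [(π.app V).hom]
  let := sectionAction hπ V
  have : Algebra.IsInvariant Γ(Y, V) Γ(X, π ⁻¹ᵁ V) G := ⟨hV.mem_range⟩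
  exact (Algebra.IsInvariant.isIntegral Γ(Y, V) Γ(X, π ⁻¹ᵁ V) G).isIntegral

/-- The group permutes transitively the prime ideals over a prime ideal of the ring of invariants. -/
theorem exists_action_eq [Finite G] (hV : IsInvariantChart hπ V) {x y : X} (hx : x ∈ π ⁻¹ᵁ V)
    (hxy : π x = π y) : ∃ g, (ρ g).hom x = y := by
  have hy : y ∈ π ⁻¹ᵁ V := by
    change π y ∈ V
    rw [← hxy]
    exact hx
  rw [← hV.isAffineOpen_preimage.opensRange_fromSpec] at hx hy
  obtain ⟨P, rfl⟩ := hx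
  obtain ⟨Q, rfl⟩ := hy
  rw [app_fromSpec hV, app_fromSpec hV] at hxy
  have h := hV.isAffineOpen.fromSpec.isOpenEmbedding.injective hxy
  algebraize [(π.app V).hom]
  let := sectionAction hπ V
  have : Algebra.IsInvariant Γ(Y, V) Γ(X, π ⁻¹ᵁ V) G := ⟨hV.mem_range⟩
  have : SMulCommClass G Γ(Y, V) Γ(X, π ⁻¹ᵁ V) := ⟨fun g c b => by
    rw [Algebra.smul_def, Algebra.smul_def, smul_mul']
    congr 1
    exact sectionAct_app hπ V g c⟩
  have := P.isPrime
  have := Q.isPrime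
  obtain ⟨g, hg⟩ := Algebra.IsInvariant.exists_smul_of_under_eq Γ(Y, V) Γ(X, π ⁻¹ᵁ V) G P.asIdeal
    Q.asIdeal (congrArg PrimeSpectrum.asIdeal h)
  refine ⟨g⁻¹, ?_⟩
  rw [action_fromSpec hV]
  congr 1
  refine PrimeSpectrum.ext (Ideal.ext fun b => ?_)
  rw [hg, Ideal.mem_pointwise_smul_iff_inv_smul_mem]
  rfl

/-- A group acting without fixed closed points acts freely: at a maximal ideal containing all
`g b - b`, the closed point would be fixed by `g`. -/
theorem finite_and_etale_app [Finite G] [JacobsonSpace X] (hV : IsInvariantChart hπ V)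
    (hfree : ∀ g, g ≠ 1 → ∀ x : X, IsClosed {x} → (ρ g).hom x ≠ x) :
    (π.app V).hom.Finite ∧ (π.app V).hom.Etale := by
  algebraize [(π.app V).hom]
  let := sectionAction hπ V
  have : Algebra.IsInvariant Γ(Y, V) Γ(X, π ⁻¹ᵁ V) G := ⟨hV.mem_range⟩
  have : SMulCommClass G Γ(Y, V) Γ(X, π ⁻¹ᵁ V) := ⟨fun g c b => by
    rw [Algebra.smul_def, Algebra.smul_def, smul_mul']
    congr 1
    exact sectionAct_app hπ V g c⟩
  refine finite_and_etale_of_free (G := G) (C := Γ(Y, V)) (B := Γ(X, π ⁻¹ᵁ V)) hV.injective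
    fun g hg => ?_
  by_contra hne
  obtain ⟨m, hm, hle⟩ := Ideal.exists_le_maximal _ hne
  let z : Spec Γ(X, π ⁻¹ᵁ V) := ⟨m, hm.isPrime⟩
  have hz : IsClosed {z} := (PrimeSpectrum.isClosed_singleton_iff_isMaximal z).2 hm
  have hcl : IsClosed {hV.isAffineOpen_preimage.fromSpec z} := by
    refine isClosed_singleton_of_isLocallyClosed_singleton ?_
    rw [← Set.image_singleton]
    exact hz.isLocallyClosed.image hV.isAffineOpen_preimage.fromSpec.isOpenEmbedding.isInducing
      hV.isAffineOpen_preimage.fromSpec.isOpenEmbedding.isOpen_range.isLocallyClosed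
  refine hfree g hg _ hcl ?_
  rw [action_fromSpec hV]
  congr 1
  refine PrimeSpectrum.ext (Ideal.ext fun b => ?_)
  have hb : sectionAct hπ V g b - b ∈ m := hle (Ideal.subset_span ⟨b, rfl⟩)
  change sectionAct hπ V g b ∈ m ↔ b ∈ m
  exact ⟨fun h => by simpa using m.sub_mem h hb, fun h => by simpa using m.add_mem hb h⟩

theorem comap_app_surjective [Finite G] (hV : IsInvariantChart hπ V) :
    Function.Surjective (PrimeSpectrum.comap (π.app V).hom) := by
  have h := isIntegral_app hV
  algebraize [(π.app V).hom]
  have : FaithfulSMul Γ(Y, V) Γ(X, π ⁻¹ᵁ V) :=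
    (faithfulSMul_iff_algebraMap_injective _ _).2 hV.injective
  exact Algebra.IsIntegral.comap_surjective Γ(Y, V) Γ(X, π ⁻¹ᵁ V)

/-- Smoothness descends along a surjective finite étale morphism. -/
theorem smooth_of_finite_etale {k C B : Type u} [Field k] [CommRing C] [CommRing B] (φ : k →+* C)
    (f : C →+* B) (hinj : Function.Injective f) (hsurj : Function.Surjective (PrimeSpectrum.comap f))
    (hfin : f.Finite) (het : f.Etale) (h : (f.comp φ).Smooth) : φ.Smooth := by
  algebraize [φ, f, f.comp φ]
  have : Algebra.FiniteType k C :=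
    ⟨fg_of_fg_of_fg k C B (Algebra.FiniteType.out (R := k) (A := B)) Module.Finite.fg_top hinj⟩
  have : Algebra.FinitePresentation k C := Algebra.FinitePresentation.of_finiteType.1 this
  have : Module.FaithfullyFlat C B := .of_comap_surjective hsurj
  exact smooth_of_etale_of_smooth k (C := C) (B := B)

variable {ι : Type*} {V : ι → Y.Opens}

theorem surjective_of_invariantChart [Finite G] (hV : ∀ i, IsInvariantChart hπ (V i))
    (hcov : ⨆ i, V i = ⊤) : Function.Surjective π := fun y => by
  obtain ⟨i, hi⟩ := TopologicalSpace.Opens.mem_iSup.1 (hcov.ge (Set.mem_univ y))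
  rw [← (hV i).isAffineOpen.opensRange_fromSpec] at hi
  obtain ⟨z, rfl⟩ := hi
  obtain ⟨w, rfl⟩ := comap_app_surjective (hV i) z
  exact ⟨_, app_fromSpec (hV i) w⟩

theorem iSup_preimage_eq_top (hcov : ⨆ i, V i = ⊤) : ⨆ i, π ⁻¹ᵁ V i = ⊤ := by
  refine eq_top_iff.2 fun x _ => ?_
  obtain ⟨i, hi⟩ := TopologicalSpace.Opens.mem_iSup.1 (hcov.ge (Set.mem_univ (π x)))
  exact TopologicalSpace.Opens.mem_iSup.2 ⟨i, hi⟩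

theorem etale_of_invariantChart [Finite G] [JacobsonSpace X] (hV : ∀ i, IsInvariantChart hπ (V i))
    (hcov : ⨆ i, V i = ⊤) (hfree : ∀ g, g ≠ 1 → ∀ x : X, IsClosed {x} → (ρ g).hom x ≠ x) :
    Etale π := by
  have : IsZariskiLocalAtSource @Etale.{u} := HasRingHomProperty.instIsZariskiLocalAtSource
  refine IsZariskiLocalAtSource.of_iSup_eq_top (P := @Etale) _ (iSup_preimage_eq_top (π := π) hcov)
    fun i => ?_
  have h1 : Etale (Spec.map (π.app (V i))) :=
    (HasRingHomProperty.Spec_iff (P := @Etale)).2 (finite_and_etale_app (hV i) hfree).2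
  have h := IsAffineOpen.SpecMap_appLE_fromSpec π (hV i).isAffineOpen
    (hV i).isAffineOpen_preimage le_rfl
  rw [Scheme.Hom.appLE_eq_app] at h
  have h2 : (π ⁻¹ᵁ V i).ι ≫ π = (hV i).isAffineOpen_preimage.isoSpec.hom ≫
      Spec.map (π.app (V i)) ≫ (hV i).isAffineOpen.fromSpec := by
    rw [h, ← (hV i).isAffineOpen_preimage.isoSpec_inv_ι, Category.assoc, Iso.hom_inv_id_assoc]
  rw [h2]
  infer_instance

/-- The topology is the quotient topology because `π`, being étale, is open. -/
theorem isQuotient_of_invariantChart [Finite G] [JacobsonSpace X]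
    (hV : ∀ i, IsInvariantChart hπ (V i)) (hcov : ⨆ i, V i = ⊤)
    (hfree : ∀ g, g ≠ 1 → ∀ x : X, IsClosed {x} → (ρ g).hom x ≠ x) : IsQuotient ρ π where
  invariant := hπ
  isQuotientMap :=
    have := etale_of_invariantChart hV hcov hfree
    π.isOpenMap.isQuotientMap π.continuous (surjective_of_invariantChart hV hcov)
  eq_iff x y := by
    refine ⟨fun h => ?_, ?_⟩
    · obtain ⟨i, hi⟩ := TopologicalSpace.Opens.mem_iSup.1 (hcov.ge (Set.mem_univ (π x)))
      exact exists_action_eq (hV i) hi h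
    · rintro ⟨g, rfl⟩
      exact congr($((hπ g).symm) x)
  app_injective := app_injective_of_invariantChart hV hcov
  range_app := range_app_of_invariantChart hV hcov

theorem smooth_of_invariantChart [Finite G] [JacobsonSpace X] {k : Type u} [Field k]
    (hV : ∀ i, IsInvariantChart hπ (V i)) (hcov : ⨆ i, V i = ⊤)
    (hfree : ∀ g, g ≠ 1 → ∀ x : X, IsClosed {x} → (ρ g).hom x ≠ x) (s : Y ⟶ Spec (.of k))
    [Smooth (π ≫ s)] : Smooth s := by
  have : IsZariskiLocalAtSource @Smooth.{u} := HasRingHomProperty.instIsZariskiLocalAtSource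
  refine IsZariskiLocalAtSource.of_iSup_eq_top (P := @Smooth) _ hcov fun i => ?_
  obtain ⟨φ, hφ⟩ := Spec.map_surjective ((hV i).isAffineOpen.fromSpec ≫ s)
  have h := IsAffineOpen.SpecMap_appLE_fromSpec π (hV i).isAffineOpen
    (hV i).isAffineOpen_preimage le_rfl
  rw [Scheme.Hom.appLE_eq_app] at h
  have h1 : Smooth (Spec.map (φ ≫ π.app (V i))) := by
    rw [Spec.map_comp, hφ, ← Category.assoc, h, Category.assoc]
    infer_instance
  have h2 : (φ ≫ π.app (V i)).hom.Smooth := (HasRingHomProperty.Spec_iff (P := @Smooth)).1 h1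
  have h3 : φ.hom.Smooth := by
    have hsurj := comap_app_surjective (hV i)
    obtain ⟨hfin, het⟩ := finite_and_etale_app (hV i) hfree
    exact smooth_of_finite_etale φ.hom (π.app (V i)).hom (hV i).injective hsurj hfin het h2
  have h4 : Smooth (Spec.map φ) := (HasRingHomProperty.Spec_iff (P := @Smooth)).2 h3
  have h5 : (V i).ι ≫ s = (hV i).isAffineOpen.isoSpec.hom ≫ Spec.map φ := by
    rw [hφ, ← (hV i).isAffineOpen.isoSpec_inv_ι, Category.assoc, Iso.hom_inv_id_assoc]
  rw [h5]
  infer_instance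

/-- Both dimensions are computed on the charts, where `π` is an integral extension of rings. -/
theorem topologicalKrullDim_of_invariantChart [Finite G] [Nonempty X]
    (hV : ∀ i, IsInvariantChart hπ (V i)) (hcov : ⨆ i, V i = ⊤) :
    topologicalKrullDim Y = topologicalKrullDim X := by
  have hdim (i : ι) : topologicalKrullDim (Spec Γ(Y, V i)) =
      topologicalKrullDim (Spec Γ(X, π ⁻¹ᵁ V i)) := by
    have h := isIntegral_app (hV i)
    algebraize [(π.app (V i)).hom]
    exact (PrimeSpectrum.topologicalKrullDim_eq_ringKrullDim _).trans
      ((ringKrullDim_eq_of_isIntegral (hV i).injective).trans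
        (PrimeSpectrum.topologicalKrullDim_eq_ringKrullDim _).symm)
  have : Nonempty Y := .map π inferInstance
  rw [topologicalKrullDim_eq_iSup_of_cover
      (fun i => (hV i).isAffineOpen.fromSpec) (fun i => Scheme.Hom.isOpenEmbedding _) fun y => ?_,
    topologicalKrullDim_eq_iSup_of_cover
      (fun i => (hV i).isAffineOpen_preimage.fromSpec) (fun i => Scheme.Hom.isOpenEmbedding _)
      fun x => ?_]
  · exact iSup_congr hdim
  · obtain ⟨i, hi⟩ := TopologicalSpace.Opens.mem_iSup.1
      ((iSup_preimage_eq_top (π := π) hcov).ge (Set.mem_univ x))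
    rw [← (hV i).isAffineOpen_preimage.opensRange_fromSpec] at hi
    exact ⟨i, hi⟩
  · obtain ⟨i, hi⟩ := TopologicalSpace.Opens.mem_iSup.1 (hcov.ge (Set.mem_univ y))
    rw [← (hV i).isAffineOpen.opensRange_fromSpec] at hi
    exact ⟨i, hi⟩

end QuotientGeometry

/-! ### The quotient of a projective scheme by a free action -/

section ProjectiveQuotient

attribute [local instance] MvPolynomial.gradedAlgebra

/-- The scheme-theoretic image of a proper morphism; it is also the set-theoretic image. -/
theorem exists_image_factorization {X Z : Scheme.{u}} (φ : X ⟶ Z) [IsProper φ] :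
    ∃ (Y : Scheme.{u}) (π : X ⟶ Y) (i : Y ⟶ Z), φ = π ≫ i ∧ IsClosedImmersion i ∧
      Function.Surjective π ∧ ∀ V, IsAffineOpen V → Function.Injective (π.app (i ⁻¹ᵁ V)) := by
  refine ⟨φ.image, φ.toImage, φ.imageι, φ.toImage_imageι.symm, inferInstance, ?_,
    fun V hV => φ.toImage_app_injective ⟨V, hV⟩⟩
  rw [← Set.range_eq_univ, ← φ.toImage.isClosedMap.isClosed_range.closure_eq]
  exact φ.toImage.denseRange.closure_eq

variable {k : Type u} [Field k] {S : Type u} [CommRing S] [Algebra k S]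
  {𝒮 : ℕ → Submodule k S} [GradedAlgebra 𝒮] {G : Type} [CommGroup G]
  (θ : G →* (S ≃ₐ[k] S)) (hθ : ∀ g n, ∀ a ∈ 𝒮 n, θ g a ∈ 𝒮 n)

/-- The quotient is the image of the morphism to a projective space given by sufficiently many
invariant forms. -/
theorem exists_projective_quotient [Finite G] [Algebra.FiniteType k S]
    (h0 : Function.Surjective (algebraMap k (𝒮 0))) {σ : Type} [Finite σ] [Nonempty σ] {x : σ → S}
    (hx : ∀ i, x i ∈ 𝒮 1) (hcov : ⨆ i, Proj.basicOpen 𝒮 (x i) = ⊤) [Smooth (projToSpec 𝒮)]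
    [IrreducibleSpace (Proj 𝒮)]
    (hfree : ∀ g, g ≠ 1 → ∀ x : Proj 𝒮, IsClosed {x} → (projAction θ hθ g).hom x ≠ x) :
    ∃ (Y : Scheme.{u}) (π : Proj 𝒮 ⟶ Y) (s : Y ⟶ Spec (.of k)),
      IsQuotient (projAction θ hθ) π ∧ π ≫ s = projToSpec 𝒮 ∧ Etale π ∧ Smooth s ∧
      IrreducibleSpace Y ∧ IsProjective s ∧
      topologicalKrullDim Y = topologicalKrullDim (Proj 𝒮) := by
  obtain ⟨N, φ, hφ, J, V, hφk, hV, hφV, hVcov, hinv⟩ :=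
    exists_invariant_morphism θ hθ h0 hx hcov
  have hproper : IsProper φ := by
    have : IsProper (projToSpec 𝒮) := isProper_projToSpec 𝒮 h0
    have h1 : IsProper (φ ≫ ProjSpace.toSpec (Fin (N + 1)) k) := by rwa [hφk]
    have : IsSeparated (ProjSpace.toSpec (Fin (N + 1)) k) := by
      change IsSeparated (Proj.toSpecZero _ ≫ Spec.map _)
      infer_instance
    exact IsProper.of_comp φ (ProjSpace.toSpec (Fin (N + 1)) k)
  obtain ⟨Y, π, i, rfl, hi, hsurj, hinj⟩ := exists_image_factorization φ
  have hπ (g : G) : (projAction θ hθ g).hom ≫ π = π := by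
    rw [← cancel_mono i, Category.assoc, hφ g]
  have hchart (j : J) : IsInvariantChart hπ (i ⁻¹ᵁ V j) :=
    ⟨(hV j).preimage i, hφV j, hinj _ (hV j), fun t ht => by
      obtain ⟨c, hc⟩ := hinv j t ht
      refine ⟨i.app (V j) c, ?_⟩
      rw [Scheme.Hom.comp_app] at hc
      exact hc⟩
  have hcovY : ⨆ j, i ⁻¹ᵁ V j = ⊤ := by
    refine eq_top_iff.2 fun y _ => ?_
    obtain ⟨z, rfl⟩ := hsurj y
    obtain ⟨j, hj⟩ := TopologicalSpace.Opens.mem_iSup.1 (hVcov.ge (Set.mem_univ z))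
    exact TopologicalSpace.Opens.mem_iSup.2 ⟨j, hj⟩
  have : JacobsonSpace (Proj 𝒮) := LocallyOfFiniteType.jacobsonSpace (projToSpec 𝒮)
  have hs : π ≫ i ≫ ProjSpace.toSpec (Fin (N + 1)) k = projToSpec 𝒮 := by
    rw [← hφk, Category.assoc]
  have : Smooth (π ≫ i ≫ ProjSpace.toSpec (Fin (N + 1)) k) := by
    rw [hs]
    infer_instance
  exact ⟨Y, π, i ≫ ProjSpace.toSpec (Fin (N + 1)) k,
    isQuotient_of_invariantChart hchart hcovY hfree, hs,
    etale_of_invariantChart hchart hcovY hfree, smooth_of_invariantChart hchart hcovY hfree _,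
    hsurj.irreducibleSpace π.continuous, ⟨N, i, hi, rfl⟩,
    topologicalKrullDim_of_invariantChart hchart hcovY⟩

end ProjectiveQuotient

section CoordinateRing

open MvPolynomial

attribute [local instance] MvPolynomial.gradedAlgebra

theorem surjective_algebraMap_coordGrading_zero {σ : Type} {k : Type u} [Field k]
    {F : MvPolynomial σ k} {d : ℕ} (hF : F.IsHomogeneous d) :
    letI := quotGradedAlgebra (homogeneousSubmodule σ k) (span_isHomogeneous hF)
    Function.Surjective (algebraMap k (coordGrading F 0)) := by
  rintro ⟨_, q, hq, rfl⟩
  have hq' : q ∈ (1 : Submodule k (MvPolynomial σ k)) := by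
    rw [← homogeneousSubmodule_zero]
    exact hq
  obtain ⟨c, rfl⟩ := Submodule.mem_one.1 hq'
  exact ⟨c, rfl⟩

end CoordinateRing

end CyclicQuotient

end

open CyclicQuotient in
theorem theorem5p1 (p : ℕ) [Fact p.Prime] (hp : 2 < p)
    (k : Type u) [Field k] [IsAlgClosed k] [CharP k p] :
    IsHypersurface (hypersurface.ι p k) p ∧
    Smooth (hypersurface.toSpec p k) ∧
    IrreducibleSpace (hypersurface p k) ∧
    topologicalKrullDim (hypersurface p k) = ((p - 2 : ℕ) : WithBot ℕ∞) ∧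
    ∃ ρ : Multiplicative (ZMod p) →* Aut (hypersurface p k),
      (∀ g, (ρ g).hom ≫ hypersurface.ι p k =
        hypersurface.ι p k ≫ (shiftAction k p g).hom) ∧
      (∀ g, g ≠ 1 → ∀ x : hypersurface p k, IsClosed {x} → (ρ g).hom x ≠ x) ∧
      ∃ (Y : Scheme.{u}) (π : hypersurface p k ⟶ Y) (s : Y ⟶ Spec (.of k)),
        IsQuotient ρ π ∧
        π ≫ s = hypersurface.toSpec p k ∧
        Etale π ∧
        Smooth s ∧
        IrreducibleSpace Y ∧
        IsProjective s ∧
        topologicalKrullDim Y = ((p - 2 : ℕ) : WithBot ℕ∞) := by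
  refine ⟨isHypersurface_ι p k, smooth_hypersurface p k hp, irreducibleSpace_hypersurface p k hp,
    topologicalKrullDim_hypersurface p k hp, hypersurfaceAction p k, hypersurfaceAction_ι p k,
    fun g hg x hx => hypersurfaceAction_ne hp hg hx, ?_⟩
  have hsm : Smooth (projToSpec (coordGrading (poly p k))) := by
    rw [← hypersurface_toSpec]
    exact smooth_hypersurface p k hp
  have hirr : IrreducibleSpace (Proj (coordGrading (poly p k))) :=
    irreducibleSpace_hypersurface p k hp
  have hft : Algebra.FiniteType k (MvPolynomial (ZMod p) k ⧸ Ideal.span {poly p k}) :=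
    .of_surjective (Ideal.Quotient.mkₐ k _) Ideal.Quotient.mk_surjective
  obtain ⟨Y, π, s, h1, h2, h3, h4, h5, h6, h7⟩ := exists_projective_quotient (shift p k)
    (shift_mem p k) (surjective_algebraMap_coordGrading_zero (poly_isHomogeneous p k))
    (coordX_mem (poly p k)) (iSup_basicOpen_coordX p k)
    fun g hg x hx => hypersurfaceAction_ne hp hg hx
  exact ⟨Y, π, s, h1, h2.trans (hypersurface_toSpec p k).symm, h3, h4, h5, h6,
    h7.trans (topologicalKrullDim_hypersurface p k hp)⟩
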